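/- **Setting.** Let $\mathcal I,\mathcal J,\mathcal S$ be finite index sets (encoders, decoders, messages), let $\mathcal S$ be the disjoint union of $\mathcal S_0$ (messages available to all encoders) and the sets $\mathcal S_i$, $i\in\mathcal I$ (messages available only to Encoder $i$), and let $\mathcal D_j\subset\mathcal S$, $j\in\mathcal J$, be the set of messages reproduced by Decoder $j$. Write $a_{\mathcal T}=\{a_s\}_{s\in\mathcal T}$. For every block length $n$ let $\mathcal Z^n_s$ be finite non-empty alphabets and $\mathcal X^n_i,\mathcal Y^n_j$ arbitrary measurable spaces, and fix a distribution $\mu_{Z^n_{\mathcal S_0}}$, conditional distributions $\mu_{Z^n_{\mathcal S_i}|Z^n_{\mathcal S_0}}$ and $\mu_{X^n_i|Z^n_{\mathcal S_0}Z^n_{\mathcal S_i}}$, and a channel $\mu_{Y^n_{\mathcal J}|X^n_{\mathcal I}}$ (no stationarity or memorylessness is assumed). The joint law of $(Z^n_{\mathcal S},X^n_{\mathcal I},Y^n_{\mathcal J})$ is the one for which $$\mu_{Z^n_{\mathcal S}}(z_{\mathcal S})=\mu_{Z^n_{\mathcal S_0}}(z_{\mathcal S_0})\prod_{i\in\mathcal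 I}\mu_{Z^n_{\mathcal S_i}|Z^n_{\mathcal S_0}}(z_{\mathcal S_i}|z_{\mathcal S_0}),$$ the $X^n_i$ are conditionally independent given $Z^n_{\mathcal S}$ with laws $\mu_{X^n_i|Z^n_{\mathcal S_0}Z^n_{\mathcal S_i}}$, and $Y^n_{\mathcal J}$ is the channel output for the input $X^n_{\mathcal I}$. With $\text{p-limsup}\,U_n=\inf\{\theta:\Pr(U_n>\theta)\to0\}$ and $\text{p-liminf}\,U_n=\sup\{\theta:\Pr(U_n<\theta)\to0\}$ put $\underline H(\boldsymbol U)=\text{p-liminf}\frac1n\log_2\frac1{\mu_{U_n}(U_n)}$, $\underline H(\boldsymbol U|\boldsymbol V)=\text{p-liminf}\frac1n\log_2\frac1{\mu_{U_n|V_n}(U_n|V_n)}$ and $\overline H(\boldsymbol U|\boldsymbol V)=\text{p-limsup}\frac1n\log_2\frac1{\mu_{U_n|V_n}(U_n|V_n)}$. **Code.** Let $\mathcal C_{s,n},\mathcal M_{s,n}$ be finite non-empty sets. Given $f_s:\mathcal Z^n_s\to\mathcal C_{s,n}$, $g_s:\mathcal Z^n_s\to\mathcal M_{s,n}$ and $c_s\in\mathcal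 C_{s,n}$ for $s\in\mathcal S$, the messages $m_s\in\mathcal M_{s,n}$ are independent and uniformly distributed. The encoders generate a shared $\widetilde z_{\mathcal S_0}$ from $\mu_{Z^n_{\mathcal S_0}}$ conditioned on $f_s(z_s)=c_s$, $g_s(z_s)=m_s$ for all $s\in\mathcal S_0$; Encoder $i$ generates (independently of the other encoders given $\widetilde z_{\mathcal S_0}$) $\widetilde z_{\mathcal S_i}$ from $\mu_{Z^n_{\mathcal S_i}|Z^n_{\mathcal S_0}}(\cdot|\widetilde z_{\mathcal S_0})$ conditioned on $f_s(z_s)=c_s$, $g_s(z_s)=m_s$ for all $s\in\mathcal S_i$, and sends $x_i$ drawn from $\mu_{X^n_i|Z^n_{\mathcal S_0}Z^n_{\mathcal S_i}}(\cdot|\widetilde z_{\mathcal S_0},\widetilde z_{\mathcal S_i})$. An error is claimed if one of these conditioning events has probability zero. Decoder $j$, receiving $y_j$, generates $\widehat z_{\mathcal D_j}$ from $\mu_{Z^n_{\mathcal D_j}|Y^n_j}(\cdot|y_j)$ conditioned on $f_s(z_s)=c_s$ for all $s\in\mathcal D_j$ and outputs $\widehat m_{j,s}=g_s(\widehat z_{j,s})$,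 $s\in\mathcal D_j$ (it fails if the conditioning event has probability zero). $\mathrm{Error}(f_{\mathcal S},g_{\mathcal S},c_{\mathcal S})$ is the probability that an error is claimed, a decoder fails, or $\widehat m_{j,s}\ne m_s$ for some $j\in\mathcal J$, $s\in\mathcal D_j$. **Ensembles.** An ensemble $(\mathcal F,p)$ is a set of functions $\mathcal F$ from a finite set $\mathcal Z$ with a probability distribution $p$ on it; $\mathrm{Im}\,\mathcal F=\bigcup_{f\in\mathcal F}f(\mathcal Z)$. A sequence of ensembles $(\mathcal F_n,p_n)$ of functions on $\mathcal Z_n$ has the hash property if there are $\alpha_n\to1$, $\beta_n\to0$ with $$\sum_{\substack{z'\neq z:\\ p_n(\{f:f(z)=f(z')\})>\alpha_n/|\mathrm{Im}\,\mathcal F_n|}}p_n(\{f:f(z)=f(z')\})\le\beta_n\quad\text{for all }n\text{ and }z\in\mathcal Z_n.$$ **Theorem.** Suppose $\frac1n\log_2|\mathcal C_{s,n}|\to r_s$ and $\frac1n\log_2|\mathcal M_{s,n}|\to R_s$ for all $s\in\mathcal S$, and $$\sum_{s\in\mathcal T}(R_s+r_s)<\underline H(\boldsymbol Z_{\mathcal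 T})\quad(\emptyset\ne\mathcal T\subset\mathcal S_0),$$ $$\sum_{s\in\mathcal T}(R_s+r_s)<\underline H(\boldsymbol Z_{\mathcal T}|\boldsymbol Z_{\mathcal S_0})\quad(i\in\mathcal I,\ \emptyset\ne\mathcal T\subset\mathcal S_i),$$ $$\sum_{s\in\mathcal T}r_s>\overline H(\boldsymbol Z_{\mathcal T}|\boldsymbol Y_j,\boldsymbol Z_{\mathcal D_j\setminus\mathcal T})\quad(j\in\mathcal J,\ \emptyset\ne\mathcal T\subset\mathcal D_j).$$ Then: 1. For every $\delta>0$ and all sufficiently large $n$ there are functions $f_s:\mathcal Z^n_s\to\mathcal C_{s,n}$, $g_s:\mathcal Z^n_s\to\mathcal M_{s,n}$ and $c_s\in\mathcal C_{s,n}$ ($s\in\mathcal S$) with $\mathrm{Error}(f_{\mathcal S},g_{\mathcal S},c_{\mathcal S})\le\delta$. 2. Moreover, if for every $s\in\mathcal S$ sequences of ensembles $(\mathcal F_{s,n},p_{F_{s,n}})$ and $(\mathcal G_{s,n},p_{G_{s,n}})$ of functions on $\mathcal Z^n_s$ with $\mathrm{Im}\,\mathcal F_{s,n}=\mathcal C_{s,n}$,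 $\mathrm{Im}\,\mathcal G_{s,n}=\mathcal M_{s,n}$ and the hash property are given, then for every $\delta>0$ and all sufficiently large $n$ such $f_s$ and $g_s$ exist within these ensembles (each with positive probability under $p_{F_{s,n}}$, $p_{G_{s,n}}$ respectively), together with $c_s\in\mathcal C_{s,n}$. -/

import Mathlib

open MeasureTheory ProbabilityTheory Filter Topology
open scoped ENNReal

noncomputable section

/-! ### Limits in probability and spectral entropy rates

The probability space may change with the block length `n`: `P n` is a law on `Ω n`. -/

section Spectrum

variable {Ω : ℕ → Type*} [∀ n, MeasurableSpace (Ω n)]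

/-- `p-limsup U_n = inf {θ : Prob (U_n > θ) → 0}`, as an extended real. -/
def pLimsup (P : ∀ n, Measure (Ω n)) (U : ∀ n, Ω n → ℝ) : EReal :=
  sInf ((fun θ : ℝ => (θ : EReal)) ''
    {θ : ℝ | Tendsto (fun n => P n {ω | θ < U n ω}) atTop (𝓝 0)})

/-- `p-liminf U_n = sup {θ : Prob (U_n < θ) → 0}`, as an extended real. -/
def pLiminf (P : ∀ n, Measure (Ω n)) (U : ∀ n, Ω n → ℝ) : EReal :=
  sSup ((fun θ : ℝ => (θ : EReal)) ''
    {θ : ℝ | Tendsto (fun n => P n {ω | U n ω < θ}) atTop (𝓝 0)})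

variable {𝒰 : ℕ → Type*} [∀ n, MeasurableSpace (𝒰 n)]
  {𝒱 : ℕ → Type*} [∀ n, MeasurableSpace (𝒱 n)]

/-- The spectral inf-entropy rate of a sequence of discrete random variables:
`p-liminf (1/n) log₂ (1 / μ_{U_n}(U_n))`. -/
def spectralInfEntropy (P : ∀ n, Measure (Ω n)) (U : ∀ n, Ω n → 𝒰 n) : EReal :=
  pLiminf P fun n ω => (1 / (n : ℝ)) * Real.logb 2 (1 / ((P n).map (U n)).real {U n ω})

/-- `(1/n) log₂ (1 / μ_{U_n|V_n}(U_n|V_n))` for a discrete `U_n` and an arbitrary `V_n`; the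
conditional law is the regular conditional distribution. -/
def condEntropyDensity [∀ n, StandardBorelSpace (𝒰 n)] [∀ n, Nonempty (𝒰 n)]
    (P : ∀ n, Measure (Ω n)) [∀ n, IsFiniteMeasure (P n)]
    (U : ∀ n, Ω n → 𝒰 n) (V : ∀ n, Ω n → 𝒱 n) (n : ℕ) (ω : Ω n) : ℝ :=
  (1 / (n : ℝ)) *
    Real.logb 2 (1 / (condDistrib (U n) (V n) (P n) (V n ω)).real {U n ω})

/-- The spectral conditional inf-entropy rate. -/
def spectralCondInfEntropy [∀ n, StandardBorelSpace (𝒰 n)] [∀ n, Nonempty (𝒰 n)]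
    (P : ∀ n, Measure (Ω n)) [∀ n, IsFiniteMeasure (P n)]
    (U : ∀ n, Ω n → 𝒰 n) (V : ∀ n, Ω n → 𝒱 n) : EReal :=
  pLiminf P (condEntropyDensity P U V)

/-- The spectral conditional sup-entropy rate. -/
def spectralCondSupEntropy [∀ n, StandardBorelSpace (𝒰 n)] [∀ n, Nonempty (𝒰 n)]
    (P : ∀ n, Measure (Ω n)) [∀ n, IsFiniteMeasure (P n)]
    (U : ∀ n, Ω n → 𝒰 n) (V : ∀ n, Ω n → 𝒱 n) : EReal :=
  pLimsup P (condEntropyDensity P U V)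

end Spectrum

/-! ### Ensembles of functions and the hash property -/

/-- An ensemble: a set of functions `𝒵 → 𝒞` with a probability distribution on it. -/
structure FunctionEnsemble (𝒵 𝒞 : Type*) where
  funs : Set (𝒵 → 𝒞)
  prob : PMF (𝒵 → 𝒞)
  support_subset : prob.support ⊆ funs

namespace FunctionEnsemble

variable {𝒵 𝒞 : Type*}

/-- `Im ℱ`, the union of the ranges of the functions of the ensemble. -/
def image (F : FunctionEnsemble 𝒵 𝒞) : Set 𝒞 := {c | ∃ f ∈ F.funs, ∃ z, f z = c}

/-- `p_F({f : f(z) = f(z')})`. -/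
def collisionProb (F : FunctionEnsemble 𝒵 𝒞) (z z' : 𝒵) : ℝ :=
  (F.prob.toOuterMeasure {f | f z = f z'}).toReal

open scoped Classical in
/-- The `(α, β)`-hash property at one block length. -/
def HasHashProperty [Fintype 𝒵] (F : FunctionEnsemble 𝒵 𝒞) (α β : ℝ) : Prop :=
  ∀ z : 𝒵,
    ∑ z' ∈ Finset.univ.filter
        (fun z' => z' ≠ z ∧ α / (F.image.ncard : ℝ) < F.collisionProb z z'),
      F.collisionProb z z' ≤ β

end FunctionEnsemble

/-- A sequence of ensembles has the hash property: it has the `(α_n, β_n)`-hash property for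
some `α_n → 1` and `β_n → 0`. -/
def HashProperty {𝒵 𝒞 : ℕ → Type*} [∀ n, Fintype (𝒵 n)]
    (F : ∀ n, FunctionEnsemble (𝒵 n) (𝒞 n)) : Prop :=
  ∃ α β : ℕ → ℝ, Tendsto α atTop (𝓝 1) ∧ Tendsto β atTop (𝓝 0) ∧
    ∀ n, (F n).HasHashProperty (α n) (β n)

/-! ### Sources and channel at one block length -/

section Block

variable {I J S : Type*}

/-- The distributions fixed at one block length: the law of `Z_{S₀}`, the conditional laws of
`Z_{Sᵢ}` given `Z_{S₀}`, the conditional laws of `Xᵢ` given `(Z_{S₀}, Z_{Sᵢ})`, and the channel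
from `X_I` to `Y_J`. -/
structure BlockModel (S₀ : Finset S) (SI : I → Finset S)
    (Z : S → Type*) (X : I → Type*) (Y : J → Type*)
    [∀ s, MeasurableSpace (Z s)] [∀ i, MeasurableSpace (X i)]
    [∀ j, MeasurableSpace (Y j)] where
  commonSource : Measure ((s : S₀) → Z s)
  privateSource : ∀ i, Kernel ((s : S₀) → Z s) ((s : SI i) → Z s)
  inputMap : ∀ i, Kernel (((s : S₀) → Z s) × ((s : SI i) → Z s)) (X i)
  channel : Kernel ((i : I) → X i) ((j : J) → Y j)
  isProbabilityMeasure_commonSource : IsProbabilityMeasure commonSource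
  isMarkovKernel_privateSource : ∀ i, IsMarkovKernel (privateSource i)
  isMarkovKernel_inputMap : ∀ i, IsMarkovKernel (inputMap i)
  isMarkovKernel_channel : IsMarkovKernel channel

attribute [instance] BlockModel.isProbabilityMeasure_commonSource
  BlockModel.isMarkovKernel_privateSource BlockModel.isMarkovKernel_inputMap
  BlockModel.isMarkovKernel_channel

/-- For functions `h_s` on `Z_s` and values `v_s`, the set `{z_T : h_s(z_s) = v_s for all s ∈ T}`. -/
def constraintSet {Z V : S → Type*} (T : Finset S) (h : ∀ s, Z s → V s) (v : ∀ s, V s) :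
    Set ((s : T) → Z s) :=
  {z | ∀ s : T, h s (z s) = v s}

namespace BlockModel

variable [Fintype I] {S₀ : Finset S} {SI : I → Finset S}
  {Z : S → Type*} {X : I → Type*} {Y : J → Type*}
  [∀ s, MeasurableSpace (Z s)] [∀ i, MeasurableSpace (X i)] [∀ j, MeasurableSpace (Y j)]

/-- `μ_{Z_S}(z_S) = μ_{Z_{S₀}}(z_{S₀}) ∏ᵢ μ_{Z_{Sᵢ}|Z_{S₀}}(z_{Sᵢ}|z_{S₀})`. -/
def sourceMass (B : BlockModel S₀ SI Z X Y) (z : ∀ s, Z s) : ℝ≥0∞ :=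
  B.commonSource {S₀.restrict z} *
    ∏ i, B.privateSource i (S₀.restrict z) {(SI i).restrict z}

/-- The law of `Z_S`, with point masses `sourceMass`. -/
def sourceLaw (B : BlockModel S₀ SI Z X Y) : Measure (∀ s, Z s) :=
  Measure.sum fun z => B.sourceMass z • Measure.dirac z

instance [Finite S] [∀ s, Finite (Z s)] (B : BlockModel S₀ SI Z X Y) :
    IsFiniteMeasure B.sourceLaw := by
  constructor
  have := Fintype.ofFinite (∀ s, Z s)
  rw [sourceLaw, Measure.sum_apply _ MeasurableSet.univ, tsum_fintype]
  refine ENNReal.sum_lt_top.2 fun z _ => ?_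
  simp only [Measure.smul_apply, measure_univ, smul_eq_mul, mul_one, sourceMass]
  exact ENNReal.mul_lt_top (measure_lt_top _ _)
    (ENNReal.prod_lt_top fun i _ => measure_lt_top _ _)

variable [Finite S] [∀ s, Finite (Z s)] [∀ s, MeasurableSingletonClass (Z s)]

/-- The conditional law of `X_I` given `Z_S`: the `X_i` are generated independently, `X_i` from
`(Z_{S₀}, Z_{Sᵢ})`. -/
def inputKernel (B : BlockModel S₀ SI Z X Y) : Kernel (∀ s, Z s) (∀ i, X i) :=
  Kernel.ofFunOfCountable fun z =>
    Measure.pi fun i => B.inputMap i (S₀.restrict z, (SI i).restrict z)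

instance (B : BlockModel S₀ SI Z X Y) : IsMarkovKernel B.inputKernel :=
  ⟨fun z => by
    change IsProbabilityMeasure
      (Measure.pi fun i => B.inputMap i (S₀.restrict z, (SI i).restrict z))
    infer_instance⟩

/-- The joint law of `(Z_S, Y_J)`. -/
def jointLaw (B : BlockModel S₀ SI Z X Y) : Measure ((∀ s, Z s) × (∀ j, Y j)) :=
  B.sourceLaw ⊗ₘ (B.channel ∘ₖ B.inputKernel)

instance (B : BlockModel S₀ SI Z X Y) : IsFiniteMeasure B.jointLaw := by
  unfold jointLaw
  infer_instance

variable {C M : S → Type*}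

/-- The constrained-random-number generator for `Z_{S₀}`: the law of `Z_{S₀}` conditioned on
`f_{S₀} = c_{S₀}` and `g_{S₀} = m_{S₀}`. It is the zero measure when this event has probability
zero, that is, when the encoders claim an error. -/
def commonGenerator (B : BlockModel S₀ SI Z X Y) (f : ∀ s, Z s → C s) (g : ∀ s, Z s → M s)
    (c : ∀ s, C s) (m : ∀ s, M s) : Measure ((s : S₀) → Z s) :=
  cond B.commonSource (constraintSet S₀ f c ∩ constraintSet S₀ g m)

/-- The constrained-random-number generator of Encoder `i` for `Z_{Sᵢ}` given `z_{S₀}`; again the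
zero measure when the encoder claims an error. -/
def privateGenerator (B : BlockModel S₀ SI Z X Y) (f : ∀ s, Z s → C s) (g : ∀ s, Z s → M s)
    (c : ∀ s, C s) (m : ∀ s, M s) (i : I) (z₀ : (s : S₀) → Z s) :
    Measure ((s : SI i) → Z s) :=
  cond (B.privateSource i z₀) (constraintSet (SI i) f c ∩ constraintSet (SI i) g m)

variable [∀ s, Nonempty (Z s)]

/-- The constrained-random-number generator of a decoder reproducing `Z_T` from `y_j` and `c_T`:
the conditional law of `Z_T` given `Y_j = y_j`, further conditioned on `f_T = c_T`. -/
def decoderGenerator (B : BlockModel S₀ SI Z X Y) (T : Finset S) (f : ∀ s, Z s → C s)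
    (c : ∀ s, C s) (j : J) (y : Y j) : Measure ((s : T) → Z s) :=
  cond (condDistrib (fun ω : (∀ s, Z s) × (∀ j, Y j) => T.restrict ω.1) (fun ω => ω.2 j)
    B.jointLaw y) (constraintSet T f c)

variable [Fintype J]

/-- The probability that, when the message vector is `m`, no encoder claims an error and
`g_s(Ẑ_{j,s}) = m_s` for every decoder `j` and every `s ∈ D_j`. All encoders share `z_{S₀}`; given
it, the encoders randomize independently, and so do the decoders given the channel outputs. -/
def successProbGiven (B : BlockModel S₀ SI Z X Y) (D : J → Finset S)
    (f : ∀ s, Z s → C s) (g : ∀ s, Z s → M s) (c : ∀ s, C s) (m : ∀ s, M s) : ℝ≥0∞ :=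
  ∫⁻ z₀, ∫⁻ zI, ∫⁻ x, ∫⁻ y,
        ∏ j, B.decoderGenerator (D j) f c j (y j) (constraintSet (D j) g m)
      ∂(B.channel x)
    ∂(Measure.pi fun i => B.inputMap i (z₀, zI i))
  ∂(Measure.pi fun i => B.privateGenerator f g c m i z₀)
  ∂(B.commonGenerator f g c m)

/-- The error probability of the code given by `(f_S, g_S, c_S)`, for independent uniformly
distributed messages; an error claimed by an encoder counts as an error. -/
def errorProb [Fintype S] [DecidableEq S] [∀ s, Fintype (M s)]
    (B : BlockModel S₀ SI Z X Y) (D : J → Finset S)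
    (f : ∀ s, Z s → C s) (g : ∀ s, Z s → M s) (c : ∀ s, C s) : ℝ :=
  1 - (∑ m : ∀ s, M s,
    (∏ s, (Fintype.card (M s) : ℝ≥0∞)⁻¹) * B.successProbGiven D f g c m).toReal

end BlockModel

end Block

end

/-! The argument is random coding. All `f_s` and `g_s` are drawn independently from the ensembles,
and `c` is averaged uniformly. Errors are charged to two kinds of loss. If the pair of label maps of
an encoder cut its source into fibres of equal mass, uniform labels followed by sampling inside the
fibre would reproduce the source law exactly; `encoderLoss` measures the failure of this balance. A
decoder that samples its posterior inside the fibre of `f` returns the true `z` unless the fibre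
holds competitors, whose posterior share is `decoderLoss`. By `lintegral_survival_le`, the average
success probability is at least the integral, under the uncoded joint law, of the product of all
factors (1 - loss). A union bound turns this into an average error of at most `totalLoss`, and the
best `c` does no worse (`exists_errorProb_le`).

Both expected losses are controlled by pairwise collisions. Imbalance is a second moment of fibre
masses, that is, collisions weighted by mass (`expected_encoderLoss_le`); ambiguity is bounded by an
expected number of colliding typical points (`expected_decoderLoss_le`). For independent hashes on
several coordinates the collision probability factorises. Each factor is either light, at most `α/N`
with `N` the number of labels, or heavy, and the hash property bounds the total heavy mass by `1 +
β`, the 1 coming from `z' = z`. Expanding the product over the set `W` of heavy coordinates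
(`sum_mul_prod_le`) is where the rate conditions for all subsets come from: an encoder pays the mass
of a value of `Z_W` times the number of labels on `W`, a decoder pays the number of typical
continuations outside `W` divided by the number of labels there.

On typical sets these masses and counts are at most `2^(-nθ)` and `2^(nθ)`, with `θ` strictly
between the sum of rates and the spectral entropy. So the residual terms vanish
(`tendsto_encoderResidual`, `tendsto_decoderResidual`), as do the probabilities of the atypical
sets. The expected total loss eventually falls below `δ`, and some functions of positive probability
do at least as well as the expectation. -/

noncomputable section

set_option linter.unusedSectionVars false

/-! ### Random functions on a finite set -/

section RandomFunction

variable {Ω 𝒵 𝒱 : Type*} [Fintype Ω] [Fintype 𝒵] [Fintype 𝒱]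

open scoped Classical in
/-- The mass of the fibre `h⁻¹(c)`. -/
def fibreMass (p : 𝒵 → ℝ) (h : 𝒵 → 𝒱) (c : 𝒱) : ℝ := ∑ z, if h z = c then p z else 0

/-- The deficit of the constrained-random-number generator at `z`: one minus the ratio, capped at
one, between the uniform mass of a value and the mass of the fibre of `z`. -/
def encoderLoss (p : 𝒵 → ℝ) (h : 𝒵 → 𝒱) (z : 𝒵) : ℝ :=
  1 - min 1 (1 / (Fintype.card 𝒱 * fibreMass p h (h z)))

/-- The probability that sampling from `p` conditioned on the fibre of `z` does not return `z`. -/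
def decoderLoss (p : 𝒵 → ℝ) (h : 𝒵 → 𝒱) (z : 𝒵) : ℝ :=
  1 - p z / fibreMass p h (h z)

open scoped Classical in
/-- The collision probability of a random function. -/
def collision (w : Ω → ℝ) (h : Ω → 𝒵 → 𝒱) (z z' : 𝒵) : ℝ :=
  ∑ ω, w ω * if h ω z = h ω z' then 1 else 0

lemma fibreMass_nonneg {p : 𝒵 → ℝ} (hp : ∀ z, 0 ≤ p z) (h : 𝒵 → 𝒱) (c : 𝒱) :
    0 ≤ fibreMass p h c :=
  Finset.sum_nonneg fun z _ => by split_ifs <;> simp [hp z]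

lemma le_fibreMass {p : 𝒵 → ℝ} (hp : ∀ z, 0 ≤ p z) (h : 𝒵 → 𝒱) (z : 𝒵) :
    p z ≤ fibreMass p h (h z) := by
  classical
  have := Finset.single_le_sum (f := fun z' => if h z' = h z then p z' else 0)
    (fun z' _ => by split_ifs <;> simp [hp z']) (Finset.mem_univ z)
  simpa [fibreMass] using this

lemma sum_fibreMass_mul (p : 𝒵 → ℝ) (h : 𝒵 → 𝒱) (φ : 𝒱 → ℝ) :
    ∑ c, fibreMass p h c * φ c = ∑ z, p z * φ (h z) := by
  classical
  simp only [fibreMass, Finset.sum_mul, ite_mul, zero_mul]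
  rw [Finset.sum_comm]
  simp

lemma sum_fibreMass (p : 𝒵 → ℝ) (h : 𝒵 → 𝒱) : ∑ c, fibreMass p h c = ∑ z, p z := by
  simpa using sum_fibreMass_mul p h 1

lemma encoderLoss_nonneg (p : 𝒵 → ℝ) (h : 𝒵 → 𝒱) (z : 𝒵) : 0 ≤ encoderLoss p h z := by
  simp [encoderLoss]

lemma encoderLoss_le_one {p : 𝒵 → ℝ} (hp : ∀ z, 0 ≤ p z) (h : 𝒵 → 𝒱) (z : 𝒵) :
    encoderLoss p h z ≤ 1 := by
  have := fibreMass_nonneg hp h (h z)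
  have : 0 ≤ min 1 (1 / (Fintype.card 𝒱 * fibreMass p h (h z))) := by positivity
  unfold encoderLoss
  linarith

lemma decoderLoss_nonneg {p : 𝒵 → ℝ} (hp : ∀ z, 0 ≤ p z) (h : 𝒵 → 𝒱) (z : 𝒵) :
    0 ≤ decoderLoss p h z :=
  sub_nonneg.2 (div_le_one_of_le₀ (le_fibreMass hp h z) (fibreMass_nonneg hp h _))

lemma decoderLoss_le_one {p : 𝒵 → ℝ} (hp : ∀ z, 0 ≤ p z) (h : 𝒵 → 𝒱) (z : 𝒵) :
    decoderLoss p h z ≤ 1 :=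
  sub_le_self _ (div_nonneg (hp z) (fibreMass_nonneg hp h _))

lemma collision_self {w : Ω → ℝ} (hw : ∑ ω, w ω = 1) (h : Ω → 𝒵 → 𝒱) (z : 𝒵) :
    collision w h z z = 1 := by
  simp [collision, hw]

/-- The square of a fibre mass counts pairs in the same fibre, so the second moment sees only
pairwise collisions. -/
lemma sum_fibreMass_sq (p : 𝒵 → ℝ) (w : Ω → ℝ) (h : Ω → 𝒵 → 𝒱) :
    ∑ ω, w ω * ∑ c, fibreMass p (h ω) c ^ 2 = ∑ z, p z * ∑ z', p z' * collision w h z z' := by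
  classical
  have key : ∀ ω, ∑ c, fibreMass p (h ω) c ^ 2 =
      ∑ z, p z * ∑ z', p z' * if h ω z = h ω z' then 1 else 0 := by
    intro ω
    simp only [sq]
    rw [sum_fibreMass_mul]
    simp [fibreMass, eq_comm]
  simp only [key, collision, Finset.mul_sum]
  rw [Finset.sum_comm]
  refine Finset.sum_congr rfl fun z _ => ?_
  rw [Finset.sum_comm]
  refine Finset.sum_congr rfl fun z' _ => Finset.sum_congr rfl fun ω _ => ?_
  ring

open scoped Classical in
-- The loss is the total excess of the fibre masses over `1/N`. After the part outside `A` is split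
-- off, it is at most the sum of `|x - a/N|` over the fibres. This sum is bounded by AM-GM with a
-- free `t` instead of Cauchy-Schwarz: the bound is then linear in the second moment, and an
-- expectation over a random `h` can be taken directly.
lemma sum_mul_encoderLoss_le [Nonempty 𝒱] {p : 𝒵 → ℝ} (hp : ∀ z, 0 ≤ p z)
    (hp1 : ∑ z, p z = 1) (h : 𝒵 → 𝒱) (A : Set 𝒵) {t : ℝ} (ht : 0 < t) :
    ∑ z, p z * encoderLoss p h z ≤ (∑ z, if z ∈ A then 0 else p z) + t +
      (Fintype.card 𝒱 * ∑ c, fibreMass (A.indicator p) h c ^ 2 -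
        (∑ z, A.indicator p z) ^ 2) / t := by
  set N : ℝ := ((Fintype.card 𝒱 : ℕ) : ℝ) with hN
  have hN0 : 0 < N := by rw [hN]; exact_mod_cast Fintype.card_pos
  set pA := A.indicator p with hpA
  have hpA0 : ∀ z, 0 ≤ pA z := fun z => Set.indicator_nonneg (fun z _ => hp z) z
  have hpAle : ∀ z, pA z ≤ p z := fun z => Set.indicator_le_self' (fun z _ => hp z) z
  set a := ∑ z, pA z with ha
  have ha1 : a ≤ 1 := hp1 ▸ Finset.sum_le_sum fun z _ => hpAle z
  have h1 : ∑ z, p z * encoderLoss p h z =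
      ∑ c, fibreMass p h c * (1 - min 1 (1 / (N * fibreMass p h c))) := by
    rw [sum_fibreMass_mul p h (fun c => 1 - min 1 (1 / (N * fibreMass p h c)))]
    rfl
  have h2 : ∀ c, fibreMass p h c * (1 - min 1 (1 / (N * fibreMass p h c))) ≤
      (fibreMass p h c - fibreMass pA h c) + (t / N +
        (N * fibreMass pA h c ^ 2 - 2 * a * fibreMass pA h c + a ^ 2 / N) / t) := by
    intro c
    have hab : fibreMass pA h c ≤ fibreMass p h c :=
      Finset.sum_le_sum fun z _ => by split_ifs <;> simp [hpAle z]
    have hb : 0 ≤ fibreMass p h c := fibreMass_nonneg hp h c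
    set b := fibreMass p h c
    set x := fibreMass pA h c
    -- The loss is positive only for `N * b > 1`, and then `b` times the loss is exactly `b - 1 /
    -- N`.
    have e1 : b * (1 - min 1 (1 / (N * b))) ≤ max 0 (b - 1 / N) := by
      rcases hb.eq_or_lt with hb | hb
      · simp [← hb]
      · rcases le_total 1 (1 / (N * b)) with h | h
        · rw [min_eq_left h]
          simp
        · rw [min_eq_right h]
          refine le_max_of_le_right (le_of_eq ?_)
          field_simp
    have e2 : N * x ^ 2 - 2 * a * x + a ^ 2 / N = N * (x - a / N) ^ 2 := by
      field_simp
      ring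
    have e3 : 2 * |x - a / N| ≤ t / N + N * (x - a / N) ^ 2 / t := by
      have : t / N + N * (x - a / N) ^ 2 / t - 2 * |x - a / N| =
          (t - N * |x - a / N|) ^ 2 / (N * t) := by
        rw [← sq_abs (x - a / N)]
        field_simp
        ring
      have h0 : 0 ≤ (t - N * |x - a / N|) ^ 2 / (N * t) := by positivity
      linarith
    rw [e2]
    have e4 : a / N ≤ 1 / N := by gcongr
    have e5 : max 0 (b - 1 / N) ≤ (b - x) + |x - a / N| :=
      max_le (add_nonneg (by linarith) (abs_nonneg _))
        (by have := le_abs_self (x - a / N); linarith)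
    have := abs_nonneg (x - a / N)
    linarith
  have h3 : (∑ z, if z ∈ A then 0 else p z) = ∑ z, p z - a := by
    rw [ha, ← Finset.sum_sub_distrib]
    refine Finset.sum_congr rfl fun z _ => ?_
    by_cases hz : z ∈ A <;> simp [hpA, hz]
  rw [h1]
  refine (Finset.sum_le_sum fun c _ => h2 c).trans (le_of_eq ?_)
  simp only [Finset.sum_add_distrib, Finset.sum_sub_distrib, ← Finset.sum_div, ← Finset.mul_sum]
  rw [sum_fibreMass, sum_fibreMass, h3, ← ha]
  simp only [Finset.sum_const, Finset.card_univ, nsmul_eq_mul, ← hN]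
  field_simp
  ring

open scoped Classical in
/-- Balanced colouring: a random function whose collision probabilities are small in average
splits the mass of `p` almost evenly. -/
lemma expected_encoderLoss_le [Nonempty 𝒱] {p : 𝒵 → ℝ} (hp : ∀ z, 0 ≤ p z)
    (hp1 : ∑ z, p z = 1) {w : Ω → ℝ} (hw : ∀ ω, 0 ≤ w ω) (hw1 : ∑ ω, w ω = 1)
    (h : Ω → 𝒵 → 𝒱) (A : Set 𝒵) {t ε : ℝ} (ht : 0 < t) (hε : 0 ≤ ε)
    (hA : ∀ z, ∑ z', A.indicator p z' * (Fintype.card 𝒱 * collision w h z z') ≤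
      (∑ z', A.indicator p z') + ε) :
    ∑ ω, w ω * ∑ z, p z * encoderLoss p (h ω) z ≤
      (∑ z, if z ∈ A then 0 else p z) + t + ε / t := by
  set N : ℝ := ((Fintype.card 𝒱 : ℕ) : ℝ) with hN
  set pA := A.indicator p with hpA
  have hpA0 : ∀ z, 0 ≤ pA z := fun z => Set.indicator_nonneg (fun z _ => hp z) z
  have hpAle : ∀ z, pA z ≤ p z := fun z => Set.indicator_le_self' (fun z _ => hp z) z
  set a := ∑ z, pA z with ha
  have ha0 : 0 ≤ a := Finset.sum_nonneg fun z _ => hpA0 z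
  have ha1 : a ≤ 1 := hp1 ▸ Finset.sum_le_sum fun z _ => hpAle z
  set d := (∑ z, if z ∈ A then 0 else p z) with hd
  have h1 : ∑ ω, w ω * ∑ z, p z * encoderLoss p (h ω) z ≤
      ∑ ω, w ω * (d + t + (N * ∑ c, fibreMass pA (h ω) c ^ 2 - a ^ 2) / t) :=
    Finset.sum_le_sum fun ω _ =>
      mul_le_mul_of_nonneg_left (sum_mul_encoderLoss_le hp hp1 (h ω) A ht) (hw ω)
  have h2 : ∑ ω, w ω * (d + t + (N * ∑ c, fibreMass pA (h ω) c ^ 2 - a ^ 2) / t) =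
      d + t + (N * ∑ ω, w ω * ∑ c, fibreMass pA (h ω) c ^ 2 - a ^ 2) / t := by
    have : ∀ ω, w ω * (d + t + (N * ∑ c, fibreMass pA (h ω) c ^ 2 - a ^ 2) / t) =
        w ω * (d + t - a ^ 2 / t) + N / t * (w ω * ∑ c, fibreMass pA (h ω) c ^ 2) := by
      intro ω; ring
    simp only [this]
    rw [Finset.sum_add_distrib, ← Finset.sum_mul, ← Finset.mul_sum, hw1]
    ring
  have h3 : N * ∑ ω, w ω * ∑ c, fibreMass pA (h ω) c ^ 2 ≤ a ^ 2 + ε := by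
    rw [sum_fibreMass_sq]
    calc N * ∑ z, pA z * ∑ z', pA z' * collision w h z z'
        = ∑ z, pA z * ∑ z', pA z' * (N * collision w h z z') := by
          rw [Finset.mul_sum]
          refine Finset.sum_congr rfl fun z _ => ?_
          rw [mul_left_comm, Finset.mul_sum]
          congr 1
          exact Finset.sum_congr rfl fun z' _ => by ring
      _ ≤ ∑ z, pA z * (a + ε) :=
          Finset.sum_le_sum fun z _ => mul_le_mul_of_nonneg_left (hA z) (hpA0 z)
      _ = a ^ 2 + a * ε := by rw [← Finset.sum_mul, ← ha]; ring
      _ ≤ a ^ 2 + ε := by nlinarith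
  refine h1.trans (h2.le.trans ?_)
  gcongr
  linarith

open scoped Classical in
-- The matrix `m z z'` is the probability of drawing `z` and then resampling `z' ≠ z` from its
-- fibre. It is symmetric, so pairs whose second point leaves `A` cost no more than pairs that start
-- outside `A`: this is the factor 2. For pairs inside `A`, the ratio `p z' / b z` is at most 1.
lemma sum_mul_decoderLoss_le {p : 𝒵 → ℝ} (hp : ∀ z, 0 ≤ p z) (h : 𝒵 → 𝒱) (A : Set 𝒵) :
    ∑ z, p z * decoderLoss p h z ≤ 2 * (∑ z, if z ∈ A then 0 else p z) +
      ∑ z, if z ∈ A then p z * ∑ z', (if z' ∈ A ∧ z' ≠ z then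
        (if h z = h z' then 1 else 0) else 0) else 0 := by
  set b : 𝒵 → ℝ := fun z => fibreMass p h (h z) with hb
  set m : 𝒵 → 𝒵 → ℝ := fun z z' =>
    if h z = h z' ∧ z' ≠ z then p z * p z' / b z else 0 with hm
  have hb0 : ∀ z, 0 ≤ b z := fun z => fibreMass_nonneg hp h _
  have hm0 : ∀ z z', 0 ≤ m z z' := by
    intro z z'
    simp only [hm]
    split_ifs
    · exact div_nonneg (mul_nonneg (hp _) (hp _)) (hb0 _)
    · rfl
  have hsymm : ∀ z z', m z z' = m z' z := by
    intro z z'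
    by_cases hz : h z = h z'
    · simp only [hm, hz, true_and, hb, ne_comm (a := z), mul_comm (p z)]
    · simp [hm, hz, Ne.symm hz]
  have hrow : ∀ z, p z * decoderLoss p h z = ∑ z', m z z' := by
    intro z
    rcases (hb0 z).eq_or_lt with h0 | h0
    · have : p z = 0 := le_antisymm (h0 ▸ le_fibreMass hp h z) (hp z)
      simp [hm, this]
    · have e1 : ∑ z', m z z' = p z / b z * ∑ z', (if h z' = h z then p z' else 0)
          - p z / b z * p z := by
        rw [Finset.mul_sum]
        have : p z / b z * p z = ∑ z', if z' = z then p z / b z * p z else 0 := by simp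
        rw [this, ← Finset.sum_sub_distrib]
        refine Finset.sum_congr rfl fun z' _ => ?_
        by_cases h1 : z' = z
        · subst h1; simp [hm]
        · by_cases h2 : h z = h z'
          · simp [hm, h1, h2]; ring
          · simp [hm, h1, h2, Ne.symm h2]
      rw [e1]
      change _ = p z / b z * b z - _
      rw [div_mul_cancel₀ _ h0.ne']
      simp only [decoderLoss]
      change p z * (1 - p z / b z) = _
      ring
  have hrowle : ∀ z, ∑ z', m z z' ≤ p z := by
    intro z
    rw [← hrow]
    exact mul_le_of_le_one_right (hp z) (decoderLoss_le_one hp h z)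
  have hsplit : ∀ z z', m z z' ≤ (if z ∈ A then 0 else m z z') + (if z' ∈ A then 0 else m z z') +
      (if z ∈ A then p z * (if z' ∈ A ∧ z' ≠ z then
        (if h z = h z' then 1 else 0) else 0) else 0) := by
    intro z z'
    have h0 := hm0 z z'
    by_cases hz : z ∈ A
    · by_cases hz' : z' ∈ A
      · simp only [hz, hz', if_true, true_and, zero_add]
        by_cases h1 : z' = z
        · simp [hm, h1]
        by_cases h2 : h z = h z'
        · simp only [hm, h1, h2, ne_eq, not_false_eq_true, and_self, if_true, mul_one]
          rw [mul_div_assoc]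
          refine mul_le_of_le_one_right (hp z) (div_le_one_of_le₀ ?_ (hb0 z))
          simp only [hb, h2]
          exact le_fibreMass hp h z'
        · simp [hm, h1, h2]
      · simp [hz, hz']
    · by_cases hz' : z' ∈ A <;> simp [hz, hz', h0]
  calc ∑ z, p z * decoderLoss p h z = ∑ z, ∑ z', m z z' :=
        Finset.sum_congr rfl fun z _ => hrow z
    _ ≤ ∑ z, ∑ z', ((if z ∈ A then 0 else m z z') + (if z' ∈ A then 0 else m z z') +
      (if z ∈ A then p z * (if z' ∈ A ∧ z' ≠ z then
        (if h z = h z' then 1 else 0) else 0) else 0)) :=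
        Finset.sum_le_sum fun z _ => Finset.sum_le_sum fun z' _ => hsplit z z'
    _ = (∑ z, if z ∈ A then 0 else ∑ z', m z z') + (∑ z', if z' ∈ A then 0 else ∑ z, m z' z) +
      ∑ z, (if z ∈ A then p z * ∑ z', (if z' ∈ A ∧ z' ≠ z then
        (if h z = h z' then 1 else 0) else 0) else 0) := by
        simp only [Finset.sum_add_distrib]
        congr 1
        · congr 1
          · refine Finset.sum_congr rfl fun z _ => ?_
            split_ifs <;> simp
          · rw [Finset.sum_comm]
            refine Finset.sum_congr rfl fun z' _ => ?_
            split_ifs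
            · simp
            · exact Finset.sum_congr rfl fun z _ => hsymm z z'
        · refine Finset.sum_congr rfl fun z _ => ?_
          split_ifs
          · rw [Finset.mul_sum]
          · simp
    _ ≤ _ := by
        rw [two_mul]
        gcongr with z _ z _
        · split_ifs <;> simp [hrowle z]
        · split_ifs <;> simp [hrowle z]

open scoped Classical in
/-- Collision resistance: posterior sampling within a fibre of a random function recovers `z`
up to the probability of `Aᶜ` and the expected number of collisions within `A`. -/
lemma expected_decoderLoss_le {p : 𝒵 → ℝ} (hp : ∀ z, 0 ≤ p z)
    (hp1 : ∑ z, p z = 1) {w : Ω → ℝ} (hw : ∀ ω, 0 ≤ w ω) (hw1 : ∑ ω, w ω = 1)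
    (h : Ω → 𝒵 → 𝒱) (A : Set 𝒵) {ε : ℝ} (hε : 0 ≤ ε)
    (hA : ∀ z ∈ A, ∑ z', A.indicator 1 z' * collision w h z z' ≤ 1 + ε) :
    ∑ ω, w ω * ∑ z, p z * decoderLoss p (h ω) z ≤
      2 * (∑ z, if z ∈ A then 0 else p z) + ε := by
  set d := (∑ z, if z ∈ A then 0 else p z) with hd
  have h1 : ∑ ω, w ω * ∑ z, p z * decoderLoss p (h ω) z ≤
      ∑ ω, w ω * (2 * d + ∑ z, if z ∈ A then p z * ∑ z', (if z' ∈ A ∧ z' ≠ z then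
        (if h ω z = h ω z' then 1 else 0) else 0) else 0) :=
    Finset.sum_le_sum fun ω _ =>
      mul_le_mul_of_nonneg_left (sum_mul_decoderLoss_le hp (h ω) A) (hw ω)
  refine h1.trans ?_
  simp only [mul_add]
  rw [Finset.sum_add_distrib, ← Finset.sum_mul, hw1, one_mul]
  gcongr
  simp only [Finset.mul_sum]
  rw [Finset.sum_comm]
  have h2 : ∀ z, ∑ ω, w ω * (if z ∈ A then ∑ z', p z * (if z' ∈ A ∧ z' ≠ z then
        (if h ω z = h ω z' then 1 else 0) else 0) else 0) ≤ p z * ε := by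
    intro z
    by_cases hz : z ∈ A
    · have h3 : ∑ z', A.indicator 1 z' * collision w h z z' - 1 =
          ∑ z', if z' ∈ A ∧ z' ≠ z then collision w h z z' else 0 := by
        have : (1 : ℝ) = ∑ z', if z' = z then collision w h z z' else 0 := by
          simp [collision_self hw1]
        rw [this, ← Finset.sum_sub_distrib]
        refine Finset.sum_congr rfl fun z' _ => ?_
        by_cases h1 : z' = z
        · subst h1; simp [hz]
        · by_cases h2 : z' ∈ A <;> simp [h1, h2]
      have h4 : ∑ ω, w ω * (∑ z', p z * (if z' ∈ A ∧ z' ≠ z then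
          (if h ω z = h ω z' then (1 : ℝ) else 0) else 0)) =
          p z * ∑ z', if z' ∈ A ∧ z' ≠ z then collision w h z z' else 0 := by
        simp only [Finset.mul_sum]
        rw [Finset.sum_comm]
        refine Finset.sum_congr rfl fun z' _ => ?_
        split_ifs
        · rw [collision, Finset.mul_sum]
          exact Finset.sum_congr rfl fun ω _ => by ring
        · simp
      simp only [hz, if_true]
      rw [h4, ← h3]
      exact mul_le_mul_of_nonneg_left (by linarith [hA z hz]) (hp z)
    · simp [hz, mul_nonneg (hp z) hε]
  refine (Finset.sum_le_sum fun z _ => h2 z).trans ?_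
  rw [← Finset.sum_mul, hp1, one_mul]

end RandomFunction

/-! ### Products of hash functions -/

section Product

variable {ι : Type*} [Fintype ι] [DecidableEq ι] {𝒵 : ι → Type*} [∀ s, Fintype (𝒵 s)]

open scoped Classical in
-- Group the points by their values on `W`. Each group has mass at most `K`, and the sum over the
-- values factorises over the coordinates.
lemma sum_mul_prod_le_of_agree (a : (∀ s, 𝒵 s) → ℝ) (W : Finset ι)
    (q : ∀ s, 𝒵 s → ℝ) (hq : ∀ s z, 0 ≤ q s z) (γ : ι → ℝ)
    (hγ : ∀ s, ∑ z, q s z ≤ γ s) (K : ℝ) (hK0 : 0 ≤ K)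
    (hK : ∀ u : ∀ s, 𝒵 s, (∑ z, if ∀ s ∈ W, z s = u s then a z else 0) ≤ K) :
    ∑ z, a z * ∏ s ∈ W, q s (z s) ≤ K * ∏ s ∈ W, γ s := by
  let ρ : (∀ s, 𝒵 s) → (∀ s : W, 𝒵 s) := fun z s => z s
  have h1 : ∑ z, a z * ∏ s ∈ W, q s (z s) =
      ∑ u : (∀ s : W, 𝒵 s), (∑ z, if ρ z = u then a z else 0) * ∏ s : W, q s (u s) := by
    simp only [Finset.sum_mul]
    rw [Finset.sum_comm]
    refine Finset.sum_congr rfl fun z _ => ?_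
    rw [Finset.sum_eq_single (ρ z)]
    · simp only [if_true, ρ]
      rw [Finset.prod_coe_sort W (fun s => q s (z s))]
    · intro u _ hu
      simp [hu.symm]
    · simp
  rw [h1]
  calc _ ≤ ∑ u : (∀ s : W, 𝒵 s), K * ∏ s : W, q s (u s) := by
        refine Finset.sum_le_sum fun u _ => mul_le_mul_of_nonneg_right ?_
          (Finset.prod_nonneg fun s _ => hq _ _)
        by_cases hu : ∃ z, ρ z = u
        · obtain ⟨z, rfl⟩ := hu
          refine le_trans (le_of_eq ?_) (hK z)
          refine Finset.sum_congr rfl fun z' _ => ?_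
          congr 1
          simp [ρ, funext_iff]
        -- A value on `W` has no extension when some `𝒵 s` outside `W` is empty.
        · push Not at hu
          simp [hu, hK0]
    _ = K * ∏ s : W, ∑ z, q s z := by
        rw [← Finset.mul_sum, Finset.prod_univ_sum, Fintype.piFinset_univ]
    _ ≤ K * ∏ s : W, γ s := by
        gcongr with s _
        · exact fun s _ => Finset.sum_nonneg fun z _ => hq _ _
        · exact hγ s
    _ = K * ∏ s ∈ W, γ s := by rw [Finset.prod_coe_sort W γ]

open scoped Classical in
/-- Split a product of kernels into light factors, at most `l s`, and heavy factors, of total mass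
at most `γ s`. -/
lemma sum_mul_prod_le (a : (∀ s, 𝒵 s) → ℝ) (ha : ∀ z, 0 ≤ a z)
    (q : ∀ s, 𝒵 s → ℝ) (hq : ∀ s z, 0 ≤ q s z) (l γ : ι → ℝ) (hl : ∀ s, 0 ≤ l s)
    (hγ : ∀ s, (∑ z, if l s < q s z then q s z else 0) ≤ γ s)
    (K : Finset ι → ℝ) (hK0 : ∀ W, 0 ≤ K W)
    (hK : ∀ W, ∀ u : ∀ s, 𝒵 s, (∑ z, if ∀ s ∈ W, z s = u s then a z else 0) ≤ K W) :
    ∑ z, a z * ∏ s, q s (z s) ≤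
      ∑ W : Finset ι, K W * (∏ s ∈ W, γ s) * ∏ s ∈ Wᶜ, l s := by
  set hv : ∀ s, 𝒵 s → ℝ := fun s z => if l s < q s z then q s z else 0 with hhv
  have hv0 : ∀ s z, 0 ≤ hv s z := by
    intro s z; simp only [hhv]; split_ifs <;> simp [hq]
  have h1 : ∀ z : ∀ s, 𝒵 s, ∏ s, q s (z s) ≤
      ∑ W : Finset ι, (∏ s ∈ W, hv s (z s)) * ∏ s ∈ Wᶜ, l s := by
    intro z
    calc ∏ s, q s (z s) ≤ ∏ s, (hv s (z s) + l s) := by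
          refine Finset.prod_le_prod (fun s _ => hq _ _) fun s _ => ?_
          simp only [hhv]
          split_ifs with h
          · linarith [hl s]
          · linarith [not_lt.1 h]
      _ = _ := by
          rw [Finset.prod_add]
          simp only [Finset.powerset_univ, Finset.compl_eq_univ_sdiff]
  calc ∑ z, a z * ∏ s, q s (z s)
      ≤ ∑ z, a z * ∑ W : Finset ι, (∏ s ∈ W, hv s (z s)) * ∏ s ∈ Wᶜ, l s :=
        Finset.sum_le_sum fun z _ => mul_le_mul_of_nonneg_left (h1 z) (ha z)
    _ = ∑ W : Finset ι, (∑ z, a z * ∏ s ∈ W, hv s (z s)) * ∏ s ∈ Wᶜ, l s := by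
        simp only [Finset.mul_sum, Finset.sum_mul]
        rw [Finset.sum_comm]
        simp only [mul_assoc]
    _ ≤ _ := by
        refine Finset.sum_le_sum fun W _ => mul_le_mul_of_nonneg_right ?_
          (Finset.prod_nonneg fun s _ => hl s)
        exact sum_mul_prod_le_of_agree a W hv hv0 γ hγ (K W) (hK0 W) (hK W)

end Product

section ProductHash

lemma one_le_prod_of_one_le {ι : Type*} (T : Finset ι) {a : ι → ℝ} (ha : ∀ s, 1 ≤ a s) :
    1 ≤ ∏ s ∈ T, a s := by
  simpa using Finset.prod_le_prod (s := T) (f := fun _ => (1 : ℝ)) (fun _ _ => zero_le_one)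
    fun s _ => ha s

variable {ι : Type*} [Fintype ι] [DecidableEq ι] {𝒵 : ι → Type*} [∀ s, Fintype (𝒵 s)]
  {𝒱 : ι → Type*} [∀ s, Fintype (𝒱 s)]

lemma collision_prodMk {Ω Ω' 𝒴 𝒱₁ 𝒱₂ : Type*} [Fintype Ω] [Fintype Ω'] [Fintype 𝒴]
    [Fintype 𝒱₁] [Fintype 𝒱₂] (w : Ω → ℝ) (w' : Ω' → ℝ) (h : Ω → 𝒴 → 𝒱₁) (h' : Ω' → 𝒴 → 𝒱₂)
    (z z' : 𝒴) :
    collision (fun ω : Ω × Ω' => w ω.1 * w' ω.2) (fun ω y => (h ω.1 y, h' ω.2 y)) z z' =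
      collision w h z z' * collision w' h' z z' := by
  classical
  simp only [collision, Fintype.sum_prod_type, Finset.sum_mul_sum, Prod.mk.injEq]
  refine Finset.sum_congr rfl fun ω _ => Finset.sum_congr rfl fun ω' _ => ?_
  split_ifs <;> simp_all

lemma collision_fst {Ω Ω' 𝒴 𝒱₁ : Type*} [Fintype Ω] [Fintype Ω'] [Fintype 𝒴]
    [Fintype 𝒱₁] (w : Ω → ℝ) {w' : Ω' → ℝ} (hw' : ∑ ω, w' ω = 1) (h : Ω → 𝒴 → 𝒱₁) (z z' : 𝒴) :
    collision (fun ω : Ω × Ω' => w ω.1 * w' ω.2) (fun ω y => h ω.1 y) z z' =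
      collision w h z z' := by
  classical
  simp only [collision, Fintype.sum_prod_type]
  refine Finset.sum_congr rfl fun ω _ => ?_
  split_ifs <;> simp [← Finset.mul_sum, hw']

/-- The collision probability of independent functions on a subset of the coordinates. -/
lemma collision_pi {Ω : ι → Type*} [∀ s, Fintype (Ω s)] (w : ∀ s, Ω s → ℝ)
    (hw : ∀ s, ∑ ω, w s ω = 1) (h : ∀ s, Ω s → 𝒵 s → 𝒱 s) (T : Finset ι)
    (z z' : (s : T) → 𝒵 s) :
    collision (fun ω : ∀ s, Ω s => ∏ s, w s (ω s))
      (fun ω (z : (s : T) → 𝒵 s) (s : T) => h s (ω s) (z s)) z z' =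
      ∏ s : T, collision (w s) (h s) (z s) (z' s) := by
  classical
  -- Coordinates outside `T` get the factor 1, so their weights sum out to 1.
  let φ : ∀ s, Ω s → ℝ := fun s ω =>
    if hs : s ∈ T then (if h s ω (z ⟨s, hs⟩) = h s ω (z' ⟨s, hs⟩) then 1 else 0) else 1
  have h2 := Finset.prod_univ_sum (fun s => (Finset.univ : Finset (Ω s)))
    (fun s ω => w s ω * φ s ω)
  rw [Fintype.piFinset_univ] at h2
  have h3 : ∏ s, ∑ ω, w s ω * φ s ω = ∏ s : T, collision (w s) (h s) (z s) (z' s) := by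
    rw [← Finset.prod_subset (Finset.subset_univ T), ← Finset.prod_coe_sort]
    · refine Finset.prod_congr rfl fun s _ => Finset.sum_congr rfl fun ω _ => ?_
      simp [φ]
    · intro s _ hs
      simp [φ, hs, hw s]
  rw [← h3, h2]
  refine Finset.sum_congr rfl fun ω _ => ?_
  rw [Finset.prod_mul_distrib]
  congr 1
  by_cases hω : ∀ s : T, h s (ω s) (z s) = h s (ω s) (z' s)
  · rw [if_pos (funext hω), eq_comm]
    refine Finset.prod_eq_one fun s _ => ?_
    by_cases hs : s ∈ T
    · simpa [φ, hs] using hω ⟨s, hs⟩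
    · simp [φ, hs]
  · rw [if_neg (fun H => hω (congrFun H))]
    push Not at hω
    obtain ⟨s, hs⟩ := hω
    rw [Finset.prod_eq_zero (Finset.mem_univ s.1)]
    simp [φ, hs]

/-- The residual error of the encoders: `K W` bounds the probability of a value of the
coordinates in `W`. -/
def encoderResidual (N α β : ι → ℝ) (K : Finset ι → ℝ) : ℝ :=
  (∏ s, α s - 1) + ∑ W ∈ Finset.univ.erase ∅,
    K W * (∏ s ∈ W, N s * (1 + β s)) * ∏ s ∈ Wᶜ, α s

/-- The residual error of a decoder: `K W` bounds the number of continuations of a value of the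
coordinates in `W`. -/
def decoderResidual (N α β : ι → ℝ) (K : Finset ι → ℝ) : ℝ :=
  (∏ s, (1 + β s) - 1) + ∑ W ∈ Finset.univ.erase Finset.univ,
    K W * (∏ s ∈ W, (1 + β s)) * ∏ s ∈ Wᶜ, α s / N s

variable {N α β : ι → ℝ} {K : Finset ι → ℝ}

lemma encoderResidual_nonneg (hN : ∀ s, 0 < N s) (hα : ∀ s, 1 ≤ α s) (hβ : ∀ s, 0 ≤ β s)
    (hK : ∀ W, 0 ≤ K W) : 0 ≤ encoderResidual N α β K := by
  have h1 : 1 ≤ ∏ s, α s := one_le_prod_of_one_le _ hα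
  have hα0 : ∀ s, 0 ≤ α s := fun s => zero_le_one.trans (hα s)
  refine add_nonneg (by linarith) (Finset.sum_nonneg fun W _ => mul_nonneg (mul_nonneg (hK W) ?_) ?_)
  · exact Finset.prod_nonneg fun s _ => mul_nonneg (hN s).le (by linarith [hβ s])
  · exact Finset.prod_nonneg fun s _ => hα0 s

lemma decoderResidual_nonneg (hN : ∀ s, 0 < N s) (hα : ∀ s, 1 ≤ α s) (hβ : ∀ s, 0 ≤ β s)
    (hK : ∀ W, 0 ≤ K W) : 0 ≤ decoderResidual N α β K := by
  have h1 : 1 ≤ ∏ s, (1 + β s) := one_le_prod_of_one_le _ fun s => by linarith [hβ s]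
  have hα0 : ∀ s, 0 ≤ α s := fun s => zero_le_one.trans (hα s)
  refine add_nonneg (by linarith) (Finset.sum_nonneg fun W _ => mul_nonneg (mul_nonneg (hK W) ?_) ?_)
  · exact Finset.prod_nonneg fun s _ => by linarith [hβ s]
  · exact Finset.prod_nonneg fun s _ => div_nonneg (hα0 s) (hN s).le

open scoped Classical in
-- In the expansion over heavy sets `W`, the empty set gives the main term `a * ∏ α`, at most `a +
-- (∏ α - 1)` because `a ≤ 1`. All other sets go into the residual.
lemma sum_indicator_mul_prod_le_encoder (hN : ∀ s, 0 < N s) (hα : ∀ s, 1 ≤ α s)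
    (hK : ∀ W, 0 ≤ K W)
    {q : ∀ s, 𝒵 s → ℝ} (hq : ∀ s z, 0 ≤ q s z)
    (hash : ∀ s, (∑ z, if α s / N s < q s z then q s z else 0) ≤ 1 + β s)
    {p : (∀ s, 𝒵 s) → ℝ} (hp : ∀ z, 0 ≤ p z) (hp1 : ∑ z, p z = 1) (A : Set (∀ s, 𝒵 s))
    (hA : ∀ W : Finset ι, W.Nonempty → ∀ u : ∀ s, 𝒵 s,
      (∑ z, if ∀ s ∈ W, z s = u s then A.indicator p z else 0) ≤ K W) :
    ∑ z, A.indicator p z * ((∏ s, N s) * ∏ s, q s (z s)) ≤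
      (∑ z, A.indicator p z) + encoderResidual N α β K := by
  set a := ∑ z, A.indicator p z with ha
  have hpA : ∀ z, 0 ≤ A.indicator p z := Set.indicator_nonneg fun z _ => hp z
  have ha0 : 0 ≤ a := Finset.sum_nonneg fun z _ => hpA z
  have ha1 : a ≤ 1 :=
    hp1 ▸ Finset.sum_le_sum fun z _ => Set.indicator_le_self' (fun z _ => hp z) z
  have h1 : 1 ≤ ∏ s, α s := one_le_prod_of_one_le _ hα
  -- Multiplying the kernels by `N s` moves the light level from `α s / N s` to `α s`.
  have key := sum_mul_prod_le (A.indicator p) hpA (fun s z => N s * q s z)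
    (fun s z => mul_nonneg (hN s).le (hq s z)) α (fun s => N s * (1 + β s))
    (fun s => zero_le_one.trans (hα s)) (fun s => ?_) (fun W => if W = ∅ then a else K W)
    (fun W => by split_ifs; exacts [ha0, hK W]) (fun W u => ?_)
  · simp only [← Finset.prod_mul_distrib]
    refine key.trans ?_
    rw [← Finset.add_sum_erase _ _ (Finset.mem_univ ∅), encoderResidual, ← add_assoc]
    refine add_le_add ?_ (le_of_eq (Finset.sum_congr rfl fun W hW => ?_))
    · simp only [if_true, Finset.prod_empty, mul_one, Finset.compl_empty]
      nlinarith
    · rw [if_neg (Finset.ne_of_mem_erase hW)]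
  · refine le_trans (le_of_eq ?_) (mul_le_mul_of_nonneg_left (hash s) (hN s).le)
    rw [Finset.mul_sum]
    refine Finset.sum_congr rfl fun z _ => ?_
    simp only [div_lt_iff₀' (hN s), mul_ite, mul_zero]
  · by_cases hW : W = ∅
    · simp [hW, ha]
    · simpa only [if_neg hW] using hA W (Finset.nonempty_iff_ne_empty.2 hW) u

open scoped Classical in
-- Here the main term is the full set: pinning every coordinate leaves at most one point, so the
-- contribution is `∏ (1 + β)`.
lemma sum_indicator_mul_prod_le_decoder (hN : ∀ s, 0 < N s) (hα : ∀ s, 1 ≤ α s)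
    (hK : ∀ W, 0 ≤ K W)
    {q : ∀ s, 𝒵 s → ℝ} (hq : ∀ s z, 0 ≤ q s z)
    (hash : ∀ s, (∑ z, if α s / N s < q s z then q s z else 0) ≤ 1 + β s)
    (A : Set (∀ s, 𝒵 s))
    (hA : ∀ W : Finset ι, W ≠ Finset.univ → ∀ u : ∀ s, 𝒵 s,
      (∑ z, if ∀ s ∈ W, z s = u s then A.indicator (1 : (∀ s, 𝒵 s) → ℝ) z else 0) ≤ K W) :
    ∑ z, A.indicator 1 z * ∏ s, q s (z s) ≤ 1 + decoderResidual N α β K := by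
  have hpA : ∀ z, 0 ≤ A.indicator (1 : (∀ s, 𝒵 s) → ℝ) z :=
    Set.indicator_nonneg fun z _ => zero_le_one
  have key := sum_mul_prod_le (A.indicator 1) hpA q hq (fun s => α s / N s) (fun s => 1 + β s)
    (fun s => div_nonneg (zero_le_one.trans (hα s)) (hN s).le) hash
    (fun W => if W = Finset.univ then 1 else K W)
    (fun W => by split_ifs; exacts [zero_le_one, hK W]) (fun W u => ?_)
  · refine key.trans (le_of_eq ?_)
    rw [← Finset.add_sum_erase _ _ (Finset.mem_univ Finset.univ), decoderResidual, ← add_assoc]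
    congr 1
    · simp
    · exact Finset.sum_congr rfl fun W hW => by rw [if_neg (Finset.ne_of_mem_erase hW)]
  · by_cases hW : W = Finset.univ
    · simp only [hW, Finset.mem_univ, forall_const, if_true, ← funext_iff]
      simp only [Finset.sum_ite_eq', Finset.mem_univ, if_true]
      exact Set.indicator_le_self' (fun _ _ => zero_le_one) u
    · simpa only [if_neg hW] using hA W hW u

end ProductHash

/-! ### Ensembles with the hash property -/

namespace FunctionEnsemble

variable {𝒵 𝒞 : Type*} [Fintype 𝒵] [Fintype 𝒞]

open scoped Classical in
lemma sum_prob_toReal (F : FunctionEnsemble 𝒵 𝒞) : ∑ f, (F.prob f).toReal = 1 := by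
  rw [← ENNReal.toReal_sum fun f _ => F.prob.apply_ne_top f, ← tsum_fintype (L := .unconditional _), F.prob.tsum_coe,
    ENNReal.toReal_one]

open scoped Classical in
lemma collision_eq_collisionProb (F : FunctionEnsemble 𝒵 𝒞) (z z' : 𝒵) :
    collision (fun f => (F.prob f).toReal) (fun f => f) z z' = F.collisionProb z z' := by
  rw [collision, collisionProb, PMF.toOuterMeasure_apply_fintype, ENNReal.toReal_sum]
  · refine Finset.sum_congr rfl fun f _ => ?_
    by_cases h : f z = f z' <;> simp [h]
  · intro f _
    by_cases h : f z = f z' <;> simp [h, F.prob.apply_ne_top f]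

lemma collisionProb_nonneg (F : FunctionEnsemble 𝒵 𝒞) (z z' : 𝒵) : 0 ≤ F.collisionProb z z' :=
  ENNReal.toReal_nonneg

lemma collisionProb_le_one (F : FunctionEnsemble 𝒵 𝒞) (z z' : 𝒵) : F.collisionProb z z' ≤ 1 := by
  classical
  rw [← collision_eq_collisionProb, ← F.sum_prob_toReal, collision]
  refine Finset.sum_le_sum fun f _ => ?_
  split_ifs <;> simp

open scoped Classical in
lemma HasHashProperty.nonneg [Nonempty 𝒵] {F : FunctionEnsemble 𝒵 𝒞} {α β : ℝ}
    (h : F.HasHashProperty α β) : 0 ≤ β :=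
  (Finset.sum_nonneg fun z' _ => F.collisionProb_nonneg _ z').trans (h (Classical.arbitrary 𝒵))

/-- A higher threshold leaves fewer heavy points. This is what allows `α ≥ 1` to be assumed. -/
lemma HasHashProperty.mono {F : FunctionEnsemble 𝒵 𝒞} {α α' β : ℝ}
    (h : F.HasHashProperty α β) (hα : α ≤ α') : F.HasHashProperty α' β := by
  classical
  intro z
  refine (Finset.sum_le_sum_of_subset_of_nonneg ?_ ?_).trans (h z)
  · intro z' hz'
    simp only [Finset.mem_filter, Finset.mem_univ, true_and] at hz' ⊢
    refine ⟨hz'.1, lt_of_le_of_lt ?_ hz'.2⟩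
    gcongr
  · exact fun z' _ _ => F.collisionProb_nonneg _ _

open scoped Classical in
-- The extra 1 pays for `z' = z`, which the hash property leaves out.
lemma HasHashProperty.sum_heavy_le {F : FunctionEnsemble 𝒵 𝒞} {α β : ℝ}
    (h : F.HasHashProperty α β) (hF : F.image = Set.univ) (z : 𝒵) :
    (∑ z', if α / (Fintype.card 𝒞 : ℝ) < F.collisionProb z z' then F.collisionProb z z' else 0) ≤
      1 + β := by
  have hz := h z
  rw [hF, Set.ncard_univ, Nat.card_eq_fintype_card, Finset.sum_filter] at hz
  rw [← Finset.add_sum_erase _ _ (Finset.mem_univ z)]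
  refine add_le_add ?_ (le_trans (le_of_eq ?_) hz)
  · split_ifs
    exacts [F.collisionProb_le_one z z, zero_le_one]
  · rw [← Finset.add_sum_erase (a := z) _ _ (Finset.mem_univ z)]
    simp only [ne_eq, not_true_eq_false, false_and, if_false, zero_add]
    refine Finset.sum_congr rfl fun z' hz' => ?_
    simp [Finset.ne_of_mem_erase hz']

open scoped Classical in
/-- Two independent functions with the hash property jointly have the hash property. -/
lemma HasHashProperty.sum_heavy_mul_le {ℳ : Type*} [Fintype ℳ] {F : FunctionEnsemble 𝒵 𝒞}
    {G : FunctionEnsemble 𝒵 ℳ} {α β α' β' : ℝ} (hα : 0 ≤ α)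
    (h : F.HasHashProperty α β) (h' : G.HasHashProperty α' β')
    (hF : F.image = Set.univ) (hG : G.image = Set.univ) (z : 𝒵) :
    (∑ z', if (α * α') / ((Fintype.card 𝒞 : ℝ) * Fintype.card ℳ) <
        F.collisionProb z z' * G.collisionProb z z' then
        F.collisionProb z z' * G.collisionProb z z' else 0) ≤ 1 + (β + β') := by
  have hz := h z
  have hz' := h' z
  rw [hF, Set.ncard_univ, Nat.card_eq_fintype_card, Finset.sum_filter] at hz
  rw [hG, Set.ncard_univ, Nat.card_eq_fintype_card, Finset.sum_filter] at hz'
  have key : ∀ z', (if (α * α') / ((Fintype.card 𝒞 : ℝ) * Fintype.card ℳ) <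
        F.collisionProb z z' * G.collisionProb z z' then
        F.collisionProb z z' * G.collisionProb z z' else 0) ≤ (if z' = z then 1 else 0) +
      ((if z' ≠ z ∧ α / (Fintype.card 𝒞 : ℝ) < F.collisionProb z z' then
        F.collisionProb z z' else 0) +
      (if z' ≠ z ∧ α' / (Fintype.card ℳ : ℝ) < G.collisionProb z z' then
        G.collisionProb z z' else 0)) := by
    intro z'
    have a0 := F.collisionProb_nonneg z z'
    have a1 := F.collisionProb_le_one z z'
    have b0 := G.collisionProb_nonneg z z'
    have b1 := G.collisionProb_le_one z z'
    set x := F.collisionProb z z'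
    set y := G.collisionProb z z'
    by_cases hzz : z' = z
    · simp only [hzz, ne_eq, not_true_eq_false, false_and, if_false, if_true, add_zero]
      split_ifs
      · exact mul_le_one₀ a1 b0 b1
      · exact zero_le_one
    · simp only [hzz, ne_eq, not_false_eq_true, true_and, if_false, zero_add]
      have hxy : x * y ≤ x := mul_le_of_le_one_right a0 b1
      have hyx : x * y ≤ y := mul_le_of_le_one_left b0 a1
      -- The product is at most either factor, so one heavy factor suffices. The remaining case has
      -- both factors light, which contradicts the product being heavy.
      split_ifs with c1 c2 c3 c3 c2 c3 c3 <;> try linarith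
      exfalso
      rw [mul_div_mul_comm] at c1
      exact absurd (mul_le_mul (not_lt.1 c2) (not_lt.1 c3) b0 (by positivity)) (not_le.2 c1)
  refine (Finset.sum_le_sum fun z' _ => key z').trans ?_
  rw [Finset.sum_add_distrib, Finset.sum_add_distrib]
  refine add_le_add ?_ (add_le_add hz hz')
  simp

/-- All functions, uniformly distributed. -/
def uniform (𝒵 𝒞 : Type*) [Fintype 𝒵] [DecidableEq 𝒵] [Fintype 𝒞] [Nonempty 𝒞] :
    FunctionEnsemble 𝒵 𝒞 where
  funs := Set.univ
  prob := PMF.uniformOfFintype (𝒵 → 𝒞)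
  support_subset := Set.subset_univ _

lemma image_uniform [DecidableEq 𝒵] [Nonempty 𝒵] [Nonempty 𝒞] :
    (uniform 𝒵 𝒞).image = Set.univ :=
  Set.eq_univ_of_forall fun c => ⟨fun _ => c, Set.mem_univ _, Classical.arbitrary 𝒵, rfl⟩

lemma collisionProb_uniform [DecidableEq 𝒵] [Nonempty 𝒞] {z z' : 𝒵}
    (h : z' ≠ z) : (uniform 𝒵 𝒞).collisionProb z z' = 1 / Fintype.card 𝒞 := by
  classical
  have hC : (0 : ℝ) < Fintype.card 𝒞 := by exact_mod_cast Fintype.card_pos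
  -- Overwriting the value at `z'` turns a colliding function and a free value into an arbitrary
  -- function, so colliding functions are a fraction `1/|𝒞|` of all.
  let e : {f : 𝒵 → 𝒞 // f z = f z'} × 𝒞 ≃ (𝒵 → 𝒞) :=
    { toFun := fun x => Function.update x.1 z' x.2
      invFun := fun f => (⟨Function.update f z' (f z), by simp [h.symm]⟩, f z')
      left_inv := by
        rintro ⟨⟨f, hf⟩, c⟩
        simp [h.symm, hf]
      right_inv := fun f => by simp }
  have h1 : (Fintype.card {f : 𝒵 → 𝒞 // f z = f z'} : ℝ) * Fintype.card 𝒞 =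
      Fintype.card (𝒵 → 𝒞) := by
    rw [← Fintype.card_congr e, Fintype.card_prod, Nat.cast_mul]
  have h2 : (0 : ℝ) < Fintype.card (𝒵 → 𝒞) := by exact_mod_cast Fintype.card_pos
  rw [collisionProb, uniform, PMF.toOuterMeasure_uniformOfFintype_apply, ENNReal.toReal_div,
    ENNReal.toReal_natCast, ENNReal.toReal_natCast, div_eq_div_iff h2.ne' hC.ne', one_mul]
  convert h1
  exact Iff.rfl

lemma hasHashProperty_uniform [DecidableEq 𝒵] [Nonempty 𝒵] [Nonempty 𝒞] :
    (uniform 𝒵 𝒞).HasHashProperty 1 0 := by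
  classical
  intro z
  rw [image_uniform, Set.ncard_univ, Nat.card_eq_fintype_card]
  refine (Finset.sum_eq_zero fun z' hz' => ?_).le
  simp only [Finset.mem_filter, Finset.mem_univ, true_and] at hz'
  exact absurd hz'.2 (by rw [collisionProb_uniform hz'.1]; exact lt_irrefl _)

end FunctionEnsemble

/-- Weierstrass's product inequality: the union bound for independent failures of probabilities `a
s`. -/
lemma one_le_prod_one_sub_add_sum {ι : Type*} (T : Finset ι) {a : ι → ℝ} (h0 : ∀ s, 0 ≤ a s)
    (h1 : ∀ s, a s ≤ 1) : 1 ≤ ∏ s ∈ T, (1 - a s) + ∑ s ∈ T, a s := by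
  classical
  induction T using Finset.induction_on with
  | empty => simp
  | insert s T hs ih =>
    rw [Finset.prod_insert hs, Finset.sum_insert hs]
    have hp : ∏ s ∈ T, (1 - a s) ≤ 1 :=
      Finset.prod_le_one (fun s _ => by linarith [h1 s]) fun s _ => by linarith [h0 s]
    nlinarith [h0 s]

/-! ### Losses as integrals against measures -/

section LossMeasure

variable {Ω 𝒵 𝒱 : Type*} [Fintype Ω] [Fintype 𝒵] [Fintype 𝒱] [MeasurableSpace 𝒵]
  [MeasurableSingletonClass 𝒵]

lemma sum_real_singleton_univ (μ : Measure 𝒵) [IsProbabilityMeasure μ] :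
    ∑ z, μ.real {z} = 1 := by
  rw [sum_measureReal_singleton, Finset.coe_univ, probReal_univ]

open scoped Classical in
lemma sum_ite_real_singleton (μ : Measure 𝒵) [IsFiniteMeasure μ] (A : Set 𝒵) :
    (∑ z, if z ∈ A then μ.real {z} else 0) = μ.real A := by
  rw [← Finset.sum_filter, sum_measureReal_singleton]
  congr 1
  ext z
  simp

open scoped Classical in
lemma sum_ite_not_real_singleton (μ : Measure 𝒵) [IsFiniteMeasure μ] (A : Set 𝒵) :
    (∑ z, if z ∈ A then 0 else μ.real {z}) = μ.real Aᶜ := by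
  rw [← sum_ite_real_singleton]
  refine Finset.sum_congr rfl fun z _ => ?_
  by_cases hz : z ∈ A <;> simp [hz]

lemma fibreMass_real (μ : Measure 𝒵) [IsFiniteMeasure μ] (h : 𝒵 → 𝒱) (c : 𝒱) :
    fibreMass (fun z => μ.real {z}) h c = μ.real (h ⁻¹' {c}) := by
  classical
  rw [← sum_ite_real_singleton]
  exact Finset.sum_congr rfl fun z _ => by congr

lemma lintegral_ofReal_eq_sum (μ : Measure 𝒵) [IsFiniteMeasure μ] {φ : 𝒵 → ℝ}
    (hφ : ∀ z, 0 ≤ φ z) :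
    ∫⁻ z, ENNReal.ofReal (φ z) ∂μ = ENNReal.ofReal (∑ z, μ.real {z} * φ z) := by
  rw [lintegral_fintype, ENNReal.ofReal_sum_of_nonneg
    fun z _ => mul_nonneg measureReal_nonneg (hφ z)]
  refine Finset.sum_congr rfl fun z _ => ?_
  rw [ENNReal.ofReal_mul measureReal_nonneg, ofReal_measureReal, mul_comm]

lemma sum_ofReal_mul_lintegral (μ : Measure 𝒵) [IsFiniteMeasure μ] {w : Ω → ℝ}
    (hw : ∀ ω, 0 ≤ w ω) {φ : Ω → 𝒵 → ℝ} (hφ : ∀ ω z, 0 ≤ φ ω z) :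
    ∑ ω, ENNReal.ofReal (w ω) * ∫⁻ z, ENNReal.ofReal (φ ω z) ∂μ =
      ENNReal.ofReal (∑ ω, w ω * ∑ z, μ.real {z} * φ ω z) := by
  have h0 : ∀ ω, 0 ≤ ∑ z, μ.real {z} * φ ω z := fun ω =>
    Finset.sum_nonneg fun z _ => mul_nonneg measureReal_nonneg (hφ ω z)
  rw [ENNReal.ofReal_sum_of_nonneg fun ω _ => mul_nonneg (hw ω) (h0 ω)]
  refine Finset.sum_congr rfl fun ω _ => ?_
  rw [lintegral_ofReal_eq_sum μ (hφ ω), ENNReal.ofReal_mul (hw ω)]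

lemma expected_lintegral_encoderLoss_le [Nonempty 𝒱] (μ : Measure 𝒵) [IsProbabilityMeasure μ]
    {w : Ω → ℝ} (hw : ∀ ω, 0 ≤ w ω) (hw1 : ∑ ω, w ω = 1)
    (h : Ω → 𝒵 → 𝒱) (A : Set 𝒵) {t ε : ℝ} (ht : 0 < t) (hε : 0 ≤ ε)
    (hA : ∀ z, ∑ z', A.indicator (fun u => μ.real {u}) z' *
      (Fintype.card 𝒱 * collision w h z z') ≤
      (∑ z', A.indicator (fun u => μ.real {u}) z') + ε) :
    ∑ ω, ENNReal.ofReal (w ω) *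
        ∫⁻ z, ENNReal.ofReal (encoderLoss (fun u => μ.real {u}) (h ω) z) ∂μ ≤
      μ Aᶜ + ENNReal.ofReal (t + ε / t) := by
  classical
  rw [sum_ofReal_mul_lintegral μ hw fun ω z => encoderLoss_nonneg _ _ _]
  have h1 := expected_encoderLoss_le (fun _ => measureReal_nonneg) (sum_real_singleton_univ μ)
    hw hw1 h A ht hε hA
  rw [sum_ite_not_real_singleton, add_assoc] at h1
  refine (ENNReal.ofReal_le_ofReal h1).trans ?_
  rw [ENNReal.ofReal_add measureReal_nonneg (by positivity), ofReal_measureReal]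

lemma expected_lintegral_decoderLoss_le (μ : Measure 𝒵) [IsProbabilityMeasure μ]
    {w : Ω → ℝ} (hw : ∀ ω, 0 ≤ w ω) (hw1 : ∑ ω, w ω = 1)
    (h : Ω → 𝒵 → 𝒱) (A : Set 𝒵) {ε : ℝ} (hε : 0 ≤ ε)
    (hA : ∀ z ∈ A, ∑ z', A.indicator 1 z' * collision w h z z' ≤ 1 + ε) :
    ∑ ω, ENNReal.ofReal (w ω) *
        ∫⁻ z, ENNReal.ofReal (decoderLoss (fun u => μ.real {u}) (h ω) z) ∂μ ≤
      2 * μ Aᶜ + ENNReal.ofReal ε := by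
  classical
  rw [sum_ofReal_mul_lintegral μ hw fun ω z => decoderLoss_nonneg (fun _ => measureReal_nonneg) _ _]
  have h1 := expected_decoderLoss_le (fun _ => measureReal_nonneg) (sum_real_singleton_univ μ)
    hw hw1 h A hε hA
  rw [sum_ite_not_real_singleton] at h1
  refine (ENNReal.ofReal_le_ofReal h1).trans ?_
  rw [ENNReal.ofReal_add (by positivity) hε, ENNReal.ofReal_mul zero_le_two, ofReal_measureReal,
    ENNReal.ofReal_ofNat]

lemma cond_real_singleton (μ : Measure 𝒵) (A : Set 𝒵) {z : 𝒵} (hz : z ∈ A) :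
    (cond μ A).real {z} = (μ.real A)⁻¹ * μ.real {z} := by
  rw [measureReal_def, cond_apply (Set.toFinite _).measurableSet,
    Set.inter_eq_right.2 (by simpa using hz), ENNReal.toReal_mul, ENNReal.toReal_inv]
  rfl

/-- Conditioning on the fibre of `z` and dividing by the number of values does not lose more than
the encoder loss. -/
lemma mul_one_sub_encoderLoss_le_cond [Nonempty 𝒱] (μ : Measure 𝒵) [IsFiniteMeasure μ]
    (h : 𝒵 → 𝒱) (z : 𝒵) :
    μ {z} * ENNReal.ofReal (1 - encoderLoss (fun u => μ.real {u}) h z) ≤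
      (Fintype.card 𝒱 : ℝ≥0∞)⁻¹ * cond μ (h ⁻¹' {h z}) {z} := by
  have hN : (0 : ℝ) < Fintype.card 𝒱 := by exact_mod_cast Fintype.card_pos
  have h1 : (Fintype.card 𝒱 : ℝ≥0∞)⁻¹ * cond μ (h ⁻¹' {h z}) {z} =
      ENNReal.ofReal (μ.real {z} * (1 / (Fintype.card 𝒱 * μ.real (h ⁻¹' {h z})))) := by
    rw [← ofReal_measureReal (μ := cond μ _), cond_real_singleton μ _ (by simp), ← ENNReal.ofReal_natCast, ← ENNReal.ofReal_inv_of_pos hN,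
      ← ENNReal.ofReal_mul (by positivity)]
    congr 1
    rw [one_div, mul_inv]
    ring
  rw [h1, ← ofReal_measureReal, ← ENNReal.ofReal_mul measureReal_nonneg]
  refine ENNReal.ofReal_le_ofReal (mul_le_mul_of_nonneg_left ?_ measureReal_nonneg)
  rw [encoderLoss, sub_sub_cancel, fibreMass_real]
  exact min_le_right _ _

/-- This is exact, whereas the cap at one makes the encoder counterpart an inequality. -/
lemma ofReal_one_sub_decoderLoss (μ : Measure 𝒵) [IsFiniteMeasure μ] (h : 𝒵 → 𝒱) (z : 𝒵) :
    ENNReal.ofReal (1 - decoderLoss (fun u => μ.real {u}) h z) = cond μ (h ⁻¹' {h z}) {z} := by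
  rw [← ofReal_measureReal (μ := cond μ _), cond_real_singleton μ _ (by simp), decoderLoss, sub_sub_cancel, fibreMass_real]
  congr 1
  ring

end LossMeasure

/-! ### The joint law as iterated integrals, and the losses of the generators -/

namespace BlockModel

variable {I J S : Type*} [Fintype I] [Fintype S] [DecidableEq S]
  {S₀ : Finset S} {SI : I → Finset S}
  {Z : S → Type*} {X : I → Type*} {Y : J → Type*}
  [∀ s, Fintype (Z s)]
  [∀ s, MeasurableSpace (Z s)] [∀ i, MeasurableSpace (X i)] [∀ j, MeasurableSpace (Y j)]
  [∀ s, MeasurableSingletonClass (Z s)]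

/-- Since the message sets partition `S`, a tuple is the same as the family of its parts. This is
what turns the nested integrals of the code into sums over `Z_S`. -/
lemma split_bijective (Z : S → Type*) (hcover : ∀ s, s ∈ S₀ ∨ ∃ i, s ∈ SI i)
    (hdisj₀ : ∀ i, Disjoint S₀ (SI i)) (hdisj : ∀ i i', i ≠ i' → Disjoint (SI i) (SI i')) :
    Function.Bijective (fun z : ∀ s, Z s =>
      ((S₀.restrict z, fun i => (SI i).restrict z) :
        ((s : S₀) → Z s) × (∀ i, (s : SI i) → Z s))) := by
  classical
  constructor
  · intro z z' h
    rw [Prod.mk.injEq] at h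
    funext s
    rcases hcover s with hs | ⟨i, hs⟩
    · exact congrFun h.1 ⟨s, hs⟩
    · exact congrFun (congrFun h.2 i) ⟨s, hs⟩
  · rintro ⟨z₀, zI⟩
    refine ⟨fun s => if hs : s ∈ S₀ then z₀ ⟨s, hs⟩ else
      zI ((hcover s).resolve_left hs).choose ⟨s, ((hcover s).resolve_left hs).choose_spec⟩, ?_⟩
    refine Prod.ext ?_ ?_
    · funext s
      simp [s.2]
    · funext i s
      have hs : s.1 ∉ S₀ := fun h => Finset.disjoint_left.1 (hdisj₀ i) h s.2
      have hi : ((hcover s).resolve_left hs).choose = i := by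
        by_contra hne
        exact Finset.disjoint_left.1 (hdisj _ _ hne) ((hcover s).resolve_left hs).choose_spec s.2
      simp only [Finset.restrict_def, hs, dif_neg, not_false_eq_true]
      -- The chosen index equals `i` only propositionally, so the identity is proved for a variable
      -- index and then substituted.
      have key : ∀ (i' : I) (hi' : s.1 ∈ SI i'), i' = i → zI i' ⟨s.1, hi'⟩ = zI i s := by
        rintro i' hi' rfl
        rfl
      exact key _ _ hi

lemma prod_split {a : S → ℝ≥0∞} (hcover : ∀ s, s ∈ S₀ ∨ ∃ i, s ∈ SI i)
    (hdisj₀ : ∀ i, Disjoint S₀ (SI i)) (hdisj : ∀ i i', i ≠ i' → Disjoint (SI i) (SI i')) :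
    ∏ s, a s = (∏ s ∈ S₀, a s) * ∏ i, ∏ s ∈ SI i, a s := by
  classical
  rw [← Finset.prod_biUnion fun i _ i' _ h => hdisj i i' h, ← Finset.prod_union]
  · refine Finset.prod_congr ?_ fun _ _ => rfl
    ext s
    simpa using hcover s
  · rw [Finset.disjoint_biUnion_right]
    exact fun i _ => hdisj₀ i

lemma lintegral_sourceLaw (B : BlockModel S₀ SI Z X Y) (F : (∀ s, Z s) → ℝ≥0∞) :
    ∫⁻ z, F z ∂B.sourceLaw = ∑ z, B.sourceMass z * F z := by
  rw [sourceLaw, lintegral_sum_measure, tsum_fintype]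
  simp [lintegral_smul_measure, lintegral_dirac]

/-- An iterated integral over the parts `Z_{S₀}` and `Z_{Sᵢ}` is a sum over `Z_S`. -/
lemma lintegral_lintegral_eq_sum (hcover : ∀ s, s ∈ S₀ ∨ ∃ i, s ∈ SI i)
    (hdisj₀ : ∀ i, Disjoint S₀ (SI i)) (hdisj : ∀ i i', i ≠ i' → Disjoint (SI i) (SI i'))
    (μ : Measure ((s : S₀) → Z s)) (κ : ((s : S₀) → Z s) → ∀ i, Measure ((s : SI i) → Z s))
    [∀ z₀ i, IsFiniteMeasure (κ z₀ i)]
    (G : ((s : S₀) → Z s) → (∀ i, (s : SI i) → Z s) → ℝ≥0∞) :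
    ∫⁻ z₀, ∫⁻ zI, G z₀ zI ∂Measure.pi (κ z₀) ∂μ =
      ∑ z : ∀ s, Z s, (μ {S₀.restrict z} * ∏ i, κ (S₀.restrict z) i {(SI i).restrict z}) *
        G (S₀.restrict z) fun i => (SI i).restrict z := by
  classical
  let e := Equiv.ofBijective _ (split_bijective Z hcover hdisj₀ hdisj)
  rw [lintegral_fintype]
  simp only [lintegral_fintype, Measure.pi_singleton, Finset.sum_mul]
  rw [← Fintype.sum_prod_type', ← e.sum_comp]
  refine Finset.sum_congr rfl fun z _ => ?_
  simp only [e, Equiv.ofBijective_apply]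
  ring

lemma lintegral_sourceLaw_split (hcover : ∀ s, s ∈ S₀ ∨ ∃ i, s ∈ SI i)
    (hdisj₀ : ∀ i, Disjoint S₀ (SI i)) (hdisj : ∀ i i', i ≠ i' → Disjoint (SI i) (SI i'))
    (B : BlockModel S₀ SI Z X Y)
    (G : ((s : S₀) → Z s) → (∀ i, (s : SI i) → Z s) → ℝ≥0∞) :
    ∫⁻ z, G (S₀.restrict z) (fun i => (SI i).restrict z) ∂B.sourceLaw =
      ∫⁻ z₀, ∫⁻ zI, G z₀ zI ∂Measure.pi (fun i => B.privateSource i z₀) ∂B.commonSource := by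
  rw [lintegral_sourceLaw, lintegral_lintegral_eq_sum hcover hdisj₀ hdisj]
  rfl

lemma lintegral_fst_jointLaw (B : BlockModel S₀ SI Z X Y) (F : (∀ s, Z s) → ℝ≥0∞) :
    ∫⁻ ω, F ω.1 ∂B.jointLaw = ∫⁻ z, F z ∂B.sourceLaw := by
  conv_rhs => rw [← Measure.fst_compProd B.sourceLaw (B.channel ∘ₖ B.inputKernel)]
  rw [Measure.fst, lintegral_map (measurable_of_countable F) measurable_fst]
  rfl

lemma lintegral_common_jointLaw (hcover : ∀ s, s ∈ S₀ ∨ ∃ i, s ∈ SI i)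
    (hdisj₀ : ∀ i, Disjoint S₀ (SI i)) (hdisj : ∀ i i', i ≠ i' → Disjoint (SI i) (SI i'))
    (B : BlockModel S₀ SI Z X Y) (F : ((s : S₀) → Z s) → ℝ≥0∞) :
    ∫⁻ ω, F (S₀.restrict ω.1) ∂B.jointLaw = ∫⁻ z₀, F z₀ ∂B.commonSource := by
  rw [lintegral_fst_jointLaw B (fun z => F (S₀.restrict z)),
    lintegral_sourceLaw_split hcover hdisj₀ hdisj B (fun z₀ _ => F z₀)]
  simp

lemma lintegral_private_jointLaw (hcover : ∀ s, s ∈ S₀ ∨ ∃ i, s ∈ SI i)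
    (hdisj₀ : ∀ i, Disjoint S₀ (SI i)) (hdisj : ∀ i i', i ≠ i' → Disjoint (SI i) (SI i'))
    (B : BlockModel S₀ SI Z X Y) (i : I) (F : ((s : S₀) → Z s) → ((s : SI i) → Z s) → ℝ≥0∞) :
    ∫⁻ ω, F (S₀.restrict ω.1) ((SI i).restrict ω.1) ∂B.jointLaw =
      ∫⁻ z₀, ∫⁻ zi, F z₀ zi ∂B.privateSource i z₀ ∂B.commonSource := by
  rw [lintegral_fst_jointLaw B (fun z => F (S₀.restrict z) ((SI i).restrict z)),
    lintegral_sourceLaw_split hcover hdisj₀ hdisj B (fun z₀ zI => F z₀ (zI i))]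
  refine lintegral_congr fun z₀ => ?_
  exact (measurePreserving_eval (fun i => B.privateSource i z₀) i).lintegral_comp
    (measurable_of_countable (F z₀))

/-- The partition matters: with overlapping or missing parts, `sourceLaw` need not have total mass
one. -/
lemma isProbabilityMeasure_jointLaw (hcover : ∀ s, s ∈ S₀ ∨ ∃ i, s ∈ SI i)
    (hdisj₀ : ∀ i, Disjoint S₀ (SI i)) (hdisj : ∀ i i', i ≠ i' → Disjoint (SI i) (SI i'))
    (B : BlockModel S₀ SI Z X Y) : IsProbabilityMeasure B.jointLaw :=
  ⟨by simpa using lintegral_common_jointLaw hcover hdisj₀ hdisj B 1⟩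

lemma measurable_comp_fst {γ : Type*} [MeasurableSpace γ] (φ : (∀ s, Z s) → γ) :
    Measurable fun ω : (∀ s, Z s) × (∀ j, Y j) => φ ω.1 :=
  (measurable_of_countable φ).comp measurable_fst

variable [∀ s, Nonempty (Z s)]

/-- The posterior law of `Z_T` given `Y_j`. -/
abbrev posterior (B : BlockModel S₀ SI Z X Y) (T : Finset S) (j : J) :
    Kernel (Y j) ((s : T) → Z s) :=
  condDistrib (fun ω : (∀ s, Z s) × (∀ j, Y j) => T.restrict ω.1) (fun ω => ω.2 j) B.jointLaw

/-- Disintegration over `Y_j`. Measurability in `y` for each fixed `z` suffices because `Z_T` is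
finite. -/
lemma lintegral_decoder_jointLaw (B : BlockModel S₀ SI Z X Y) (T : Finset S) (j : J)
    {F : Y j → ((s : T) → Z s) → ℝ≥0∞} (hF : ∀ z, Measurable fun y => F y z) :
    ∫⁻ ω, F (ω.2 j) (T.restrict ω.1) ∂B.jointLaw =
      ∫⁻ y, ∫⁻ z, F y z ∂B.posterior T j y ∂(B.jointLaw.map fun ω => ω.2 j) := by
  have hm : Measurable fun x : Y j × ((s : T) → Z s) => F x.1 x.2 :=
    measurable_from_prod_countable_left fun z => hF z
  have hT : Measurable fun ω : (∀ s, Z s) × (∀ j, Y j) => T.restrict ω.1 :=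
    measurable_comp_fst T.restrict
  have hj : Measurable fun ω : (∀ s, Z s) × (∀ j, Y j) => ω.2 j :=
    (measurable_pi_apply j).comp measurable_snd
  rw [← Measure.lintegral_compProd hm, compProd_map_condDistrib hT.aemeasurable,
    lintegral_map hm (hj.prodMk hT)]

lemma measurable_decoderLoss {𝒵 𝒱 𝒴 : Type*} [Fintype 𝒵] [Fintype 𝒱] [MeasurableSpace 𝒵]
    [MeasurableSingletonClass 𝒵] [MeasurableSpace 𝒴] (κ : Kernel 𝒴 𝒵) (h : 𝒵 → 𝒱) (z : 𝒵) :
    Measurable fun y => decoderLoss (fun u => (κ y).real {u}) h z := by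
  classical
  have h1 : ∀ u, Measurable fun y => (κ y).real {u} := fun u =>
    (κ.measurable_coe (measurableSet_singleton u)).ennreal_toReal
  refine measurable_const.sub ((h1 z).div ?_)
  refine Finset.measurable_sum _ fun u _ => ?_
  split_ifs
  exacts [h1 u, measurable_const]

variable {C M : S → Type*} [∀ s, Fintype (C s)] [∀ s, Nonempty (C s)]
  [∀ s, Fintype (M s)] [∀ s, Nonempty (M s)]

/-- The functions of the encoders, on the coordinates in `T`. -/
def encoderMap (f : ∀ s, Z s → C s) (g : ∀ s, Z s → M s) (T : Finset S) (z : (s : T) → Z s)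
    (s : T) : C s × M s := (f s (z s), g s (z s))

/-- The functions of the decoders, on the coordinates in `T`. -/
def decoderMap (f : ∀ s, Z s → C s) (T : Finset S) (z : (s : T) → Z s) (s : T) : C s :=
  f s (z s)

lemma constraintSet_eq_decoderMap (f : ∀ s, Z s → C s) (T : Finset S) (z : ∀ s, Z s) :
    constraintSet T f (fun s => f s (z s)) =
      decoderMap f T ⁻¹' {decoderMap f T (T.restrict z)} := by
  ext u
  simp [constraintSet, decoderMap, funext_iff]

lemma constraintSet_inter_eq_encoderMap (f : ∀ s, Z s → C s) (g : ∀ s, Z s → M s) (T : Finset S)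
    (z : ∀ s, Z s) :
    constraintSet T f (fun s => f s (z s)) ∩ constraintSet T g (fun s => g s (z s)) =
      encoderMap f g T ⁻¹' {encoderMap f g T (T.restrict z)} := by
  ext u
  simp [constraintSet, encoderMap, funext_iff, forall_and]

/-- The loss of the generator of `Z_{S₀}`. -/
def commonLoss (B : BlockModel S₀ SI Z X Y) (f : ∀ s, Z s → C s) (g : ∀ s, Z s → M s)
    (z₀ : (s : S₀) → Z s) : ℝ :=
  encoderLoss (fun u => B.commonSource.real {u}) (encoderMap f g S₀) z₀

/-- The loss of the generator of Encoder `i`. -/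
def privateLoss (B : BlockModel S₀ SI Z X Y) (f : ∀ s, Z s → C s) (g : ∀ s, Z s → M s)
    (i : I) (z₀ : (s : S₀) → Z s) (zi : (s : SI i) → Z s) : ℝ :=
  encoderLoss (fun u => (B.privateSource i z₀).real {u}) (encoderMap f g (SI i)) zi

/-- The loss of Decoder `j`. -/
def posteriorLoss (B : BlockModel S₀ SI Z X Y) (D : Finset S) (f : ∀ s, Z s → C s)
    (j : J) (y : Y j) (z : (s : D) → Z s) : ℝ :=
  decoderLoss (fun u => (B.posterior D j y).real {u}) (decoderMap f D) z

end BlockModel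

/-! ### From losses of the generators to the error probability -/

namespace BlockModel

variable {I J S : Type*} [Fintype I] [Fintype S] [DecidableEq S]
  {S₀ : Finset S} {SI : I → Finset S}
  {Z : S → Type*} {X : I → Type*} {Y : J → Type*}
  [∀ s, Fintype (Z s)]
  [∀ s, MeasurableSpace (Z s)] [∀ i, MeasurableSpace (X i)] [∀ j, MeasurableSpace (Y j)]
  [∀ s, MeasurableSingletonClass (Z s)]
  [∀ s, Nonempty (Z s)]
  {C M : S → Type*} [∀ s, Fintype (C s)] [∀ s, Nonempty (C s)]
  [∀ s, Fintype (M s)] [∀ s, Nonempty (M s)] [Fintype J]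

instance (B : BlockModel S₀ SI Z X Y) (f : ∀ s, Z s → C s) (g : ∀ s, Z s → M s) (c : ∀ s, C s)
    (m : ∀ s, M s) : IsZeroOrProbabilityMeasure (B.commonGenerator f g c m) := by
  unfold commonGenerator; infer_instance

instance (B : BlockModel S₀ SI Z X Y) (f : ∀ s, Z s → C s) (g : ∀ s, Z s → M s) (c : ∀ s, C s)
    (m : ∀ s, M s) (i : I) (z₀ : (s : S₀) → Z s) :
    IsZeroOrProbabilityMeasure (B.privateGenerator f g c m i z₀) := by
  unfold privateGenerator; infer_instance

instance (B : BlockModel S₀ SI Z X Y) (T : Finset S) (f : ∀ s, Z s → C s) (c : ∀ s, C s)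
    (j : J) (y : Y j) : IsZeroOrProbabilityMeasure (B.decoderGenerator T f c j y) := by
  unfold decoderGenerator; infer_instance

/-- The probability weight that survives the losses of all generators. -/
def survival (B : BlockModel S₀ SI Z X Y) (D : J → Finset S) (f : ∀ s, Z s → C s)
    (g : ∀ s, Z s → M s) (ω : (∀ s, Z s) × (∀ j, Y j)) : ℝ≥0∞ :=
  (ENNReal.ofReal (1 - B.commonLoss f g (S₀.restrict ω.1)) *
    ∏ i, ENNReal.ofReal (1 - B.privateLoss f g i (S₀.restrict ω.1) ((SI i).restrict ω.1))) *
    ∏ j, ENNReal.ofReal (1 - B.posteriorLoss (D j) f j (ω.2 j) ((D j).restrict ω.1))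

lemma measurable_survival_right (B : BlockModel S₀ SI Z X Y) (D : J → Finset S)
    (f : ∀ s, Z s → C s) (z : ∀ s, Z s) :
    Measurable fun y : ∀ j, Y j =>
      ∏ j, ENNReal.ofReal (1 - B.posteriorLoss (D j) f j (y j) ((D j).restrict z)) := by
  refine Finset.measurable_prod _ fun j _ => ENNReal.measurable_ofReal.comp
    (measurable_const.sub ?_)
  exact (measurable_decoderLoss (B.posterior (D j) j) (decoderMap f (D j))
    ((D j).restrict z)).comp (measurable_pi_apply j)

lemma measurable_survival (B : BlockModel S₀ SI Z X Y) (D : J → Finset S)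
    (f : ∀ s, Z s → C s) (g : ∀ s, Z s → M s) : Measurable (B.survival D f g) :=
  measurable_from_prod_countable_right fun z => by
    dsimp only [survival]
    exact (B.measurable_survival_right D f z).const_mul _

lemma mul_le_inv_card_mul_cond (μ : Measure ((s : S₀) → Z s)) [IsFiniteMeasure μ]
    (f : ∀ s, Z s → C s) (g : ∀ s, Z s → M s) (z : ∀ s, Z s) :
    μ {S₀.restrict z} *
        ENNReal.ofReal (1 - encoderLoss (fun u => μ.real {u}) (encoderMap f g S₀) (S₀.restrict z)) ≤
      (∏ s ∈ S₀, ((Fintype.card (C s) : ℝ≥0∞)⁻¹ * (Fintype.card (M s) : ℝ≥0∞)⁻¹)) *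
        cond μ (constraintSet S₀ f (fun s => f s (z s)) ∩ constraintSet S₀ g (fun s => g s (z s)))
          {S₀.restrict z} := by
  refine (mul_one_sub_encoderLoss_le_cond μ (encoderMap f g S₀) (S₀.restrict z)).trans
    (le_of_eq ?_)
  rw [constraintSet_inter_eq_encoderMap]
  congr 1
  rw [Fintype.card_pi, Nat.cast_prod, ENNReal.prod_inv_distrib fun s _ t _ _ => Or.inr (ENNReal.natCast_ne_top _),
    ← Finset.prod_coe_sort S₀
      (fun s => (Fintype.card (C s) : ℝ≥0∞)⁻¹ * (Fintype.card (M s) : ℝ≥0∞)⁻¹)]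
  refine Finset.prod_congr rfl fun s _ => ?_
  rw [Fintype.card_prod, Nat.cast_mul, ENNReal.mul_inv (by simp) (by simp)]

/-- Write the success probability averaged over `c` and `m` as a sum over `(z, c, m)` and keep only
the terms whose labels are those of `z`. There, a uniform label times the generator's mass is at
least the source mass times one minus the encoder loss, part by part, and a decoder that returns `z`
is correct. -/
lemma lintegral_survival_le (hcover : ∀ s, s ∈ S₀ ∨ ∃ i, s ∈ SI i)
    (hdisj₀ : ∀ i, Disjoint S₀ (SI i)) (hdisj : ∀ i i', i ≠ i' → Disjoint (SI i) (SI i'))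
    (B : BlockModel S₀ SI Z X Y) (D : J → Finset S) (f : ∀ s, Z s → C s) (g : ∀ s, Z s → M s) :
    ∫⁻ ω, B.survival D f g ω ∂B.jointLaw ≤
      ∑ c : ∀ s, C s, (∏ s, (Fintype.card (C s) : ℝ≥0∞)⁻¹) * ∑ m : ∀ s, M s,
        (∏ s, (Fintype.card (M s) : ℝ≥0∞)⁻¹) * B.successProbGiven D f g c m := by
  classical
  set b : (∀ s, Z s) → (∀ j, Y j) → ℝ≥0∞ := fun z y =>
    ∏ j, ENNReal.ofReal (1 - B.posteriorLoss (D j) f j (y j) ((D j).restrict z)) with hb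
  have h1 : ∫⁻ ω, B.survival D f g ω ∂B.jointLaw = ∑ z, B.sourceMass z *
      ((ENNReal.ofReal (1 - B.commonLoss f g (S₀.restrict z)) *
        ∏ i, ENNReal.ofReal (1 - B.privateLoss f g i (S₀.restrict z) ((SI i).restrict z))) *
        ∫⁻ y, b z y ∂((B.channel ∘ₖ B.inputKernel) z)) := by
    rw [jointLaw, Measure.lintegral_compProd (B.measurable_survival D f g), lintegral_sourceLaw]
    refine Finset.sum_congr rfl fun z _ => ?_
    congr 1
    dsimp only [survival]
    exact lintegral_const_mul (μ := (B.channel ∘ₖ B.inputKernel) z) _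
      (B.measurable_survival_right D f z)
  let inner : (∀ s, C s) → (∀ s, M s) → ((s : S₀) → Z s) → (∀ i, (s : SI i) → Z s) → ℝ≥0∞ :=
    fun c m z₀ zI => ∫⁻ x, ∫⁻ y, ∏ j, B.decoderGenerator (D j) f c j (y j)
      (constraintSet (D j) g m) ∂(B.channel x) ∂(Measure.pi fun i => B.inputMap i (z₀, zI i))
  have h2 : ∀ c m, B.successProbGiven D f g c m = ∑ z : ∀ s, Z s,
      (B.commonGenerator f g c m {S₀.restrict z} *
        ∏ i, B.privateGenerator f g c m i (S₀.restrict z) {(SI i).restrict z}) *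
        inner c m (S₀.restrict z) fun i => (SI i).restrict z := by
    intro c m
    exact lintegral_lintegral_eq_sum hcover hdisj₀ hdisj (B.commonGenerator f g c m)
      (fun z₀ i => B.privateGenerator f g c m i z₀) (inner c m)
  have h3 : ∀ z : ∀ s, Z s, ∫⁻ y, b z y ∂((B.channel ∘ₖ B.inputKernel) z) ≤
      inner (fun s => f s (z s)) (fun s => g s (z s)) (S₀.restrict z)
        fun i => (SI i).restrict z := by
    intro z
    rw [Kernel.lintegral_comp _ _ _ (B.measurable_survival_right D f z)]
    refine lintegral_mono fun x => lintegral_mono fun y => Finset.prod_le_prod' fun j _ => ?_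
    rw [posteriorLoss, ofReal_one_sub_decoderLoss, ← constraintSet_eq_decoderMap]
    -- Only exact recovery of `z` is counted; it forces the correct messages.
    refine measure_mono (Set.singleton_subset_iff.2 ?_)
    intro s
    rfl
  set NC : ℝ≥0∞ := ∏ s, (Fintype.card (C s) : ℝ≥0∞)⁻¹
  set NM : ℝ≥0∞ := ∏ s, (Fintype.card (M s) : ℝ≥0∞)⁻¹
  let term : (∀ s, C s) → (∀ s, M s) → (∀ s, Z s) → ℝ≥0∞ := fun c m z =>
    NC * (NM * ((B.commonGenerator f g c m {S₀.restrict z} *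
        ∏ i, B.privateGenerator f g c m i (S₀.restrict z) {(SI i).restrict z}) *
        inner c m (S₀.restrict z) fun i => (SI i).restrict z))
  have h4 : ∑ c : ∀ s, C s, NC * ∑ m : ∀ s, M s, NM * B.successProbGiven D f g c m =
      ∑ z, ∑ c, ∑ m, term c m z := by
    simp only [h2, Finset.mul_sum]
    rw [Finset.sum_comm]
    simp only [term]
    rw [Finset.sum_comm]
    rw [Finset.sum_congr rfl fun c _ => Finset.sum_comm]
    rw [Finset.sum_comm]
  rw [h1, h4]
  refine Finset.sum_le_sum fun z _ => ?_
  -- Every `c` and `m` other than the labels of `z` is discarded.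
  refine le_trans ?_ ((Finset.single_le_sum (f := fun m => term (fun s => f s (z s)) m z)
    (fun _ _ => zero_le) (Finset.mem_univ fun s => g s (z s))).trans
    (Finset.single_le_sum (f := fun c => ∑ m, term c m z)
    (fun _ _ => zero_le) (Finset.mem_univ fun s => f s (z s))))
  -- The uniform label weight factors along the partition, one share for each generator.
  have h5 : NC * NM = (∏ s ∈ S₀, ((Fintype.card (C s) : ℝ≥0∞)⁻¹ * (Fintype.card (M s) : ℝ≥0∞)⁻¹)) *
      ∏ i, ∏ s ∈ SI i, ((Fintype.card (C s) : ℝ≥0∞)⁻¹ * (Fintype.card (M s) : ℝ≥0∞)⁻¹) := by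
    rw [← prod_split (SI := SI) hcover hdisj₀ hdisj, Finset.prod_mul_distrib]
  have h6 := mul_le_inv_card_mul_cond B.commonSource f g z
  have h7 := fun i => mul_le_inv_card_mul_cond (B.privateSource i (S₀.restrict z)) f g z
  calc _ = (B.commonSource {S₀.restrict z} *
          ENNReal.ofReal (1 - B.commonLoss f g (S₀.restrict z))) *
        (∏ i, (B.privateSource i (S₀.restrict z) {(SI i).restrict z} *
          ENNReal.ofReal (1 - B.privateLoss f g i (S₀.restrict z) ((SI i).restrict z)))) *
        ∫⁻ y, b z y ∂((B.channel ∘ₖ B.inputKernel) z) := by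
        rw [sourceMass, Finset.prod_mul_distrib]
        ring
    _ ≤ _ := mul_le_mul' (mul_le_mul' h6 (Finset.prod_le_prod' fun i _ => h7 i)) (h3 z)
    _ = term (fun s => f s (z s)) (fun s => g s (z s)) z := by
        simp only [term]
        rw [← mul_assoc NC, h5, Finset.prod_mul_distrib (s := (Finset.univ : Finset I))]
        simp only [commonGenerator, privateGenerator]
        ring

/-- The expected total loss. -/
def totalLoss (B : BlockModel S₀ SI Z X Y) (D : J → Finset S) (f : ∀ s, Z s → C s)
    (g : ∀ s, Z s → M s) : ℝ≥0∞ :=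
  (∫⁻ z₀, ENNReal.ofReal (B.commonLoss f g z₀) ∂B.commonSource) +
  (∑ i, ∫⁻ z₀, ∫⁻ zi, ENNReal.ofReal (B.privateLoss f g i z₀ zi) ∂B.privateSource i z₀
    ∂B.commonSource) +
  ∑ j, ∫⁻ y, ∫⁻ z, ENNReal.ofReal (B.posteriorLoss (D j) f j y z) ∂B.posterior (D j) j y
    ∂(B.jointLaw.map fun ω => ω.2 j)

/-- The pointwise union bound over all generators, to be integrated against the joint law. -/
lemma one_le_survival_add (B : BlockModel S₀ SI Z X Y) (D : J → Finset S)
    (f : ∀ s, Z s → C s) (g : ∀ s, Z s → M s) (ω : (∀ s, Z s) × (∀ j, Y j)) :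
    1 ≤ B.survival D f g ω + (ENNReal.ofReal (B.commonLoss f g (S₀.restrict ω.1)) +
      (∑ i, ENNReal.ofReal (B.privateLoss f g i (S₀.restrict ω.1) ((SI i).restrict ω.1))) +
      ∑ j, ENNReal.ofReal (B.posteriorLoss (D j) f j (ω.2 j) ((D j).restrict ω.1))) := by
  have a0 : 0 ≤ B.commonLoss f g (S₀.restrict ω.1) := encoderLoss_nonneg _ _ _
  have a1 : B.commonLoss f g (S₀.restrict ω.1) ≤ 1 :=
    encoderLoss_le_one (fun _ => measureReal_nonneg) _ _
  have b0 : ∀ i, 0 ≤ B.privateLoss f g i (S₀.restrict ω.1) ((SI i).restrict ω.1) :=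
    fun i => encoderLoss_nonneg _ _ _
  have b1 : ∀ i, B.privateLoss f g i (S₀.restrict ω.1) ((SI i).restrict ω.1) ≤ 1 :=
    fun i => encoderLoss_le_one (fun _ => measureReal_nonneg) _ _
  have c0 : ∀ j, 0 ≤ B.posteriorLoss (D j) f j (ω.2 j) ((D j).restrict ω.1) :=
    fun j => decoderLoss_nonneg (fun _ => measureReal_nonneg) _ _
  have c1 : ∀ j, B.posteriorLoss (D j) f j (ω.2 j) ((D j).restrict ω.1) ≤ 1 :=
    fun j => decoderLoss_le_one (fun _ => measureReal_nonneg) _ _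
  unfold survival
  generalize B.commonLoss f g (S₀.restrict ω.1) = a at *
  set b := fun i => B.privateLoss f g i (S₀.restrict ω.1) ((SI i).restrict ω.1)
  set c := fun j => B.posteriorLoss (D j) f j (ω.2 j) ((D j).restrict ω.1)
  have hb := one_le_prod_one_sub_add_sum Finset.univ b0 b1
  have hc := one_le_prod_one_sub_add_sum Finset.univ c0 c1
  have pb0 : 0 ≤ ∏ i, (1 - b i) := Finset.prod_nonneg fun i _ => sub_nonneg.2 (b1 i)
  have pc0 : 0 ≤ ∏ j, (1 - c j) := Finset.prod_nonneg fun j _ => sub_nonneg.2 (c1 j)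
  have pb1 : ∏ i, (1 - b i) ≤ 1 :=
    Finset.prod_le_one (fun i _ => sub_nonneg.2 (b1 i)) fun i _ => sub_le_self _ (b0 i)
  have pc1 : ∏ j, (1 - c j) ≤ 1 :=
    Finset.prod_le_one (fun j _ => sub_nonneg.2 (c1 j)) fun j _ => sub_le_self _ (c0 j)
  have sb0 : 0 ≤ ∑ i, b i := Finset.sum_nonneg fun i _ => b0 i
  have sc0 : 0 ≤ ∑ j, c j := Finset.sum_nonneg fun j _ => c0 j
  rw [← ENNReal.ofReal_prod_of_nonneg fun i _ => sub_nonneg.2 (b1 i),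
    ← ENNReal.ofReal_prod_of_nonneg fun j _ => sub_nonneg.2 (c1 j),
    ← ENNReal.ofReal_sum_of_nonneg fun i _ => b0 i, ← ENNReal.ofReal_sum_of_nonneg fun j _ => c0 j,
    ← ENNReal.ofReal_mul (by linarith), ← ENNReal.ofReal_mul (mul_nonneg (by linarith) pb0),
    ← ENNReal.ofReal_add a0 sb0, ← ENNReal.ofReal_add (by linarith) sc0,
    ← ENNReal.ofReal_add (mul_nonneg (mul_nonneg (by linarith) pb0) pc0) (by linarith),
    ← ENNReal.ofReal_one]
  refine ENNReal.ofReal_le_ofReal ?_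
  set p := ∏ i, (1 - b i)
  set q := ∏ j, (1 - c j)
  have e1 : 1 - (1 - a) * p ≤ a + (1 - p) := by nlinarith
  have e2 : 1 - (1 - a) * p * q ≤ (1 - (1 - a) * p) + (1 - q) := by
    have : (1 - a) * p ≤ 1 := mul_le_one₀ (by linarith) pb0 pb1
    nlinarith
  linarith

lemma measurable_posteriorLoss (B : BlockModel S₀ SI Z X Y) (T : Finset S)
    (f : ∀ s, Z s → C s) (j : J) :
    Measurable fun ω : (∀ s, Z s) × (∀ j, Y j) =>
      ENNReal.ofReal (B.posteriorLoss T f j (ω.2 j) (T.restrict ω.1)) := by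
  refine measurable_from_prod_countable_right fun z => ?_
  exact (ENNReal.measurable_ofReal.comp (measurable_decoderLoss (B.posterior T j) (decoderMap f T)
    (T.restrict z))).comp (measurable_pi_apply j)

lemma lintegral_posteriorLoss (B : BlockModel S₀ SI Z X Y) (T : Finset S)
    (f : ∀ s, Z s → C s) (j : J) :
    ∫⁻ ω, ENNReal.ofReal (B.posteriorLoss T f j (ω.2 j) (T.restrict ω.1)) ∂B.jointLaw =
      ∫⁻ y, ∫⁻ z, ENNReal.ofReal (B.posteriorLoss T f j y z) ∂B.posterior T j y
        ∂(B.jointLaw.map fun ω => ω.2 j) :=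
  B.lintegral_decoder_jointLaw T j (F := fun y z => ENNReal.ofReal (B.posteriorLoss T f j y z))
    fun z => ENNReal.measurable_ofReal.comp
      (measurable_decoderLoss (B.posterior T j) (decoderMap f T) z)

lemma one_le_lintegral_survival_add (hcover : ∀ s, s ∈ S₀ ∨ ∃ i, s ∈ SI i)
    (hdisj₀ : ∀ i, Disjoint S₀ (SI i)) (hdisj : ∀ i i', i ≠ i' → Disjoint (SI i) (SI i'))
    (B : BlockModel S₀ SI Z X Y) (D : J → Finset S) (f : ∀ s, Z s → C s) (g : ∀ s, Z s → M s) :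
    1 ≤ ∫⁻ ω, B.survival D f g ω ∂B.jointLaw + B.totalLoss D f g := by
  have := isProbabilityMeasure_jointLaw hcover hdisj₀ hdisj B
  set φ₀ : (∀ s, Z s) × (∀ j, Y j) → ℝ≥0∞ := fun ω =>
    ENNReal.ofReal (B.commonLoss f g (S₀.restrict ω.1))
  set φ₁ : I → (∀ s, Z s) × (∀ j, Y j) → ℝ≥0∞ := fun i ω =>
    ENNReal.ofReal (B.privateLoss f g i (S₀.restrict ω.1) ((SI i).restrict ω.1))
  set φ₂ : J → (∀ s, Z s) × (∀ j, Y j) → ℝ≥0∞ := fun j ω =>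
    ENNReal.ofReal (B.posteriorLoss (D j) f j (ω.2 j) ((D j).restrict ω.1))
  have m₀ : Measurable φ₀ :=
    measurable_comp_fst fun z => ENNReal.ofReal (B.commonLoss f g (S₀.restrict z))
  have m₁ : ∀ i, Measurable (φ₁ i) := fun i => measurable_comp_fst fun z =>
    ENNReal.ofReal (B.privateLoss f g i (S₀.restrict z) ((SI i).restrict z))
  have m₂ : ∀ j, Measurable (φ₂ j) := fun j => B.measurable_posteriorLoss (D j) f j
  have e₀ : ∫⁻ ω, φ₀ ω ∂B.jointLaw =
      ∫⁻ z₀, ENNReal.ofReal (B.commonLoss f g z₀) ∂B.commonSource :=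
    lintegral_common_jointLaw hcover hdisj₀ hdisj B
      (fun z₀ => ENNReal.ofReal (B.commonLoss f g z₀))
  have e₁ : ∀ i, ∫⁻ ω, φ₁ i ω ∂B.jointLaw = ∫⁻ z₀, ∫⁻ zi,
      ENNReal.ofReal (B.privateLoss f g i z₀ zi) ∂B.privateSource i z₀ ∂B.commonSource := fun i =>
    lintegral_private_jointLaw hcover hdisj₀ hdisj B i
      (fun z₀ zi => ENNReal.ofReal (B.privateLoss f g i z₀ zi))
  have e₂ : ∀ j, ∫⁻ ω, φ₂ j ω ∂B.jointLaw = ∫⁻ y, ∫⁻ z,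
      ENNReal.ofReal (B.posteriorLoss (D j) f j y z) ∂B.posterior (D j) j y
      ∂(B.jointLaw.map fun ω => ω.2 j) := fun j => B.lintegral_posteriorLoss (D j) f j
  have m₁' : Measurable fun ω => φ₀ ω + ∑ i, φ₁ i ω := m₀.add <| Finset.measurable_sum _ fun i _ => m₁ i
  calc (1 : ℝ≥0∞) = ∫⁻ _, 1 ∂B.jointLaw := by simp
    _ ≤ ∫⁻ ω, B.survival D f g ω + ((φ₀ ω + ∑ i, φ₁ i ω) + ∑ j, φ₂ j ω) ∂B.jointLaw :=
        lintegral_mono (B.one_le_survival_add D f g)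
    _ = ∫⁻ ω, B.survival D f g ω ∂B.jointLaw + ((∫⁻ ω, φ₀ ω ∂B.jointLaw +
          ∑ i, ∫⁻ ω, φ₁ i ω ∂B.jointLaw) + ∑ j, ∫⁻ ω, φ₂ j ω ∂B.jointLaw) := by
        rw [lintegral_add_left (B.measurable_survival D f g),
          lintegral_add_left m₁', lintegral_add_left m₀,
          lintegral_finsetSum _ fun i _ => m₁ i, lintegral_finsetSum _ fun j _ => m₂ j]
    _ = _ := by
        simp only [e₀, e₁, e₂]
        rfl

lemma lintegral_le_one {𝒴 : Type*} [MeasurableSpace 𝒴] {μ : Measure 𝒴} (hμ : μ Set.univ ≤ 1)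
    {F : 𝒴 → ℝ≥0∞} (hF : ∀ y, F y ≤ 1) : ∫⁻ y, F y ∂μ ≤ 1 :=
  (lintegral_mono hF).trans (by simpa using hμ)

lemma successProbGiven_le_one (B : BlockModel S₀ SI Z X Y) (D : J → Finset S)
    (f : ∀ s, Z s → C s) (g : ∀ s, Z s → M s) (c : ∀ s, C s) (m : ∀ s, M s) :
    B.successProbGiven D f g c m ≤ 1 := by
  refine lintegral_le_one prob_le_one fun z₀ => lintegral_le_one ?_ fun zI =>
    lintegral_le_one prob_le_one fun x => lintegral_le_one prob_le_one fun y => ?_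
  · rw [Measure.pi_univ]
    exact Finset.prod_le_one' fun i _ => prob_le_one
  · exact Finset.prod_le_one' fun j _ => prob_le_one

lemma sum_prod_inv_card (V : S → Type*) [∀ s, Fintype (V s)] [∀ s, Nonempty (V s)] :
    ∑ _v : ∀ s, V s, ∏ s, (Fintype.card (V s) : ℝ≥0∞)⁻¹ = 1 := by
  rw [Finset.sum_const, Finset.card_univ, Fintype.card_pi, nsmul_eq_mul, Nat.cast_prod,
    ← Finset.prod_mul_distrib]
  refine Finset.prod_eq_one fun s _ => ENNReal.mul_inv_cancel ?_ (by simp)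
  simp

/-- Some shift `c` achieves an error probability not above the expected total loss. -/
lemma exists_errorProb_le (hcover : ∀ s, s ∈ S₀ ∨ ∃ i, s ∈ SI i)
    (hdisj₀ : ∀ i, Disjoint S₀ (SI i)) (hdisj : ∀ i i', i ≠ i' → Disjoint (SI i) (SI i'))
    (B : BlockModel S₀ SI Z X Y) (D : J → Finset S) (f : ∀ s, Z s → C s) (g : ∀ s, Z s → M s)
    {η : ℝ} (hη : 0 ≤ η) (h : B.totalLoss D f g ≤ ENNReal.ofReal η) :
    ∃ c, B.errorProb D f g c ≤ η := by
  classical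
  set σ : (∀ s, C s) → ℝ≥0∞ := fun c => ∑ m : ∀ s, M s,
    (∏ s, (Fintype.card (M s) : ℝ≥0∞)⁻¹) * B.successProbGiven D f g c m with hσ
  -- The best `c` does at least as well as the uniform average over `c`.
  obtain ⟨c, hc⟩ := Finite.exists_max σ
  refine ⟨c, ?_⟩
  have hfin : σ c ≤ 1 := by
    refine le_trans (Finset.sum_le_sum fun m _ => mul_le_of_le_one_right' ?_) (sum_prod_inv_card M).le
    exact B.successProbGiven_le_one D f g c m
  have h1 : 1 ≤ σ c + ENNReal.ofReal η := by
    refine (one_le_lintegral_survival_add hcover hdisj₀ hdisj B D f g).trans (add_le_add ?_ h)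
    refine (lintegral_survival_le hcover hdisj₀ hdisj B D f g).trans ?_
    refine (Finset.sum_le_sum fun c' _ => mul_le_mul_right (hc c') _).trans ?_
    rw [← Finset.sum_mul, sum_prod_inv_card C, one_mul]
  have h2 := ENNReal.toReal_mono (by finiteness [ne_top_of_le_ne_top ENNReal.one_ne_top hfin]) h1
  rw [ENNReal.toReal_add (ne_top_of_le_ne_top ENNReal.one_ne_top hfin) ENNReal.ofReal_ne_top,
    ENNReal.toReal_one, ENNReal.toReal_ofReal hη] at h2
  change 1 - (σ c).toReal ≤ η
  linarith

end BlockModel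

/-! ### Expected losses of independent random functions -/

namespace BlockModel

section RandomCode

variable {S : Type*} [Fintype S] [DecidableEq S]
  {Z : S → Type*} [∀ s, Fintype (Z s)] [∀ s, Nonempty (Z s)]
  [∀ s, MeasurableSpace (Z s)] [∀ s, MeasurableSingletonClass (Z s)]
  {C M : S → Type*} [∀ s, Fintype (C s)] [∀ s, Nonempty (C s)]
  [∀ s, Fintype (M s)] [∀ s, Nonempty (M s)]

/-- The probability of the functions `ω` when they are drawn independently from the ensembles. -/
def codeProb (F : ∀ s, FunctionEnsemble (Z s) (C s)) (G : ∀ s, FunctionEnsemble (Z s) (M s))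
    (ω : ∀ s, (Z s → C s) × (Z s → M s)) : ℝ :=
  ∏ s, ((F s).prob (ω s).1).toReal * ((G s).prob (ω s).2).toReal

variable {F : ∀ s, FunctionEnsemble (Z s) (C s)} {G : ∀ s, FunctionEnsemble (Z s) (M s)}

lemma codeProb_nonneg (ω : ∀ s, (Z s → C s) × (Z s → M s)) : 0 ≤ codeProb F G ω :=
  Finset.prod_nonneg fun _ _ => mul_nonneg ENNReal.toReal_nonneg ENNReal.toReal_nonneg

open scoped Classical in
lemma sum_pairProb (F : ∀ s, FunctionEnsemble (Z s) (C s))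
    (G : ∀ s, FunctionEnsemble (Z s) (M s)) (s : S) :
    ∑ ω : (Z s → C s) × (Z s → M s), ((F s).prob ω.1).toReal * ((G s).prob ω.2).toReal = 1 := by
  rw [Fintype.sum_prod_type]
  simp_rw [← Finset.mul_sum, (G s).sum_prob_toReal, mul_one, (F s).sum_prob_toReal]

open scoped Classical in
lemma sum_codeProb : ∑ ω, codeProb F G ω = 1 := by
  have h := Finset.prod_univ_sum (fun s => (Finset.univ : Finset ((Z s → C s) × (Z s → M s))))
    (fun s ω => ((F s).prob ω.1).toReal * ((G s).prob ω.2).toReal)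
  rw [Fintype.piFinset_univ] at h
  exact h.symm.trans (Finset.prod_eq_one fun s _ => sum_pairProb F G s)

open scoped Classical in
lemma collision_encoderMap (T : Finset S) (z z' : (s : T) → Z s) :
    collision (codeProb F G) (fun ω => encoderMap (fun s => (ω s).1) (fun s => (ω s).2) T) z z' =
      ∏ s : T, (F s).collisionProb (z s) (z' s) * (G s).collisionProb (z s) (z' s) := by
  refine (collision_pi (fun s (ω : (Z s → C s) × (Z s → M s)) =>
    ((F s).prob ω.1).toReal * ((G s).prob ω.2).toReal) (sum_pairProb F G)
    (fun s ω z => (ω.1 z, ω.2 z)) T z z').trans ?_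
  refine Finset.prod_congr rfl fun s _ => ?_
  rw [← (F s).collision_eq_collisionProb, ← (G s).collision_eq_collisionProb]
  exact collision_prodMk (fun f => ((F s).prob f).toReal) (fun g => ((G s).prob g).toReal)
    (fun f => f) (fun g => g) _ _

open scoped Classical in
lemma collision_decoderMap (T : Finset S) (z z' : (s : T) → Z s) :
    collision (codeProb F G) (fun ω => decoderMap (fun s => (ω s).1) T) z z' =
      ∏ s : T, (F s).collisionProb (z s) (z' s) := by
  refine (collision_pi (fun s (ω : (Z s → C s) × (Z s → M s)) =>
    ((F s).prob ω.1).toReal * ((G s).prob ω.2).toReal) (sum_pairProb F G)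
    (fun s ω z => ω.1 z) T z z').trans ?_
  refine Finset.prod_congr rfl fun s _ => ?_
  rw [← (F s).collision_eq_collisionProb]
  exact collision_fst (fun f => ((F s).prob f).toReal) (G s).sum_prob_toReal (fun f => f) _ _

variable {α β α' β' : S → ℝ}

open scoped Classical in
-- The balance bound for the joint hash `(f_s, g_s)`. Its heavy mass is `1 + (β + β')`, since a
-- heavy product needs `f_s` or `g_s` to be heavy.
lemma expected_encoderLoss_encoderMap_le (hα : ∀ s, 1 ≤ α s) (hα' : ∀ s, 1 ≤ α' s)
    (hF : ∀ s, (F s).image = Set.univ) (hG : ∀ s, (G s).image = Set.univ)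
    (hashF : ∀ s, (F s).HasHashProperty (α s) (β s))
    (hashG : ∀ s, (G s).HasHashProperty (α' s) (β' s))
    (T : Finset S) (μ : Measure ((s : T) → Z s)) [IsProbabilityMeasure μ]
    (A : Set ((s : T) → Z s)) (K : Finset T → ℝ) (hK : ∀ W, 0 ≤ K W)
    (hA : ∀ W : Finset T, W.Nonempty → ∀ u : (s : T) → Z s,
      (∑ z, if ∀ s ∈ W, z s = u s then A.indicator (fun z => μ.real {z}) z else 0) ≤ K W)
    {t : ℝ} (ht : 0 < t) :
    ∑ ω, ENNReal.ofReal (codeProb F G ω) * ∫⁻ z, ENNReal.ofReal (encoderLoss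
        (fun u => μ.real {u}) (encoderMap (fun s => (ω s).1) (fun s => (ω s).2) T) z) ∂μ ≤
      μ Aᶜ + ENNReal.ofReal (t + encoderResidual
        (fun s : T => (Fintype.card (C s) : ℝ) * Fintype.card (M s))
        (fun s => α s * α' s) (fun s => β s + β' s) K / t) := by
  have hN : ∀ s : T, 0 < (Fintype.card (C s) : ℝ) * Fintype.card (M s) := fun s =>
    mul_pos (by exact_mod_cast Fintype.card_pos) (by exact_mod_cast Fintype.card_pos)
  have hαα : ∀ s : T, 1 ≤ α s * α' s := fun s => one_le_mul_of_one_le_of_one_le (hα s) (hα' s)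
  have hββ : ∀ s : T, 0 ≤ β s + β' s := fun s => add_nonneg (hashF s).nonneg (hashG s).nonneg
  refine expected_lintegral_encoderLoss_le μ codeProb_nonneg sum_codeProb _ A ht
    (encoderResidual_nonneg hN hαα hββ hK) fun z => ?_
  have h1 : (Fintype.card ((s : T) → C s × M s) : ℝ) =
      ∏ s : T, (Fintype.card (C s) : ℝ) * Fintype.card (M s) := by
    simp [Fintype.card_pi, Fintype.card_prod]
  simp only [h1, collision_encoderMap]
  exact sum_indicator_mul_prod_le_encoder hN hαα hK
    (q := fun (s : T) z' => (F s).collisionProb (z s) z' * (G s).collisionProb (z s) z')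
    (fun s z' => mul_nonneg ((F s).collisionProb_nonneg _ _) ((G s).collisionProb_nonneg _ _))
    (fun s => (hashF s).sum_heavy_mul_le (zero_le_one.trans (hα s)) (hashG s) (hF s) (hG s) (z s))
    (fun _ => measureReal_nonneg) (sum_real_singleton_univ μ) A hA

open scoped Classical in
lemma expected_decoderLoss_decoderMap_le (hα : ∀ s, 1 ≤ α s)
    (hF : ∀ s, (F s).image = Set.univ) (hashF : ∀ s, (F s).HasHashProperty (α s) (β s))
    (T : Finset S) (μ : Measure ((s : T) → Z s)) [IsProbabilityMeasure μ]
    (A : Set ((s : T) → Z s)) (K : Finset T → ℝ) (hK : ∀ W, 0 ≤ K W)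
    (hA : ∀ W : Finset T, W ≠ Finset.univ → ∀ u : (s : T) → Z s,
      (∑ z, if ∀ s ∈ W, z s = u s then A.indicator (1 : ((s : T) → Z s) → ℝ) z else 0) ≤ K W) :
    ∑ ω, ENNReal.ofReal (codeProb F G ω) * ∫⁻ z, ENNReal.ofReal (decoderLoss
        (fun u => μ.real {u}) (decoderMap (fun s => (ω s).1) T) z) ∂μ ≤
      2 * μ Aᶜ + ENNReal.ofReal (decoderResidual (fun s : T => (Fintype.card (C s) : ℝ))
        (fun s => α s) (fun s => β s) K) := by
  have hN : ∀ s : T, 0 < (Fintype.card (C s) : ℝ) := fun s => by exact_mod_cast Fintype.card_pos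
  refine expected_lintegral_decoderLoss_le μ codeProb_nonneg sum_codeProb _ A
    (decoderResidual_nonneg hN (fun s => hα s) (fun s => (hashF s).nonneg) hK) fun z _ => ?_
  simp only [collision_decoderMap]
  exact sum_indicator_mul_prod_le_decoder hN (fun s => hα s) hK
    (q := fun (s : T) z' => (F s).collisionProb (z s) z')
    (fun s z' => (F s).collisionProb_nonneg _ _) (fun s => (hashF s).sum_heavy_le (hF s) (z s))
    A hA

end RandomCode

/-! ### Mass and counting bounds on typical sets -/

section Typical

variable {S : Type*} [Fintype S] [DecidableEq S]
  {Z : S → Type*} [∀ s, Fintype (Z s)]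
  [∀ s, MeasurableSpace (Z s)] [∀ s, MeasurableSingletonClass (Z s)]

/-- The tuples all of whose subtuples have small probability. -/
def encoderTypicalSet (D : Finset S) (ν : ∀ T : Finset S, Measure ((s : T) → Z s))
    (κ : Finset S → ℝ) : Set ((s : D) → Z s) :=
  {z | ∀ T (hT : T ⊆ D), T.Nonempty → (ν T).real {Finset.restrict₂ hT z} ≤ κ T}

/-- The tuples all of whose subtuples have a large conditional probability given the rest. -/
def decoderTypicalSet (D : Finset S)
    (ν : ∀ T : Finset S, ((s : (D \ T : Finset S)) → Z s) → Measure ((s : T) → Z s))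
    (κ : Finset S → ℝ) : Set ((s : D) → Z s) :=
  {z | ∀ T (hT : T ⊆ D), T.Nonempty →
    κ T ≤ (ν T (Finset.restrict₂ Finset.sdiff_subset z)).real {Finset.restrict₂ hT z}}

lemma map_subtype_subset {D : Finset S} (W : Finset D) :
    W.map (Function.Embedding.subtype _) ⊆ D := by
  intro s hs
  obtain ⟨s', _, rfl⟩ := Finset.mem_map.1 hs
  exact s'.2

lemma restrict₂_map_subtype_eq_iff {D : Finset S} (W : Finset D) (z z' : (s : D) → Z s) :
    Finset.restrict₂ (map_subtype_subset W) z = Finset.restrict₂ (map_subtype_subset W) z' ↔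
      ∀ s ∈ W, z s = z' s := by
  constructor
  · intro h s hs
    exact congrFun h ⟨s.1, Finset.mem_map_of_mem (Function.Embedding.subtype _) hs⟩
  · rintro h
    funext ⟨s, hs⟩
    obtain ⟨s', hs', rfl⟩ := Finset.mem_map.1 hs
    exact h s' hs'

open scoped Classical in
-- If some typical point agrees with `u` on `W`, its typicality bounds the marginal mass of that
-- value by `κ`; otherwise the sum vanishes.
lemma sum_encoderTypicalSet_le (D : Finset S) (μ : Measure ((s : D) → Z s)) [IsFiniteMeasure μ]
    (ν : ∀ T : Finset S, Measure ((s : T) → Z s)) (κ : Finset S → ℝ) (hκ : ∀ T, 0 ≤ κ T)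
    (hν : ∀ T (hT : T ⊆ D) z, μ.real {z' | Finset.restrict₂ hT z' = Finset.restrict₂ hT z} ≤
      (ν T).real {Finset.restrict₂ hT z})
    (W : Finset D) (hW : W.Nonempty) (u : (s : D) → Z s) :
    (∑ z, if ∀ s ∈ W, z s = u s then
      (encoderTypicalSet D ν κ).indicator (fun z => μ.real {z}) z else 0) ≤
      κ (W.map (Function.Embedding.subtype _)) := by
  by_cases h : ∃ z ∈ encoderTypicalSet D ν κ, ∀ s ∈ W, z s = u s
  · obtain ⟨z₀, hz₀, hu⟩ := h
    refine le_trans ?_ ((hν _ (map_subtype_subset W) z₀).trans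
      (hz₀ _ (map_subtype_subset W) (hW.map)))
    rw [← sum_ite_real_singleton]
    refine Finset.sum_le_sum fun z _ => ?_
    have : z ∈ {z' | Finset.restrict₂ (map_subtype_subset W) z' =
        Finset.restrict₂ (map_subtype_subset W) z₀} ↔ ∀ s ∈ W, z s = u s := by
      rw [Set.mem_ofPred_eq, restrict₂_map_subtype_eq_iff]
      exact forall₂_congr fun s hs => by rw [hu s hs]
    simp only [this]
    split_ifs
    · exact Set.indicator_le_self' (fun _ _ => measureReal_nonneg) z
    · rfl
  · push Not at h
    refine le_trans (le_of_eq (Finset.sum_eq_zero fun z _ => ?_)) (hκ _)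
    split_ifs with hz
    · refine Set.indicator_of_notMem (fun hzA => ?_) _
      obtain ⟨s, hs, hne⟩ := h z hzA
      exact hne (hz s hs)
    · rfl

open scoped Classical in
-- A counting argument. With the coordinates in `W` fixed, distinct points differ on the complement,
-- and each typical one has conditional probability at least `κ` there, so there are at most `1/κ`
-- of them. The family `ν` is arbitrary: no compatibility with a law of `z` enters.
lemma sum_decoderTypicalSet_le (D : Finset S)
    (ν : ∀ T : Finset S, ((s : (D \ T : Finset S)) → Z s) → Measure ((s : T) → Z s))
    [∀ T v, IsProbabilityMeasure (ν T v)]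
    (κ : Finset S → ℝ) (hκ : ∀ T, 0 < κ T)
    (W : Finset D) (hW : W ≠ Finset.univ) (u : (s : D) → Z s) :
    (∑ z, if ∀ s ∈ W, z s = u s then
      (decoderTypicalSet D ν κ).indicator (1 : ((s : D) → Z s) → ℝ) z else 0) ≤
      (κ (Wᶜ.map (Function.Embedding.subtype _)))⁻¹ := by
  set T := Wᶜ.map (Function.Embedding.subtype _) with hT
  have hTD : T ⊆ D := map_subtype_subset _
  have hTne : T.Nonempty := by
    refine Finset.Nonempty.map (Finset.nonempty_iff_ne_empty.2 fun h => hW ?_)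
    rwa [Finset.compl_eq_empty_iff] at h
  set v := Finset.restrict₂ (Finset.sdiff_subset (s := D) (t := T)) u with hv
  have hagree : ∀ z : (s : D) → Z s, (∀ s ∈ W, z s = u s) →
      Finset.restrict₂ (Finset.sdiff_subset (s := D) (t := T)) z = v := by
    intro z hz
    funext ⟨s, hs⟩
    rw [Finset.mem_sdiff] at hs
    refine hz ⟨s, hs.1⟩ ?_
    by_contra hsW
    exact hs.2 (Finset.mem_map_of_mem (Function.Embedding.subtype _) (Finset.mem_compl.2 hsW))
  rw [← Finset.sum_filter]
  calc ∑ z with ∀ s ∈ W, z s = u s,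
        (decoderTypicalSet D ν κ).indicator (1 : ((s : D) → Z s) → ℝ) z
      ≤ ∑ z with ∀ s ∈ W, z s = u s, (κ T)⁻¹ * (ν T v).real {Finset.restrict₂ hTD z} := by
        refine Finset.sum_le_sum fun z hz => ?_
        by_cases hzA : z ∈ decoderTypicalSet D ν κ
        · rw [Set.indicator_of_mem hzA, Pi.one_apply, ← hagree z (Finset.mem_filter.1 hz).2,
            ← div_eq_inv_mul, one_le_div₀ (hκ T)]
          exact hzA T hTD hTne
        · rw [Set.indicator_of_notMem hzA]
          exact mul_nonneg (inv_nonneg.2 (hκ T).le) measureReal_nonneg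
    _ = (κ T)⁻¹ * ∑ w ∈ (Finset.univ.filter fun z : (s : D) → Z s => ∀ s ∈ W, z s = u s).image
          (Finset.restrict₂ hTD), (ν T v).real {w} := by
        rw [Finset.sum_image, Finset.mul_sum]
        intro z hz z' hz' h
        simp only [Finset.coe_filter, Finset.mem_univ, true_and, Set.mem_ofPred_eq] at hz hz'
        funext s
        by_cases hs : s ∈ W
        · rw [hz s hs, hz' s hs]
        · exact (restrict₂_map_subtype_eq_iff Wᶜ z z').1 h s (Finset.mem_compl.2 hs)
    _ ≤ (κ T)⁻¹ * ∑ w, (ν T v).real {w} := by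
        refine mul_le_mul_of_nonneg_left ?_ (inv_nonneg.2 (hκ T).le)
        exact Finset.sum_le_sum_of_subset_of_nonneg (Finset.subset_univ _)
          fun _ _ _ => measureReal_nonneg
    _ = (κ T)⁻¹ := by rw [sum_real_singleton_univ, mul_one]

end Typical
end BlockModel

/-! ### Probability thresholds and entropy densities -/

section EntropyDensity

lemma density_lt_of_lt {n θ p : ℝ} (hn : 0 < n) (h : (2 : ℝ) ^ (-(n * θ)) < p) :
    1 / n * Real.logb 2 (1 / p) < θ := by
  have hp : 0 < p := lt_trans (by positivity) h
  have h1 := Real.logb_lt_logb one_lt_two (by positivity) h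
  rw [Real.logb_rpow two_pos (by norm_num)] at h1
  rw [one_div p, Real.logb_inv, one_div, inv_mul_lt_iff₀ hn]
  linarith

/-- Positivity of `p` is essential: at `p = 0` the conventions `1 / 0 = 0` and `logb 2 0 = 0` make
the density 0 instead of infinite. -/
lemma lt_density_of_lt {n θ p : ℝ} (hn : 0 < n) (hp : 0 < p) (h : p < (2 : ℝ) ^ (-(n * θ))) :
    θ < 1 / n * Real.logb 2 (1 / p) := by
  have h1 := Real.logb_lt_logb one_lt_two hp h
  rw [Real.logb_rpow two_pos (by norm_num)] at h1
  rw [one_div p, Real.logb_inv, one_div, lt_inv_mul_iff₀ hn]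
  linarith

variable {Ω 𝒰 𝒱 : Type*} [MeasurableSpace Ω] [MeasurableSpace 𝒰] [MeasurableSpace 𝒱]
  [Finite 𝒰] [MeasurableSingletonClass 𝒰] [StandardBorelSpace 𝒰] [Nonempty 𝒰]

/-- Almost surely, the conditional probability of the value taken is positive. -/
lemma measure_condDistrib_eq_zero (P : Measure Ω) [IsFiniteMeasure P] {U : Ω → 𝒰} {V : Ω → 𝒱}
    (hU : Measurable U) (hV : Measurable V) :
    P {ω | condDistrib U V P (V ω) {U ω} = 0} = 0 := by
  have hm : MeasurableSet {x : 𝒱 × 𝒰 | condDistrib U V P x.1 {x.2} = 0} :=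
    (measurable_from_prod_countable_left (f := fun x : 𝒱 × 𝒰 => condDistrib U V P x.1 {x.2})
      fun u => Kernel.measurable_coe _ (measurableSet_singleton u)) (measurableSet_singleton 0)
  have h1 : P {ω | condDistrib U V P (V ω) {U ω} = 0} =
      (P.map fun ω => (V ω, U ω)) {x : 𝒱 × 𝒰 | condDistrib U V P x.1 {x.2} = 0} := by
    rw [Measure.map_apply (hV.prodMk hU) hm]
    rfl
  rw [h1, ← compProd_map_condDistrib hU.aemeasurable, Measure.compProd_apply hm]
  refine lintegral_eq_zero_of_ae_eq_zero (ae_of_all _ fun v => ?_)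
  exact (measure_null_iff_singleton (Set.to_countable _)).2 fun u hu => hu

/-- The inclusion of events can fail only where the conditional probability of the value taken is 0,
and that set is null. -/
lemma measure_condDistrib_lt_le (P : Measure Ω) [IsFiniteMeasure P] {U : Ω → 𝒰} {V : Ω → 𝒱}
    (hU : Measurable U) (hV : Measurable V) {n θ : ℝ} (hn : 0 < n) :
    P {ω | (condDistrib U V P (V ω)).real {U ω} < (2 : ℝ) ^ (-(n * θ))} ≤
      P {ω | θ < 1 / n * Real.logb 2 (1 / (condDistrib U V P (V ω)).real {U ω})} := by
  refine (measure_mono (fun ω hω => ?_)).trans ((measure_union_le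
    {ω | θ < 1 / n * Real.logb 2 (1 / (condDistrib U V P (V ω)).real {U ω})}
    {ω | condDistrib U V P (V ω) {U ω} = 0}).trans
    (by rw [measure_condDistrib_eq_zero P hU hV, add_zero]))
  by_cases h0 : condDistrib U V P (V ω) {U ω} = 0
  · exact Or.inr h0
  · exact Or.inl (lt_density_of_lt hn (ENNReal.toReal_pos h0 (measure_ne_top _ _)) hω)

end EntropyDensity

/-! ### Typical sets of the block model and their probabilities -/

namespace BlockModel

variable {I J S : Type*} [Fintype I] [Fintype S] [DecidableEq S]
  {S₀ : Finset S} {SI : I → Finset S}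
  {Z : S → Type*} {X : I → Type*} {Y : J → Type*}
  [∀ s, Fintype (Z s)]
  [∀ s, MeasurableSpace (Z s)] [∀ i, MeasurableSpace (X i)] [∀ j, MeasurableSpace (Y j)]
  [∀ s, MeasurableSingletonClass (Z s)]

/-- The non-empty subsets of `D`. -/
def nonemptySubsets (D : Finset S) : Finset (Finset S) := D.powerset.erase ∅

lemma mem_nonemptySubsets {D T : Finset S} : T ∈ nonemptySubsets D ↔ T.Nonempty ∧ T ⊆ D := by
  rw [nonemptySubsets, Finset.mem_erase, Finset.mem_powerset, Finset.nonempty_iff_ne_empty]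

lemma commonSource_apply (hcover : ∀ s, s ∈ S₀ ∨ ∃ i, s ∈ SI i)
    (hdisj₀ : ∀ i, Disjoint S₀ (SI i)) (hdisj : ∀ i i', i ≠ i' → Disjoint (SI i) (SI i'))
    (B : BlockModel S₀ SI Z X Y) (A : Set ((s : S₀) → Z s)) :
    B.commonSource A = B.jointLaw {ω | S₀.restrict ω.1 ∈ A} := by
  have h := lintegral_common_jointLaw hcover hdisj₀ hdisj B (A.indicator 1)
  rw [lintegral_indicator_one (Set.toFinite A).measurableSet] at h
  have hm : MeasurableSet {ω : (∀ s, Z s) × (∀ j, Y j) | S₀.restrict ω.1 ∈ A} :=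
    measurable_comp_fst S₀.restrict (Set.toFinite A).measurableSet
  rw [← h, ← lintegral_indicator_one hm]
  rfl

lemma lintegral_privateSource_apply (hcover : ∀ s, s ∈ S₀ ∨ ∃ i, s ∈ SI i)
    (hdisj₀ : ∀ i, Disjoint S₀ (SI i)) (hdisj : ∀ i i', i ≠ i' → Disjoint (SI i) (SI i'))
    (B : BlockModel S₀ SI Z X Y) (i : I) (A : ((s : S₀) → Z s) → Set ((s : SI i) → Z s)) :
    ∫⁻ z₀, B.privateSource i z₀ (A z₀) ∂B.commonSource =
      B.jointLaw {ω | (SI i).restrict ω.1 ∈ A (S₀.restrict ω.1)} := by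
  have h := lintegral_private_jointLaw hcover hdisj₀ hdisj B i (fun z₀ => (A z₀).indicator 1)
  simp only [lintegral_indicator_one (Set.toFinite _).measurableSet] at h
  have hm : MeasurableSet {ω : (∀ s, Z s) × (∀ j, Y j) |
      (SI i).restrict ω.1 ∈ A (S₀.restrict ω.1)} :=
    measurable_fst (Set.toFinite {z | (SI i).restrict z ∈ A (S₀.restrict z)}).measurableSet
  rw [← h, ← lintegral_indicator_one hm]
  rfl

variable [∀ s, Nonempty (Z s)]

/-- At an atom of `Z_{S₀}` the conditional distribution is a ratio of point masses, hence determined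
by the joint law. At null `z₀` the two sides may differ. -/
lemma privateSource_eq_condDistrib (hcover : ∀ s, s ∈ S₀ ∨ ∃ i, s ∈ SI i)
    (hdisj₀ : ∀ i, Disjoint S₀ (SI i)) (hdisj : ∀ i i', i ≠ i' → Disjoint (SI i) (SI i'))
    (B : BlockModel S₀ SI Z X Y) (i : I) {T : Finset S} (hT : T ⊆ SI i) {z₀ : (s : S₀) → Z s}
    (hz₀ : B.commonSource {z₀} ≠ 0) (u : (s : T) → Z s) :
    B.privateSource i z₀ {z | Finset.restrict₂ hT z = u} =
      condDistrib (fun ω : (∀ s, Z s) × (∀ j, Y j) => T.restrict ω.1) (fun ω => S₀.restrict ω.1)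
        B.jointLaw z₀ {u} := by
  have mT : Measurable fun ω : (∀ s, Z s) × (∀ j, Y j) => T.restrict ω.1 :=
    measurable_comp_fst T.restrict
  have m₀ : Measurable fun ω : (∀ s, Z s) × (∀ j, Y j) => S₀.restrict ω.1 :=
    measurable_comp_fst S₀.restrict
  have h1 : (B.jointLaw.map fun ω => S₀.restrict ω.1) {z₀} = B.commonSource {z₀} := by
    rw [Measure.map_apply m₀ (measurableSet_singleton _),
      commonSource_apply hcover hdisj₀ hdisj B]
    rfl
  have h2 : (B.jointLaw.map fun ω => (S₀.restrict ω.1, T.restrict ω.1)) ({z₀} ×ˢ {u}) =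
      B.commonSource {z₀} * B.privateSource i z₀ {z | Finset.restrict₂ hT z = u} := by
    rw [Measure.map_apply (m₀.prodMk mT) (Set.toFinite _).measurableSet]
    have h3 := lintegral_privateSource_apply hcover hdisj₀ hdisj B i
      (fun z₀' => {z | z₀' = z₀ ∧ Finset.restrict₂ hT z = u})
    refine h3.symm.trans ?_
    rw [lintegral_fintype, Finset.sum_eq_single z₀]
    · simp [mul_comm]
    · intro z₀' _ hne
      simp [hne]
    · simp
  rw [condDistrib_apply_of_ne_zero mT z₀ (by rw [h1]; exact hz₀), h1, h2, ← mul_assoc,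
    ENNReal.inv_mul_cancel hz₀ (measure_ne_top _ _), one_mul]

/-- The threshold `2^{-nθ}`. -/
def threshold (n : ℝ) (θ : Finset S → ℝ) (T : Finset S) : ℝ := 2 ^ (-(n * θ T))

/-- The typical set of the common generator. -/
def commonTypical (B : BlockModel S₀ SI Z X Y) (κ : Finset S → ℝ) : Set ((s : S₀) → Z s) :=
  encoderTypicalSet S₀ (fun T => B.jointLaw.map fun ω => T.restrict ω.1) κ

/-- The typical set of the generator of Encoder `i`. -/
def privateTypical (B : BlockModel S₀ SI Z X Y) (i : I) (κ : Finset S → ℝ)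
    (z₀ : (s : S₀) → Z s) : Set ((s : SI i) → Z s) :=
  encoderTypicalSet (SI i) (fun T => condDistrib (fun ω : (∀ s, Z s) × (∀ j, Y j) =>
    T.restrict ω.1) (fun ω => S₀.restrict ω.1) B.jointLaw z₀) κ

/-- The typical set of Decoder `j`. -/
def posteriorTypical (B : BlockModel S₀ SI Z X Y) (D : Finset S) (j : J) (κ : Finset S → ℝ)
    (y : Y j) : Set ((s : D) → Z s) :=
  decoderTypicalSet D (fun T v => condDistrib (fun ω : (∀ s, Z s) × (∀ j, Y j) =>
    T.restrict ω.1) (fun ω => (ω.2 j, (D \ T).restrict ω.1)) B.jointLaw (y, v)) κ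

lemma commonSource_compl_commonTypical_le (hcover : ∀ s, s ∈ S₀ ∨ ∃ i, s ∈ SI i)
    (hdisj₀ : ∀ i, Disjoint S₀ (SI i)) (hdisj : ∀ i i', i ≠ i' → Disjoint (SI i) (SI i'))
    (B : BlockModel S₀ SI Z X Y) {n : ℝ} (hn : 0 < n) (θ : Finset S → ℝ) :
    B.commonSource (B.commonTypical (threshold n θ))ᶜ ≤
      ∑ T ∈ nonemptySubsets S₀, B.jointLaw {ω | 1 / n * Real.logb 2
        (1 / (B.jointLaw.map fun ω => T.restrict ω.1).real {T.restrict ω.1}) < θ T} := by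
  rw [commonSource_apply hcover hdisj₀ hdisj B]
  refine (measure_mono fun ω hω => ?_).trans (measure_biUnion_finset_le _ _)
  simp only [commonTypical, encoderTypicalSet, Set.mem_ofPred_eq, Set.mem_compl_iff, not_forall,
    not_le] at hω
  obtain ⟨T, hT, hTne, h⟩ := hω
  exact Set.mem_biUnion (mem_nonemptySubsets.2 ⟨hTne, hT⟩) (density_lt_of_lt hn h)

lemma lintegral_compl_privateTypical_le (hcover : ∀ s, s ∈ S₀ ∨ ∃ i, s ∈ SI i)
    (hdisj₀ : ∀ i, Disjoint S₀ (SI i)) (hdisj : ∀ i i', i ≠ i' → Disjoint (SI i) (SI i'))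
    (B : BlockModel S₀ SI Z X Y) (i : I) {n : ℝ} (hn : 0 < n) (θ : Finset S → ℝ) :
    ∫⁻ z₀, B.privateSource i z₀ (B.privateTypical i (threshold n θ) z₀)ᶜ ∂B.commonSource ≤
      ∑ T ∈ nonemptySubsets (SI i), B.jointLaw {ω | 1 / n * Real.logb 2
        (1 / (condDistrib (fun ω : (∀ s, Z s) × (∀ j, Y j) => T.restrict ω.1)
          (fun ω => S₀.restrict ω.1) B.jointLaw (S₀.restrict ω.1)).real
            {T.restrict ω.1}) < θ T} := by
  rw [lintegral_privateSource_apply hcover hdisj₀ hdisj B]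
  refine (measure_mono fun ω hω => ?_).trans (measure_biUnion_finset_le _ _)
  simp only [privateTypical, encoderTypicalSet, Set.mem_ofPred_eq, Set.mem_compl_iff, not_forall,
    not_le] at hω
  obtain ⟨T, hT, hTne, h⟩ := hω
  exact Set.mem_biUnion (mem_nonemptySubsets.2 ⟨hTne, hT⟩) (density_lt_of_lt hn h)

lemma measurableSet_posteriorTypical (B : BlockModel S₀ SI Z X Y) (D : Finset S) (j : J)
    (κ : Finset S → ℝ) (z : (s : D) → Z s) :
    MeasurableSet {y | z ∈ B.posteriorTypical D j κ y} := by
  have h0 : {y | z ∈ B.posteriorTypical D j κ y} = ⋂ (T : Finset S) (hT : T ⊆ D)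
      (_ : T.Nonempty), {y | κ T ≤ (condDistrib (fun ω : (∀ s, Z s) × (∀ j, Y j) =>
      T.restrict ω.1) (fun ω => (ω.2 j, (D \ T).restrict ω.1)) B.jointLaw
      (y, Finset.restrict₂ Finset.sdiff_subset z)).real {Finset.restrict₂ hT z}} := by
    ext y
    simp only [Set.mem_iInter]
    rfl
  rw [h0]
  refine MeasurableSet.iInter fun T => MeasurableSet.iInter fun hT => MeasurableSet.iInter fun _ => ?_
  have h1 : Measurable fun y : Y j => (condDistrib (fun ω : (∀ s, Z s) × (∀ j, Y j) =>
      T.restrict ω.1) (fun ω => (ω.2 j, (D \ T).restrict ω.1)) B.jointLaw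
      (y, Finset.restrict₂ Finset.sdiff_subset z)).real {Finset.restrict₂ hT z} :=
    ((Kernel.measurable_coe _ (measurableSet_singleton _)).comp
      (measurable_id.prodMk measurable_const)).ennreal_toReal
  exact measurableSet_le measurable_const h1

lemma lintegral_compl_posteriorTypical_le (B : BlockModel S₀ SI Z X Y) (D : Finset S) (j : J)
    {n : ℝ} (hn : 0 < n) (θ : Finset S → ℝ) :
    ∫⁻ y, B.posterior D j y (B.posteriorTypical D j (threshold n θ) y)ᶜ
        ∂(B.jointLaw.map fun ω => ω.2 j) ≤
      ∑ T ∈ nonemptySubsets D, B.jointLaw {ω | θ T < 1 / n * Real.logb 2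
        (1 / (condDistrib (fun ω : (∀ s, Z s) × (∀ j, Y j) => T.restrict ω.1)
          (fun ω => (ω.2 j, (D \ T).restrict ω.1)) B.jointLaw
          (ω.2 j, (D \ T).restrict ω.1)).real {T.restrict ω.1})} := by
  classical
  set A := fun y => (B.posteriorTypical D j (threshold n θ) y)ᶜ with hA
  have hm : ∀ z, MeasurableSet {y | z ∈ A y} := fun z =>
    (B.measurableSet_posteriorTypical D j _ z).compl
  have h1 := B.lintegral_decoder_jointLaw D j (F := fun y => (A y).indicator 1)
    (fun z => (measurable_const (a := (1 : ℝ≥0∞))).indicator (hm z))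
  simp only [lintegral_indicator_one (Set.toFinite _).measurableSet] at h1
  have h2 : MeasurableSet {ω : (∀ s, Z s) × (∀ j, Y j) | D.restrict ω.1 ∈ A (ω.2 j)} := by
    have h3 : MeasurableSet {x : Y j × ((s : D) → Z s) | x.2 ∈ A x.1} := by
      have : {x : Y j × ((s : D) → Z s) | x.2 ∈ A x.1} =
          ⋃ z, {y | z ∈ A y} ×ˢ {z} := by
        ext ⟨y, z⟩
        simp
      rw [this]
      exact MeasurableSet.iUnion fun z => (hm z).prod (measurableSet_singleton z)
    exact (((measurable_pi_apply j).comp measurable_snd).prodMk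
      (measurable_comp_fst D.restrict)) h3
  have h4 : B.jointLaw {ω | D.restrict ω.1 ∈ A (ω.2 j)} =
      ∫⁻ y, B.posterior D j y (A y) ∂(B.jointLaw.map fun ω => ω.2 j) := by
    rw [← h1, ← lintegral_indicator_one h2]
    rfl
  rw [← h4]
  refine (measure_mono fun ω hω => ?_).trans ((measure_biUnion_finset_le (nonemptySubsets D)
    fun T => {ω | (condDistrib (fun ω : (∀ s, Z s) × (∀ j, Y j) => T.restrict ω.1)
          (fun ω => (ω.2 j, (D \ T).restrict ω.1)) B.jointLaw
          (ω.2 j, (D \ T).restrict ω.1)).real {T.restrict ω.1} < threshold n θ T}).trans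
    (Finset.sum_le_sum fun T _ => measure_condDistrib_lt_le B.jointLaw
      (measurable_comp_fst T.restrict) (((measurable_pi_apply j).comp measurable_snd).prodMk
      (measurable_comp_fst (D \ T).restrict)) hn))
  simp only [hA, posteriorTypical, decoderTypicalSet, Set.mem_ofPred_eq, Set.mem_compl_iff,
    not_forall, not_le] at hω
  obtain ⟨T, hT, hTne, h⟩ := hω
  exact Set.mem_biUnion (mem_nonemptySubsets.2 ⟨hTne, hT⟩) h

end BlockModel

/-! ### Vanishing of the residual errors -/

section Limits

lemma tendsto_two_rpow_mul {e : ℕ → ℝ} {c : ℝ} (hc : c < 0) (he : Tendsto e atTop (𝓝 c)) :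
    Tendsto (fun n : ℕ => (2 : ℝ) ^ ((n : ℝ) * e n)) atTop (𝓝 0) :=
  (tendsto_rpow_atBot_of_base_gt_one 2 one_lt_two).comp
    (tendsto_natCast_atTop_atTop.atTop_mul_neg hc he)

lemma two_rpow_mul_sum_logb {ι : Type*} (W : Finset ι) {N : ι → ℝ} (hN : ∀ s, 0 < N s) {n : ℕ}
    (hn : n ≠ 0) : (2 : ℝ) ^ ((n : ℝ) * ∑ s ∈ W, Real.logb 2 (N s) / n) = ∏ s ∈ W, N s := by
  have hn' : (n : ℝ) ≠ 0 := Nat.cast_ne_zero.2 hn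
  rw [Finset.mul_sum, Real.rpow_sum_of_pos two_pos]
  refine Finset.prod_congr rfl fun s _ => ?_
  rw [mul_div_cancel₀ _ hn', Real.rpow_logb two_pos (by norm_num) (hN s)]

variable {ι : Type*} [Fintype ι] [DecidableEq ι] {N α β : ℕ → ι → ℝ} {ρ : ι → ℝ}

/-- The term of a non-empty `W` is two to the power `n` times (normalised log-size of the labels on
`W`, minus `θ W`), up to factors tending to 1. The bracket has a negative limit. -/
lemma tendsto_encoderResidual (hN : ∀ n s, 0 < N n s)
    (hρ : ∀ s, Tendsto (fun n : ℕ => Real.logb 2 (N n s) / n) atTop (𝓝 (ρ s)))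
    (hα : ∀ s, Tendsto (fun n => α n s) atTop (𝓝 1))
    (hβ : ∀ s, Tendsto (fun n => β n s) atTop (𝓝 0)) {θ : Finset ι → ℝ}
    (hθ : ∀ W : Finset ι, W.Nonempty → ∑ s ∈ W, ρ s < θ W) :
    Tendsto (fun n : ℕ => encoderResidual (N n) (α n) (β n) fun W => 2 ^ (-((n : ℝ) * θ W)))
      atTop (𝓝 0) := by
  have hprod : ∀ W : Finset ι, Tendsto (fun n => ∏ s ∈ W, α n s) atTop (𝓝 1) := fun W => by
    simpa using tendsto_finsetProd W fun s _ => hα s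
  have hprod' : ∀ W : Finset ι, Tendsto (fun n => ∏ s ∈ W, (1 + β n s)) atTop (𝓝 1) := fun W => by
    simpa using tendsto_finsetProd W fun s _ => (hβ s).const_add 1
  have h0 : Tendsto (fun n => ∏ s, α n s - 1) atTop (𝓝 0) := by
    simpa using (hprod Finset.univ).sub_const 1
  have h1 : ∀ W ∈ Finset.univ.erase (∅ : Finset ι), Tendsto (fun n : ℕ =>
      (2 : ℝ) ^ (-((n : ℝ) * θ W)) * (∏ s ∈ W, N n s * (1 + β n s)) * ∏ s ∈ Wᶜ, α n s)
      atTop (𝓝 0) := by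
    intro W hW
    have hlt := hθ W (Finset.nonempty_iff_ne_empty.2 (Finset.ne_of_mem_erase hW))
    have h2 := tendsto_two_rpow_mul (sub_neg.2 hlt)
      ((tendsto_finsetSum W fun s _ => hρ s).sub_const (θ W))
    have h3 := (h2.mul (hprod' W)).mul (hprod Wᶜ)
    rw [zero_mul, zero_mul] at h3
    -- At `n = 0` the normalised logarithm is a division by zero and does not give back `N`.
    refine h3.congr' ((eventually_ne_atTop 0).mono fun n hn => ?_)
    dsimp only
    rw [Finset.prod_mul_distrib, mul_sub, sub_eq_neg_add, Real.rpow_add two_pos,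
      two_rpow_mul_sum_logb W (hN n) hn]
    ring
  simpa [encoderResidual] using h0.add (tendsto_finsetSum _ h1)

/-- The coordinates that count are those outside `W`: up to factors tending to 1, the term is
`2^(nθ)` divided by the number of labels on `Wᶜ`, with negative exponential rate. -/
lemma tendsto_decoderResidual (hN : ∀ n s, 0 < N n s)
    (hρ : ∀ s, Tendsto (fun n : ℕ => Real.logb 2 (N n s) / n) atTop (𝓝 (ρ s)))
    (hα : ∀ s, Tendsto (fun n => α n s) atTop (𝓝 1))
    (hβ : ∀ s, Tendsto (fun n => β n s) atTop (𝓝 0)) {θ : Finset ι → ℝ}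
    (hθ : ∀ W : Finset ι, W.Nonempty → θ W < ∑ s ∈ W, ρ s) :
    Tendsto (fun n : ℕ => decoderResidual (N n) (α n) (β n)
      fun W => ((2 : ℝ) ^ (-((n : ℝ) * θ Wᶜ)))⁻¹) atTop (𝓝 0) := by
  have hprod : ∀ W : Finset ι, Tendsto (fun n => ∏ s ∈ W, α n s) atTop (𝓝 1) := fun W => by
    simpa using tendsto_finsetProd W fun s _ => hα s
  have hprod' : ∀ W : Finset ι, Tendsto (fun n => ∏ s ∈ W, (1 + β n s)) atTop (𝓝 1) := fun W => by
    simpa using tendsto_finsetProd W fun s _ => (hβ s).const_add 1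
  have h0 : Tendsto (fun n => ∏ s, (1 + β n s) - 1) atTop (𝓝 0) := by
    simpa using (hprod' Finset.univ).sub_const 1
  have h1 : ∀ W ∈ Finset.univ.erase (Finset.univ : Finset ι), Tendsto (fun n : ℕ =>
      ((2 : ℝ) ^ (-((n : ℝ) * θ Wᶜ)))⁻¹ * (∏ s ∈ W, (1 + β n s)) * ∏ s ∈ Wᶜ, α n s / N n s)
      atTop (𝓝 0) := by
    intro W hW
    have hlt := hθ Wᶜ (Finset.nonempty_iff_ne_empty.2 fun h =>
      Finset.ne_of_mem_erase hW ((Finset.compl_eq_empty_iff W).1 h))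
    have h2 := tendsto_two_rpow_mul (sub_neg.2 hlt)
      ((tendsto_finsetSum Wᶜ fun s _ => hρ s).const_sub (θ Wᶜ))
    have h3 := (h2.mul (hprod' W)).mul (hprod Wᶜ)
    rw [zero_mul, zero_mul] at h3
    refine h3.congr' ((eventually_ne_atTop 0).mono fun n hn => ?_)
    dsimp only
    rw [Finset.prod_div_distrib, mul_sub, Real.rpow_sub two_pos,
      two_rpow_mul_sum_logb Wᶜ (hN n) hn, Real.rpow_neg zero_le_two, inv_inv]
    ring
  simpa [decoderResidual] using h0.add (tendsto_finsetSum _ h1)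

end Limits

/-! ### Expected total loss at one block length -/

namespace BlockModel

variable {I J S : Type*} [Fintype I] [Fintype J] [Fintype S] [DecidableEq S]
  {S₀ : Finset S} {SI : I → Finset S}
  {Z : S → Type*} {X : I → Type*} {Y : J → Type*}
  [∀ s, Fintype (Z s)]
  [∀ s, MeasurableSpace (Z s)] [∀ i, MeasurableSpace (X i)] [∀ j, MeasurableSpace (Y j)]
  [∀ s, MeasurableSingletonClass (Z s)]
  [∀ s, Nonempty (Z s)]
  {C M : S → Type*} [∀ s, Fintype (C s)] [∀ s, Nonempty (C s)]
  [∀ s, Fintype (M s)] [∀ s, Nonempty (M s)]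
  {F : ∀ s, FunctionEnsemble (Z s) (C s)} {G : ∀ s, FunctionEnsemble (Z s) (M s)}
  {α β α' β' : S → ℝ}

/-- The subset of `S` underlying a subset of `T`. -/
abbrev lift {T : Finset S} (W : Finset T) : Finset S := W.map (Function.Embedding.subtype _)

lemma threshold_pos (n : ℝ) (θ : Finset S → ℝ) (T : Finset S) : 0 < threshold n θ T :=
  Real.rpow_pos_of_pos two_pos _

/-- The contribution of an encoder to the expected loss, apart from atypical sources. -/
def encoderTerm (C M : S → Type*) [∀ s, Fintype (C s)] [∀ s, Fintype (M s)] (T : Finset S)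
    (α β α' β' : S → ℝ) (n : ℝ) (θ : Finset S → ℝ) (t : ℝ) : ℝ :=
  t + encoderResidual (fun s : T => (Fintype.card (C s) : ℝ) * Fintype.card (M s))
    (fun s => α s * α' s) (fun s => β s + β' s) (fun W => threshold n θ (lift W)) / t

/-- The contribution of a decoder to the expected loss, apart from atypical sources. -/
def decoderTerm (C : S → Type*) [∀ s, Fintype (C s)] (T : Finset S)
    (α β : S → ℝ) (n : ℝ) (θ : Finset S → ℝ) : ℝ :=
  decoderResidual (fun s : T => (Fintype.card (C s) : ℝ)) (fun s => α s) (fun s => β s)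
    (fun W => (threshold n θ (lift Wᶜ))⁻¹)

open scoped Classical in
lemma expected_commonLoss_le (hcover : ∀ s, s ∈ S₀ ∨ ∃ i, s ∈ SI i)
    (hdisj₀ : ∀ i, Disjoint S₀ (SI i)) (hdisj : ∀ i i', i ≠ i' → Disjoint (SI i) (SI i'))
    (B : BlockModel S₀ SI Z X Y) (hα : ∀ s, 1 ≤ α s) (hα' : ∀ s, 1 ≤ α' s)
    (hF : ∀ s, (F s).image = Set.univ) (hG : ∀ s, (G s).image = Set.univ)
    (hashF : ∀ s, (F s).HasHashProperty (α s) (β s))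
    (hashG : ∀ s, (G s).HasHashProperty (α' s) (β' s))
    (n : ℝ) (θ : Finset S → ℝ) {t : ℝ} (ht : 0 < t) :
    ∑ ω, ENNReal.ofReal (codeProb F G ω) * ∫⁻ z₀, ENNReal.ofReal
        (B.commonLoss (fun s => (ω s).1) (fun s => (ω s).2) z₀) ∂B.commonSource ≤
      B.commonSource (B.commonTypical (threshold n θ))ᶜ +
        ENNReal.ofReal (encoderTerm C M S₀ α β α' β' n θ t) := by
  refine expected_encoderLoss_encoderMap_le hα hα' hF hG hashF hashG S₀ B.commonSource
    (B.commonTypical (threshold n θ)) _ (fun W => (threshold_pos n θ _).le) ?_ ht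
  intro W hW u
  refine sum_encoderTypicalSet_le S₀ B.commonSource _ _ (fun T => (threshold_pos n θ T).le)
    (fun T hT z => le_of_eq ?_) W hW u
  rw [measureReal_def, measureReal_def, commonSource_apply hcover hdisj₀ hdisj B,
    Measure.map_apply (measurable_comp_fst T.restrict) (measurableSet_singleton _)]
  rfl

open scoped Classical in
lemma expected_privateLoss_le (hcover : ∀ s, s ∈ S₀ ∨ ∃ i, s ∈ SI i)
    (hdisj₀ : ∀ i, Disjoint S₀ (SI i)) (hdisj : ∀ i i', i ≠ i' → Disjoint (SI i) (SI i'))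
    (B : BlockModel S₀ SI Z X Y) (hα : ∀ s, 1 ≤ α s) (hα' : ∀ s, 1 ≤ α' s)
    (hF : ∀ s, (F s).image = Set.univ) (hG : ∀ s, (G s).image = Set.univ)
    (hashF : ∀ s, (F s).HasHashProperty (α s) (β s))
    (hashG : ∀ s, (G s).HasHashProperty (α' s) (β' s))
    (i : I) (n : ℝ) (θ : Finset S → ℝ) {t : ℝ} (ht : 0 < t) :
    ∑ ω, ENNReal.ofReal (codeProb F G ω) * ∫⁻ z₀, ∫⁻ zi, ENNReal.ofReal
        (B.privateLoss (fun s => (ω s).1) (fun s => (ω s).2) i z₀ zi)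
        ∂B.privateSource i z₀ ∂B.commonSource ≤
      ∫⁻ z₀, B.privateSource i z₀ (B.privateTypical i (threshold n θ) z₀)ᶜ ∂B.commonSource +
        ENNReal.ofReal (encoderTerm C M (SI i) α β α' β' n θ t) := by
  have h1 : ∑ ω, ENNReal.ofReal (codeProb F G ω) * ∫⁻ z₀, ∫⁻ zi, ENNReal.ofReal
        (B.privateLoss (fun s => (ω s).1) (fun s => (ω s).2) i z₀ zi)
        ∂B.privateSource i z₀ ∂B.commonSource =
      ∫⁻ z₀, ∑ ω, ENNReal.ofReal (codeProb F G ω) * ∫⁻ zi, ENNReal.ofReal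
        (B.privateLoss (fun s => (ω s).1) (fun s => (ω s).2) i z₀ zi)
        ∂B.privateSource i z₀ ∂B.commonSource := by
    rw [lintegral_finsetSum _ fun ω _ => measurable_of_countable _]
    refine Finset.sum_congr rfl fun ω _ => ?_
    rw [lintegral_const_mul _ (measurable_of_countable _)]
  have h2 : ∫⁻ z₀, B.privateSource i z₀ (B.privateTypical i (threshold n θ) z₀)ᶜ
        ∂B.commonSource + ENNReal.ofReal (encoderTerm C M (SI i) α β α' β' n θ t) =
      ∫⁻ z₀, B.privateSource i z₀ (B.privateTypical i (threshold n θ) z₀)ᶜ +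
        ENNReal.ofReal (encoderTerm C M (SI i) α β α' β' n θ t) ∂B.commonSource := by
    rw [lintegral_add_left (measurable_of_countable _), lintegral_const, measure_univ, mul_one]
  rw [h1, h2]
  -- Only `z₀` of positive mass matter. There the private source has the conditional law from which
  -- the typical set is built.
  refine lintegral_mono_ae (ae_iff_of_countable.2 fun z₀ hz₀ => ?_)
  refine expected_encoderLoss_encoderMap_le hα hα' hF hG hashF hashG (SI i)
    (B.privateSource i z₀) (B.privateTypical i (threshold n θ) z₀) _
    (fun W => (threshold_pos n θ _).le) ?_ ht
  intro W hW u
  refine sum_encoderTypicalSet_le (SI i) (B.privateSource i z₀) _ _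
    (fun T => (threshold_pos n θ T).le) (fun T hT z => le_of_eq ?_) W hW u
  rw [measureReal_def, measureReal_def,
    privateSource_eq_condDistrib hcover hdisj₀ hdisj B i hT hz₀]

open scoped Classical in
lemma expected_posteriorLoss_le (B : BlockModel S₀ SI Z X Y) (hα : ∀ s, 1 ≤ α s)
    (hF : ∀ s, (F s).image = Set.univ) (hashF : ∀ s, (F s).HasHashProperty (α s) (β s))
    (hprob : IsProbabilityMeasure B.jointLaw)
    (D : Finset S) (j : J) (n : ℝ) (θ : Finset S → ℝ) :
    ∑ ω, ENNReal.ofReal (codeProb F G ω) * ∫⁻ y, ∫⁻ z, ENNReal.ofReal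
        (B.posteriorLoss D (fun s => (ω s).1) j y z) ∂B.posterior D j y
        ∂(B.jointLaw.map fun ω => ω.2 j) ≤
      2 * ∫⁻ y, B.posterior D j y (B.posteriorTypical D j (threshold n θ) y)ᶜ
        ∂(B.jointLaw.map fun ω => ω.2 j) + ENNReal.ofReal (decoderTerm C D α β n θ) := by
  have hj : Measurable fun ω : (∀ s, Z s) × (∀ j, Y j) => ω.2 j :=
    (measurable_pi_apply j).comp measurable_snd
  have hP : IsProbabilityMeasure (B.jointLaw.map fun ω => ω.2 j) :=
    Measure.isProbabilityMeasure_map hj.aemeasurable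
  have hm : ∀ ω : ∀ s, (Z s → C s) × (Z s → M s), Measurable fun y => ∫⁻ z, ENNReal.ofReal
      (B.posteriorLoss D (fun s => (ω s).1) j y z) ∂B.posterior D j y := by
    intro ω
    simp only [lintegral_fintype]
    exact Finset.measurable_sum _ fun z _ => (ENNReal.measurable_ofReal.comp
      (measurable_decoderLoss (B.posterior D j) _ z)).mul
      (Kernel.measurable_coe _ (measurableSet_singleton z))
  refine le_trans (le_of_eq (b := ∫⁻ y, ∑ ω, ENNReal.ofReal (codeProb F G ω) *
      ∫⁻ z, ENNReal.ofReal (B.posteriorLoss D (fun s => (ω s).1) j y z) ∂B.posterior D j y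
        ∂(B.jointLaw.map fun ω => ω.2 j)) ?_)
    (le_trans (lintegral_mono (g := fun y => 2 * B.posterior D j y
      (B.posteriorTypical D j (threshold n θ) y)ᶜ + ENNReal.ofReal (decoderTerm C D α β n θ))
      fun y => ?_) (le_of_eq ?_))
  · rw [lintegral_finsetSum _ fun ω _ => (hm ω).const_mul _]
    refine Finset.sum_congr rfl fun ω _ => ?_
    rw [lintegral_const_mul _ (hm ω)]
  -- This holds for every `y`, not just almost every one: counting typical points needs no relation
  -- between the posterior and the conditional laws that define the typical set.
  · refine expected_decoderLoss_decoderMap_le hα hF hashF D (B.posterior D j y)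
      (B.posteriorTypical D j (threshold n θ) y) _
      (fun W => (inv_pos.2 (threshold_pos n θ _)).le) fun W hW u => ?_
    exact sum_decoderTypicalSet_le D _ _ (fun T => threshold_pos n θ T) W hW u
  · rw [lintegral_add_right _ measurable_const, lintegral_const, measure_univ, mul_one,
      lintegral_const_mul' _ _ (by simp)]

open scoped Classical in
lemma expected_totalLoss (B : BlockModel S₀ SI Z X Y) (D : J → Finset S) :
    ∑ ω, ENNReal.ofReal (codeProb F G ω) *
        B.totalLoss D (fun s => (ω s).1) (fun s => (ω s).2) =
      (∑ ω, ENNReal.ofReal (codeProb F G ω) * ∫⁻ z₀, ENNReal.ofReal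
        (B.commonLoss (fun s => (ω s).1) (fun s => (ω s).2) z₀) ∂B.commonSource) +
      (∑ i, ∑ ω, ENNReal.ofReal (codeProb F G ω) * ∫⁻ z₀, ∫⁻ zi, ENNReal.ofReal
        (B.privateLoss (fun s => (ω s).1) (fun s => (ω s).2) i z₀ zi)
        ∂B.privateSource i z₀ ∂B.commonSource) +
      ∑ j, ∑ ω, ENNReal.ofReal (codeProb F G ω) * ∫⁻ y, ∫⁻ z, ENNReal.ofReal
        (B.posteriorLoss (D j) (fun s => (ω s).1) j y z) ∂B.posterior (D j) j y
        ∂(B.jointLaw.map fun ω => ω.2 j) := by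
  simp only [totalLoss, mul_add, Finset.sum_add_distrib, Finset.mul_sum]
  congr 1
  · congr 1
    exact Finset.sum_comm
  · exact Finset.sum_comm

open scoped Classical in
/-- Some functions of the ensembles achieve the expected total loss. -/
lemma exists_code_of_expected_le (hcover : ∀ s, s ∈ S₀ ∨ ∃ i, s ∈ SI i)
    (hdisj₀ : ∀ i, Disjoint S₀ (SI i)) (hdisj : ∀ i i', i ≠ i' → Disjoint (SI i) (SI i'))
    (B : BlockModel S₀ SI Z X Y) (D : J → Finset S) {η : ℝ} (hη : 0 ≤ η)
    (h : ∑ ω, ENNReal.ofReal (codeProb F G ω) *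
        B.totalLoss D (fun s => (ω s).1) (fun s => (ω s).2) ≤ ENNReal.ofReal η) :
    ∃ (f : ∀ s, Z s → C s) (g : ∀ s, Z s → M s) (c : ∀ s, C s),
      (∀ s, f s ∈ (F s).prob.support) ∧ (∀ s, g s ∈ (G s).prob.support) ∧
      B.errorProb D f g c ≤ η := by
  -- Minimising over functions of non-zero weight only keeps the chosen code within the supports of
  -- the ensembles.
  set Q : Finset (∀ s, (Z s → C s) × (Z s → M s)) :=
    Finset.univ.filter fun ω => codeProb F G ω ≠ 0 with hQ
  have hQsum : ∑ ω ∈ Q, codeProb F G ω = 1 := by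
    rw [hQ, Finset.sum_filter_ne_zero, sum_codeProb]
  have hQne : Q.Nonempty := by
    by_contra hne
    rw [Finset.not_nonempty_iff_eq_empty] at hne
    simp [hne] at hQsum
  obtain ⟨ω, hω, hmin⟩ := Finset.exists_min_image Q
    (fun ω => B.totalLoss D (fun s => (ω s).1) (fun s => (ω s).2)) hQne
  have hle : B.totalLoss D (fun s => (ω s).1) (fun s => (ω s).2) ≤ ENNReal.ofReal η := by
    refine le_trans ?_ h
    calc _ = ∑ ω' ∈ Q, ENNReal.ofReal (codeProb F G ω') *
          B.totalLoss D (fun s => (ω s).1) (fun s => (ω s).2) := by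
          rw [← Finset.sum_mul, ← ENNReal.ofReal_sum_of_nonneg fun ω _ => codeProb_nonneg ω, hQsum,
            ENNReal.ofReal_one, one_mul]
      _ ≤ ∑ ω' ∈ Q, ENNReal.ofReal (codeProb F G ω') *
          B.totalLoss D (fun s => (ω' s).1) (fun s => (ω' s).2) :=
          Finset.sum_le_sum fun ω' hω' => mul_le_mul_right (hmin ω' hω') _
      _ ≤ _ := Finset.sum_le_sum_of_subset (Finset.subset_univ _)
  obtain ⟨c, hc⟩ := exists_errorProb_le hcover hdisj₀ hdisj B D _ _ hη hle
  have hpos := (Finset.mem_filter.1 hω).2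
  have hfac : ∀ s, ((F s).prob (ω s).1).toReal * ((G s).prob (ω s).2).toReal ≠ 0 := fun s =>
    Finset.prod_ne_zero_iff.1 hpos s (Finset.mem_univ s)
  refine ⟨_, _, c, fun s => ?_, fun s => ?_, hc⟩
  · exact (PMF.mem_support_iff _ _).2 fun h0 => hfac s (by simp [h0])
  · exact (PMF.mem_support_iff _ _).2 fun h0 => hfac s (by simp [h0])

end BlockModel

/-- Replacing `α` by `max α 1` keeps both the limit 1 and the hash property. The residual bounds
rely on `1 ≤ α`. -/
lemma HashProperty.exists_one_le {𝒵 𝒞 : ℕ → Type*} [∀ n, Fintype (𝒵 n)] [∀ n, Fintype (𝒞 n)]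
    {F : ∀ n, FunctionEnsemble (𝒵 n) (𝒞 n)} (h : HashProperty F) :
    ∃ α β : ℕ → ℝ, Tendsto α atTop (𝓝 1) ∧ Tendsto β atTop (𝓝 0) ∧ (∀ n, 1 ≤ α n) ∧
      ∀ n, (F n).HasHashProperty (α n) (β n) := by
  obtain ⟨α, β, hα, hβ, hash⟩ := h
  refine ⟨fun n => max (α n) 1, β, ?_, hβ, fun n => le_max_right _ _,
    fun n => (hash n).mono (le_max_left _ _)⟩
  simpa using hα.max (tendsto_const_nhds (x := (1 : ℝ)))

lemma hashProperty_uniform {𝒵 𝒞 : ℕ → Type*} [∀ n, Fintype (𝒵 n)] [∀ n, DecidableEq (𝒵 n)]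
    [∀ n, Nonempty (𝒵 n)] [∀ n, Fintype (𝒞 n)] [∀ n, Nonempty (𝒞 n)] :
    HashProperty fun n => FunctionEnsemble.uniform (𝒵 n) (𝒞 n) :=
  ⟨fun _ => 1, fun _ => 0, tendsto_const_nhds, tendsto_const_nhds,
    fun _ => FunctionEnsemble.hasHashProperty_uniform⟩

section Spectrum

variable {Ω : ℕ → Type*} [∀ n, MeasurableSpace (Ω n)] {P : ∀ n, Measure (Ω n)} {U : ∀ n, Ω n → ℝ}

lemma exists_lt_of_lt_pLiminf {x : ℝ} (h : (x : EReal) < pLiminf P U) :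
    ∃ θ : ℝ, x < θ ∧ Tendsto (fun n => P n {ω | U n ω < θ}) atTop (𝓝 0) := by
  obtain ⟨_, ⟨θ, hθ, rfl⟩, hlt⟩ := lt_sSup_iff.1 h
  exact ⟨θ, EReal.coe_lt_coe_iff.1 hlt, hθ⟩

lemma exists_lt_of_pLimsup_lt {x : ℝ} (h : pLimsup P U < (x : EReal)) :
    ∃ θ : ℝ, θ < x ∧ Tendsto (fun n => P n {ω | θ < U n ω}) atTop (𝓝 0) := by
  obtain ⟨_, ⟨θ, hθ, rfl⟩, hlt⟩ := sInf_lt_iff.1 h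
  exact ⟨θ, EReal.coe_lt_coe_iff.1 hlt, hθ⟩

end Spectrum

/-! ### Limits of the loss bounds at the given rates -/

namespace BlockModel

variable {S : Type*} [Fintype S] [DecidableEq S] {C M : ℕ → S → Type*}
  [∀ n s, Fintype (C n s)] [∀ n s, Nonempty (C n s)]
  [∀ n s, Fintype (M n s)] [∀ n s, Nonempty (M n s)] {r R : S → ℝ}
  {α β α' β' : S → ℕ → ℝ}

lemma lift_nonempty {T : Finset S} {W : Finset T} (hW : W.Nonempty) : (lift W).Nonempty := hW.map

lemma sum_lift {T : Finset S} (W : Finset T) (ρ : S → ℝ) : ∑ s ∈ lift W, ρ s = ∑ s ∈ W, ρ s := by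
  simp [lift]

/-- For fixed `t` the residual divided by `t` vanishes, so only the slack `t` of the balance bound
remains; it is made small afterwards. -/
lemma tendsto_encoderTerm
    (hr : ∀ s, Tendsto (fun n : ℕ => Real.logb 2 (Fintype.card (C n s)) / n) atTop (𝓝 (r s)))
    (hR : ∀ s, Tendsto (fun n : ℕ => Real.logb 2 (Fintype.card (M n s)) / n) atTop (𝓝 (R s)))
    (hα : ∀ s, Tendsto (α s) atTop (𝓝 1)) (hβ : ∀ s, Tendsto (β s) atTop (𝓝 0))
    (hα' : ∀ s, Tendsto (α' s) atTop (𝓝 1)) (hβ' : ∀ s, Tendsto (β' s) atTop (𝓝 0))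
    (T : Finset S) {θ : Finset S → ℝ}
    (hθ : ∀ W ⊆ T, W.Nonempty → ∑ s ∈ W, (R s + r s) < θ W) (t : ℝ) :
    Tendsto (fun n : ℕ => encoderTerm (C n) (M n) T (fun s => α s n) (fun s => β s n)
      (fun s => α' s n) (fun s => β' s n) n θ t) atTop (𝓝 t) := by
  have h := tendsto_encoderResidual (ι := T)
    (N := fun n s => (Fintype.card (C n s) : ℝ) * Fintype.card (M n s))
    (α := fun n s => α s n * α' s n) (β := fun n s => β s n + β' s n)
    (ρ := fun s => R s + r s) (θ := fun W => θ (lift W))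
    (fun n s => mul_pos (by exact_mod_cast Fintype.card_pos) (by exact_mod_cast Fintype.card_pos))
    (fun s => ?_) (fun s => by simpa using (hα s).mul (hα' s))
    (fun s => by simpa using (hβ s).add (hβ' s))
    (fun W hW => by
      rw [← sum_lift W (fun s => R s + r s)]
      exact hθ _ (map_subtype_subset W) (lift_nonempty hW))
  · simpa [encoderTerm, threshold] using (h.div_const t).const_add t
  · refine ((hR s).add (hr s)).congr fun n => ?_
    have hC : (Fintype.card (C n s) : ℝ) ≠ 0 := Nat.cast_ne_zero.2 Fintype.card_ne_zero
    have hM : (Fintype.card (M n s) : ℝ) ≠ 0 := Nat.cast_ne_zero.2 Fintype.card_ne_zero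
    rw [Real.logb_mul hC hM]
    ring

lemma tendsto_decoderTerm
    (hr : ∀ s, Tendsto (fun n : ℕ => Real.logb 2 (Fintype.card (C n s)) / n) atTop (𝓝 (r s)))
    (hα : ∀ s, Tendsto (α s) atTop (𝓝 1)) (hβ : ∀ s, Tendsto (β s) atTop (𝓝 0))
    (T : Finset S) {θ : Finset S → ℝ}
    (hθ : ∀ W ⊆ T, W.Nonempty → θ W < ∑ s ∈ W, r s) :
    Tendsto (fun n : ℕ => decoderTerm (C n) T (fun s => α s n) (fun s => β s n) n θ)
      atTop (𝓝 0) :=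
  tendsto_decoderResidual (ι := T) (N := fun n s => (Fintype.card (C n s) : ℝ))
    (α := fun n s => α s n) (β := fun n s => β s n) (ρ := fun s => r s) (θ := fun W => θ (lift W))
    (fun n s => by exact_mod_cast Fintype.card_pos) (fun s => hr s) (fun s => hα s)
    (fun s => hβ s) (fun W hW => by
      rw [← sum_lift W r]
      exact hθ _ (map_subtype_subset W) (lift_nonempty hW))

end BlockModel

open BlockModel in
/-- Random coding within given ensembles. -/
theorem eventually_exists_code_of_hashProperty
    {I J S : Type*} [Fintype I] [Fintype J] [Fintype S] [DecidableEq S]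
    (S₀ : Finset S) (SI : I → Finset S) (D : J → Finset S)
    (hcover : ∀ s, s ∈ S₀ ∨ ∃ i, s ∈ SI i)
    (hdisj₀ : ∀ i, Disjoint S₀ (SI i))
    (hdisj : ∀ i i', i ≠ i' → Disjoint (SI i) (SI i'))
    (Z : ℕ → S → Type*) (X : ℕ → I → Type*) (Y : ℕ → J → Type*)
    [∀ n s, Fintype (Z n s)] [∀ n s, Nonempty (Z n s)]
    [∀ n s, MeasurableSpace (Z n s)] [∀ n s, MeasurableSingletonClass (Z n s)]
    [∀ n i, MeasurableSpace (X n i)] [∀ n j, MeasurableSpace (Y n j)]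
    (B : ∀ n, BlockModel S₀ SI (Z n) (X n) (Y n))
    (C M : ℕ → S → Type*)
    [∀ n s, Fintype (C n s)] [∀ n s, Nonempty (C n s)]
    [∀ n s, Fintype (M n s)] [∀ n s, Nonempty (M n s)]
    (r R : S → ℝ)
    (hr : ∀ s, Tendsto (fun n : ℕ => Real.logb 2 (Fintype.card (C n s)) / n) atTop (𝓝 (r s)))
    (hR : ∀ s, Tendsto (fun n : ℕ => Real.logb 2 (Fintype.card (M n s)) / n) atTop (𝓝 (R s)))
    (hcommon : ∀ T : Finset S, T.Nonempty → T ⊆ S₀ →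
      ((∑ s ∈ T, (R s + r s) : ℝ) : EReal) <
        spectralInfEntropy (fun n => (B n).jointLaw) (fun _ ω => T.restrict ω.1))
    (hprivate : ∀ i, ∀ T : Finset S, T.Nonempty → T ⊆ SI i →
      ((∑ s ∈ T, (R s + r s) : ℝ) : EReal) <
        spectralCondInfEntropy (fun n => (B n).jointLaw)
          (fun _ ω => T.restrict ω.1) (fun _ ω => S₀.restrict ω.1))
    (hdecode : ∀ j, ∀ T : Finset S, T.Nonempty → T ⊆ D j →
      spectralCondSupEntropy (fun n => (B n).jointLaw)
          (fun _ ω => T.restrict ω.1) (fun _ ω => (ω.2 j, (D j \ T).restrict ω.1)) <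
        ((∑ s ∈ T, r s : ℝ) : EReal))
    (F : ∀ s n, FunctionEnsemble (Z n s) (C n s)) (G : ∀ s n, FunctionEnsemble (Z n s) (M n s))
    (hF : ∀ s n, (F s n).image = Set.univ) (hG : ∀ s n, (G s n).image = Set.univ)
    (hashF : ∀ s, HashProperty (F s)) (hashG : ∀ s, HashProperty (G s))
    {δ : ℝ} (hδ : 0 < δ) :
    ∀ᶠ n in atTop,
      ∃ (f : ∀ s, Z n s → C n s) (g : ∀ s, Z n s → M n s) (c : ∀ s, C n s),
        (∀ s, f s ∈ (F s n).prob.support) ∧ (∀ s, g s ∈ (G s n).prob.support) ∧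
        (B n).errorProb D f g c ≤ δ := by
  classical
  choose α β hα hβ hα1 hashα using fun s => (hashF s).exists_one_le
  choose α' β' hα' hβ' hα1' hashα' using fun s => (hashG s).exists_one_le
  -- The strict rate inequality leaves room for a threshold beyond the sum of rates at which the
  -- atypical probability still vanishes. Irrelevant subsets get the dummy value 0.
  have hc : ∀ T : Finset S, ∃ θ : ℝ, T.Nonempty → T ⊆ S₀ → ∑ s ∈ T, (R s + r s) < θ ∧
      Tendsto (fun n : ℕ => (B n).jointLaw {ω | 1 / (n : ℝ) * Real.logb 2
        (1 / ((B n).jointLaw.map fun ω => T.restrict ω.1).real {T.restrict ω.1}) < θ})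
        atTop (𝓝 0) := by
    intro T
    by_cases hT : T.Nonempty ∧ T ⊆ S₀
    · obtain ⟨θ, h⟩ := exists_lt_of_lt_pLiminf (hcommon T hT.1 hT.2)
      exact ⟨θ, fun _ _ => h⟩
    · exact ⟨0, fun h1 h2 => absurd ⟨h1, h2⟩ hT⟩
  choose θ₀ hθ₀ using hc
  have hp : ∀ i, ∀ T : Finset S, ∃ θ : ℝ, T.Nonempty → T ⊆ SI i → ∑ s ∈ T, (R s + r s) < θ ∧
      Tendsto (fun n : ℕ => (B n).jointLaw {ω | 1 / (n : ℝ) * Real.logb 2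
        (1 / (condDistrib (fun ω : (∀ s, Z n s) × (∀ j, Y n j) => T.restrict ω.1)
          (fun ω => S₀.restrict ω.1) (B n).jointLaw (S₀.restrict ω.1)).real
            {T.restrict ω.1}) < θ}) atTop (𝓝 0) := by
    intro i T
    by_cases hT : T.Nonempty ∧ T ⊆ SI i
    · obtain ⟨θ, h⟩ := exists_lt_of_lt_pLiminf (hprivate i T hT.1 hT.2)
      exact ⟨θ, fun _ _ => h⟩
    · exact ⟨0, fun h1 h2 => absurd ⟨h1, h2⟩ hT⟩
  choose θI hθI using hp
  have hd : ∀ j, ∀ T : Finset S, ∃ θ : ℝ, T.Nonempty → T ⊆ D j → θ < ∑ s ∈ T, r s ∧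
      Tendsto (fun n : ℕ => (B n).jointLaw {ω | θ < 1 / (n : ℝ) * Real.logb 2
        (1 / (condDistrib (fun ω : (∀ s, Z n s) × (∀ j, Y n j) => T.restrict ω.1)
          (fun ω => (ω.2 j, (D j \ T).restrict ω.1)) (B n).jointLaw
          (ω.2 j, (D j \ T).restrict ω.1)).real {T.restrict ω.1})}) atTop (𝓝 0) := by
    intro j T
    by_cases hT : T.Nonempty ∧ T ⊆ D j
    · obtain ⟨θ, h⟩ := exists_lt_of_pLimsup_lt (hdecode j T hT.1 hT.2)
      exact ⟨θ, fun _ _ => h⟩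
    · exact ⟨0, fun h1 h2 => absurd ⟨h1, h2⟩ hT⟩
  choose θD hθD using hd
  -- Each of the `|I| + 1` encoder terms tends to `t` and everything else to 0, so the total tends
  -- to `(|I| + 1) * t`, strictly below `δ`.
  set t : ℝ := δ / (Fintype.card I + 2) with ht
  have ht0 : 0 < t := by positivity
  have lim₀ := (tendsto_finsetSum (nonemptySubsets S₀) fun T hT =>
    (hθ₀ T (mem_nonemptySubsets.1 hT).1 (mem_nonemptySubsets.1 hT).2).2).add
    (ENNReal.tendsto_ofReal (tendsto_encoderTerm hr hR hα hβ hα' hβ' S₀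
      (fun W hW hne => (hθ₀ W hne hW).1) t))
  have limI := tendsto_finsetSum (Finset.univ : Finset I) fun i _ =>
    (tendsto_finsetSum (nonemptySubsets (SI i)) fun T hT =>
    (hθI i T (mem_nonemptySubsets.1 hT).1 (mem_nonemptySubsets.1 hT).2).2).add
    (ENNReal.tendsto_ofReal (tendsto_encoderTerm hr hR hα hβ hα' hβ' (SI i)
      (fun W hW hne => (hθI i W hne hW).1) t))
  have limJ := tendsto_finsetSum (Finset.univ : Finset J) fun j _ =>
    (ENNReal.Tendsto.const_mul (a := 2) (tendsto_finsetSum (nonemptySubsets (D j)) fun T hT =>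
    (hθD j T (mem_nonemptySubsets.1 hT).1 (mem_nonemptySubsets.1 hT).2).2)
      (Or.inr ENNReal.ofNat_ne_top)).add
    (ENNReal.tendsto_ofReal (tendsto_decoderTerm hr hα hβ (D j)
      (fun W hW hne => (hθD j W hne hW).1)))
  have lim := (lim₀.add limI).add limJ
  have hlt : ENNReal.ofReal t + ∑ _i : I, ENNReal.ofReal t < ENNReal.ofReal δ := by
    rw [← ENNReal.ofReal_sum_of_nonneg fun _ _ => ht0.le, ← ENNReal.ofReal_add ht0.le (by positivity)]
    refine (ENNReal.ofReal_lt_ofReal_iff hδ).2 ?_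
    have : δ = t * (Fintype.card I + 2) := by rw [ht]; field_simp
    rw [Finset.sum_const, Finset.card_univ, nsmul_eq_mul]
    linarith
  filter_upwards [lim.eventually_lt_const (by simpa using hlt), eventually_gt_atTop 0]
    with n hn hn0
  have hn0' : (0 : ℝ) < n := Nat.cast_pos.2 hn0
  refine exists_code_of_expected_le hcover hdisj₀ hdisj (B n) D hδ.le
    (F := fun s => F s n) (G := fun s => G s n) (le_trans ?_ hn.le)
  rw [expected_totalLoss]
  refine add_le_add (add_le_add ?_ (Finset.sum_le_sum fun i _ => ?_))
    (Finset.sum_le_sum fun j _ => ?_)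
  · refine (expected_commonLoss_le hcover hdisj₀ hdisj (B n) (fun s => hα1 s n)
      (fun s => hα1' s n) (fun s => hF s n) (fun s => hG s n) (fun s => hashα s n)
      (fun s => hashα' s n) n θ₀ ht0).trans (add_le_add ?_ le_rfl)
    exact commonSource_compl_commonTypical_le hcover hdisj₀ hdisj (B n) hn0' θ₀
  · refine (expected_privateLoss_le hcover hdisj₀ hdisj (B n) (fun s => hα1 s n)
      (fun s => hα1' s n) (fun s => hF s n) (fun s => hG s n) (fun s => hashα s n)
      (fun s => hashα' s n) i n (θI i) ht0).trans (add_le_add ?_ le_rfl)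
    exact lintegral_compl_privateTypical_le hcover hdisj₀ hdisj (B n) i hn0' (θI i)
  · refine (expected_posteriorLoss_le (B n) (fun s => hα1 s n) (fun s => hF s n)
      (fun s => hashα s n) (isProbabilityMeasure_jointLaw hcover hdisj₀ hdisj (B n))
      (D j) j n (θD j)).trans (add_le_add (mul_le_mul_right ?_ _) le_rfl)
    exact lintegral_compl_posteriorTypical_le (B n) (D j) j hn0' (θD j)

end

theorem mainTheorem2
    {I J S : Type*} [Fintype I] [Fintype J] [Fintype S] [DecidableEq S]
    (S₀ : Finset S) (SI : I → Finset S) (D : J → Finset S)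
    (hcover : ∀ s, s ∈ S₀ ∨ ∃ i, s ∈ SI i)
    (hdisj₀ : ∀ i, Disjoint S₀ (SI i))
    (hdisj : ∀ i i', i ≠ i' → Disjoint (SI i) (SI i'))
    (Z : ℕ → S → Type*) (X : ℕ → I → Type*) (Y : ℕ → J → Type*)
    [∀ n s, Fintype (Z n s)] [∀ n s, Nonempty (Z n s)]
    [∀ n s, MeasurableSpace (Z n s)] [∀ n s, MeasurableSingletonClass (Z n s)]
    [∀ n i, MeasurableSpace (X n i)] [∀ n j, MeasurableSpace (Y n j)]
    (B : ∀ n, BlockModel S₀ SI (Z n) (X n) (Y n))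
    (C M : ℕ → S → Type*)
    [∀ n s, Fintype (C n s)] [∀ n s, Nonempty (C n s)]
    [∀ n s, Fintype (M n s)] [∀ n s, Nonempty (M n s)]
    (r R : S → ℝ)
    (hr : ∀ s, Tendsto (fun n : ℕ => Real.logb 2 (Fintype.card (C n s)) / n) atTop (𝓝 (r s)))
    (hR : ∀ s, Tendsto (fun n : ℕ => Real.logb 2 (Fintype.card (M n s)) / n) atTop (𝓝 (R s)))
    (hcommon : ∀ T : Finset S, T.Nonempty → T ⊆ S₀ →
      ((∑ s ∈ T, (R s + r s) : ℝ) : EReal) <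
        spectralInfEntropy (fun n => (B n).jointLaw) (fun _ ω => T.restrict ω.1))
    (hprivate : ∀ i, ∀ T : Finset S, T.Nonempty → T ⊆ SI i →
      ((∑ s ∈ T, (R s + r s) : ℝ) : EReal) <
        spectralCondInfEntropy (fun n => (B n).jointLaw)
          (fun _ ω => T.restrict ω.1) (fun _ ω => S₀.restrict ω.1))
    (hdecode : ∀ j, ∀ T : Finset S, T.Nonempty → T ⊆ D j →
      spectralCondSupEntropy (fun n => (B n).jointLaw)
          (fun _ ω => T.restrict ω.1) (fun _ ω => (ω.2 j, (D j \ T).restrict ω.1)) <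
        ((∑ s ∈ T, r s : ℝ) : EReal)) :
    (∀ δ : ℝ, 0 < δ → ∀ᶠ n in atTop,
      ∃ (f : ∀ s, Z n s → C n s) (g : ∀ s, Z n s → M n s) (c : ∀ s, C n s),
        (B n).errorProb D f g c ≤ δ) ∧
    (∀ (F : ∀ s n, FunctionEnsemble (Z n s) (C n s))
       (G : ∀ s n, FunctionEnsemble (Z n s) (M n s)),
      (∀ s n, (F s n).image = Set.univ) → (∀ s n, (G s n).image = Set.univ) →
      (∀ s, HashProperty (F s)) → (∀ s, HashProperty (G s)) →
      ∀ δ : ℝ, 0 < δ → ∀ᶠ n in atTop,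
        ∃ (f : ∀ s, Z n s → C n s) (g : ∀ s, Z n s → M n s) (c : ∀ s, C n s),
          (∀ s, f s ∈ (F s n).prob.support) ∧ (∀ s, g s ∈ (G s n).prob.support) ∧
          (B n).errorProb D f g c ≤ δ) := by
  classical
  have key := fun F G hF hG hashF hashG (δ : ℝ) (hδ : 0 < δ) =>
    eventually_exists_code_of_hashProperty S₀ SI D hcover hdisj₀ hdisj Z X Y B C M r R hr hR
      hcommon hprivate hdecode F G hF hG hashF hashG hδ
  refine ⟨fun δ hδ => ?_, key⟩
  -- Under the uniform ensemble distinct points collide with probability exactly `1/|C|`, so it has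
  -- the hash property with `α = 1` and `β = 0`.
  refine (key (fun s n => FunctionEnsemble.uniform (Z n s) (C n s))
    (fun s n => FunctionEnsemble.uniform (Z n s) (M n s))
    (fun _ _ => FunctionEnsemble.image_uniform) (fun _ _ => FunctionEnsemble.image_uniform)
    (fun _ => hashProperty_uniform) (fun _ => hashProperty_uniform) δ hδ).mono ?_
  rintro n ⟨f, g, c, -, -, h⟩
  exact ⟨f, g, c, h⟩
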